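/- Graphs are finite and simple, and $|G|$ denotes the number of vertices of $G$. For disjoint sets $X,Y\subseteq V(G)$, $X$ *covers* $Y$ if every vertex of $Y$ has a neighbour in $X$, and $X$ is *anticomplete* to $Y$ if there are no edges between $X$ and $Y$. A *blockade* in $G$ is a family $\mathcal{A}=(A_i:i\in I)$ of nonempty pairwise disjoint subsets of $V(G)$ (its *blocks*), where $I$ is a finite set of integers; its *length* is $|I|$. Its *linkage* is the maximum, over all distinct $i,j\in I$ and all $v\in A_i$, of $|N(v)\cap A_j|/|A_j|$ (and $0$ if $|I|\le 1$). For $\gamma,\delta\ge 0$, it is *$(\gamma,\delta)$-divergent* if there are distinct $i,j\in I$ and $X\subseteq A_i$, $Y\subseteq A_j$ with $|X|\ge\gamma|A_i|$ and $|Y|\ge\delta|A_j|$ such that $X$ is anticomplete to $Y$. If $\mathcal{B}$ is a blockade each of whose blocks is included in a block of $\mathcal{A}$, the *$\mathcal{A}$-size* of $\mathcal{B}$ is the minimum of $|B|/|A|$ over the blocks $B$ of $\mathcal{B}$, where $A$ is the block of $\mathcal{A}$ including $B$. A *levelling* in $G$ of *height* $p\ge 1$ is a sequence $\mathcal{L}=(L_0,\ldots,L_p)$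 of pairwise disjoint subsets of $V(G)$ such that $|L_0|=1$, $L_{i-1}$ covers $L_i$ for $1\le i\le p$, and $L_0\cup\cdots\cup L_{i-2}$ is anticomplete to $L_i$ for $2\le i\le p$. It *reaches* $C\subseteq V(G)$ if $(L_0,\ldots,L_p,C)$ is a levelling. Let $\mathcal{B}=(B_j:j\in J)$ be a blockade. We say $\mathcal{L}$ *grades $\mathcal{B}$ forwards* (respectively *backwards*) if $\mathcal{L}$ reaches $\bigcup_{j\in J}B_j$ and for each $j\in J$ there is $Y\subseteq L_p$ that covers $\bigcup_{i\in J,\,i\ge j}B_i$ and is anticomplete to $\bigcup_{i\in J,\,i<j}B_i$ (respectively covers $\bigcup_{i\in J,\,i\le j}B_i$ and is anticomplete to $\bigcup_{i\in J,\,i>j}B_i$). A *bi-grading* in $G$ is a triple $(\mathcal{L},\mathcal{M},\mathcal{B})$ where $\mathcal{B}=(B_j:j\in J)$ is a blockade, and $\mathcal{L}=(L_0,\ldots,L_p)$ and $\mathcal{M}=(M_0,\ldots,M_m)$ are levellings such that $L_0=M_0$, the set $M_1\cup\cdots\cup M_m$ is disjoint from and anticomplete to $L_1\cup\cdots\cup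 L_p$, $\mathcal{L}$ grades $\mathcal{B}$ forwards, and $\mathcal{M}$ grades $\mathcal{B}$ backwards. Its *length* is $|J|$ and its *height* is $p+m$. It is *$\mathcal{A}$-rainbow*, for a blockade $\mathcal{A}=(A_i:i\in I)$, if each of the sets $B_j\ (j\in J)$, $L_j\ (0\le j\le p)$, $M_j\ (1\le j\le m)$ is included in some $A_i$, and each $A_i$ includes at most one of these sets. **Theorem.** Let $\ell$ be an integer and let $c>0$ be real, such that $\ell\ge 3\lceil 1/c\rceil+1$. Let $k\ge 1$ be an integer, and let $0<d,\lambda'\le 1$. Then there exist an integer $K\ge 1$ and a real $\lambda>0$ with the following property. Let $G$ be a graph and let $\mathcal{A}$ be a blockade in $G$ of length $K$, with linkage at most $\lambda$, that is not $(2^{-6-2\ell}/K,\;K^{-K}|G|^{-c})$-divergent. Then there is an $\mathcal{A}$-rainbow bi-grading $(\mathcal{L},\mathcal{M},\mathcal{B})$ in $G$ with length $k$ and height $\ell$, such that $\mathcal{B}$ has $\mathcal{A}$-size at least $2^{-k-2\ell}K^{-K}|G|^{-d}$ and linkage at most $\lambda'$. -/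

import Mathlib

open scoped NNReal

/-- `A` covers `B`: every vertex of `B` has a neighbour in `A`
(only ever used below for disjoint `A`, `B`). -/
def Covers {V : Type*} (G : SimpleGraph V) (A B : Finset V) : Prop :=
  ∀ b ∈ B, ∃ a ∈ A, G.Adj a b

/-- `A` is anticomplete to `B`: there is no edge between `A` and `B`
(only ever used below for disjoint `A`, `B`). -/
def Anticomplete {V : Type*} (G : SimpleGraph V) (A B : Finset V) : Prop :=
  ∀ a ∈ A, ∀ b ∈ B, ¬ G.Adj a b

open Classical in
/-- The max-degree from `A` to `B`: the maximum over `v ∈ A` of the number of neighbours of `v`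
in `B`. -/
noncomputable def maxDegreeTo {V : Type*} (G : SimpleGraph V) (A B : Finset V) : ℕ :=
  A.sup fun v => (B.filter fun w => G.Adj v w).card

/-- A blockade: a family of nonempty pairwise disjoint vertex sets, indexed by a finite set `I` of
integers. The values of `block` outside `I` play no role. -/
structure Blockade (V : Type*) where
  I : Finset ℤ
  block : ℤ → Finset V
  nonempty : ∀ i ∈ I, (block i).Nonempty
  disjoint : ∀ i ∈ I, ∀ j ∈ I, i ≠ j → Disjoint (block i) (block j)

/-- The length of a blockade is its number of blocks. -/
def Blockade.length {V : Type*} (𝓑 : Blockade V) : ℕ := 𝓑.I.card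

open Classical in
/-- The union of those blocks of a blockade whose index satisfies `p`. -/
noncomputable def Blockade.unionOf {V : Type*} (𝓑 : Blockade V) (p : ℤ → Prop) : Finset V :=
  (𝓑.I.filter p).biUnion 𝓑.block

/-- The union of all blocks of a blockade. -/
noncomputable def Blockade.verts {V : Type*} (𝓑 : Blockade V) : Finset V :=
  𝓑.unionOf fun _ => True

/-- The linkage of a blockade: the maximum over all distinct indices `i`, `j` of
`d i j / |B j|`, where `d i j` is the max-degree from `B i` to `B j` (zero if there is at most one
block, the supremum of the empty set in `ℝ≥0` being zero). -/
noncomputable def Blockade.linkage {V : Type*} (G : SimpleGraph V) (𝓑 : Blockade V) : ℝ :=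
  ((𝓑.I.offDiag.sup fun p =>
    (maxDegreeTo G (𝓑.block p.1) (𝓑.block p.2) : ℝ≥0) / ((𝓑.block p.2).card : ℝ≥0) : ℝ≥0) : ℝ)

/-- `(γ, δ)`-divergence of a blockade. -/
def Blockade.Divergent {V : Type*} (G : SimpleGraph V) (𝓐 : Blockade V) (γ δ : ℝ) : Prop :=
  ∃ i ∈ 𝓐.I, ∃ j ∈ 𝓐.I, i ≠ j ∧ ∃ X ⊆ 𝓐.block i, ∃ Y ⊆ 𝓐.block j,
    γ * ((𝓐.block i).card : ℝ) ≤ (X.card : ℝ) ∧ δ * ((𝓐.block j).card : ℝ) ≤ (Y.card : ℝ) ∧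
    Anticomplete G X Y

open Classical in
/-- The `𝓐`-size of a set `X` of vertices: `|X| / |A|` if `X ⊆ A` for some block `A` of `𝓐`.
For nonempty `X` there is at most one such block, as the blocks are disjoint; if there is
none the value is zero. -/
noncomputable def Blockade.sizeOfSet {V : Type*} (𝓐 : Blockade V) (X : Finset V) : ℝ :=
  (((𝓐.I.filter fun i => X ⊆ 𝓐.block i).sup fun i =>
    (X.card : ℝ≥0) / ((𝓐.block i).card : ℝ≥0) : ℝ≥0) : ℝ)

/-- The `𝓐`-size of a blockade `𝓑`: the minimum of the `𝓐`-sizes of the blocks of `𝓑`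
(only used for blockades with at least one block). -/
noncomputable def Blockade.sizeOf {V : Type*} (𝓐 𝓑 : Blockade V) : ℝ :=
  ⨅ j : 𝓑.I, 𝓐.sizeOfSet (𝓑.block j)

/-- `(L 0, …, L k)` is a levelling in `G`. The values `L i` with `i > k` play no role. -/
structure IsLevelling {V : Type*} (G : SimpleGraph V) (k : ℕ) (L : ℕ → Finset V) : Prop where
  one_le : 1 ≤ k
  disjoint : ∀ i j, i ≤ k → j ≤ k → i ≠ j → Disjoint (L i) (L j)
  card_zero : (L 0).card = 1
  covers : ∀ i, 1 ≤ i → i ≤ k → Covers G (L (i - 1)) (L i)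
  anticomplete : ∀ i j, 2 ≤ i → i ≤ k → j ≤ i - 2 → Anticomplete G (L j) (L i)

/-- A levelling `(L 0, …, L k)` in `G`, of height `k`. Its base is `L k`. -/
structure Levelling {V : Type*} (G : SimpleGraph V) where
  height : ℕ
  level : ℕ → Finset V
  isLevelling : IsLevelling G height level

/-- The base of a levelling. -/
def Levelling.base {V : Type*} {G : SimpleGraph V} (𝓛 : Levelling G) : Finset V :=
  𝓛.level 𝓛.height

/-- `(L 0, …, L k)` reaches `C` if `(L 0, …, L k, C)` is a levelling. -/
def Levelling.Reaches {V : Type*} {G : SimpleGraph V} (𝓛 : Levelling G) (C : Finset V) : Prop :=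
  IsLevelling G (𝓛.height + 1) (Function.update 𝓛.level (𝓛.height + 1) C)

/-- `𝓛` grades `𝓑` forwards. -/
def Levelling.GradesForwards {V : Type*} {G : SimpleGraph V} (𝓛 : Levelling G)
    (𝓑 : Blockade V) : Prop :=
  𝓛.Reaches 𝓑.verts ∧ ∀ j ∈ 𝓑.I, ∃ Y ⊆ 𝓛.base,
    Covers G Y (𝓑.unionOf fun i => j ≤ i) ∧ Anticomplete G Y (𝓑.unionOf fun i => i < j)

/-- `𝓜` grades `𝓑` backwards. -/
def Levelling.GradesBackwards {V : Type*} {G : SimpleGraph V} (𝓜 : Levelling G)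
    (𝓑 : Blockade V) : Prop :=
  𝓜.Reaches 𝓑.verts ∧ ∀ j ∈ 𝓑.I, ∃ Y ⊆ 𝓜.base,
    Covers G Y (𝓑.unionOf fun i => i ≤ j) ∧ Anticomplete G Y (𝓑.unionOf fun i => j < i)

/-- Two levellings are parallel if they have the same apex and, apart from it, they are disjoint
from and anticomplete to each other. -/
def Levelling.Parallel {V : Type*} {G : SimpleGraph V} (𝓛 𝓜 : Levelling G) : Prop :=
  𝓛.level 0 = 𝓜.level 0 ∧
    ∀ i j, 1 ≤ i → i ≤ 𝓜.height → 1 ≤ j → j ≤ 𝓛.height →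
      Disjoint (𝓜.level i) (𝓛.level j) ∧ Anticomplete G (𝓜.level i) (𝓛.level j)

/-- `(𝓛, 𝓜, 𝓒)` is a bi-levelling in `G`. -/
structure IsBiLevelling {V : Type*} {G : SimpleGraph V} (𝓛 𝓜 : Levelling G)
    (𝓒 : Blockade V) : Prop where
  parallel : 𝓛.Parallel 𝓜
  reaches_left : 𝓛.Reaches 𝓒.verts
  reaches_right : 𝓜.Reaches 𝓒.verts
  forwards : 𝓛.GradesForwards 𝓒

/-- A bi-grading is a bi-levelling whose second levelling grades the blockade backwards. -/
structure IsBiGrading {V : Type*} {G : SimpleGraph V} (𝓛 𝓜 : Levelling G)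
    (𝓒 : Blockade V) : Prop where
  biLevelling : IsBiLevelling 𝓛 𝓜 𝓒
  backwards : 𝓜.GradesBackwards 𝓒

/-- The constituent sets of a bi-levelling: the blocks of `𝓒`, the levels `L 0, …, L k` and the
levels `M 1, …, M m` (recall that `M 0 = L 0`). -/
def constituents {V : Type*} {G : SimpleGraph V} (𝓛 𝓜 : Levelling G) (𝓒 : Blockade V) :
    Set (Finset V) :=
  {X | (∃ j ∈ 𝓒.I, X = 𝓒.block j) ∨ (∃ i, i ≤ 𝓛.height ∧ X = 𝓛.level i) ∨
    ∃ i, 1 ≤ i ∧ i ≤ 𝓜.height ∧ X = 𝓜.level i}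

/-- `(𝓛, 𝓜, 𝓒)` is `𝓐`-rainbow: each constituent set is included in a block of `𝓐`, and each
block of `𝓐` includes at most one of the constituent sets. -/
def IsRainbow {V : Type*} {G : SimpleGraph V} (𝓐 : Blockade V) (𝓛 𝓜 : Levelling G)
    (𝓒 : Blockade V) : Prop :=
  (∀ X ∈ constituents 𝓛 𝓜 𝓒, ∃ i ∈ 𝓐.I, X ⊆ 𝓐.block i) ∧
    ∀ i ∈ 𝓐.I, ∀ X ∈ constituents 𝓛 𝓜 𝓒, ∀ Y ∈ constituents 𝓛 𝓜 𝓒,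
      X ⊆ 𝓐.block i → Y ⊆ 𝓐.block i → X = Y

/-! Write n for |G|, x = n^c and t = ⌈1/c⌉, so that x^t ≥ n. Non-divergence enters only as expansion
(`Sparse`): a part of a block of proportion at least ε/x has neighbours in all but a proportion ε of
every other block. Suppose a set Z reaches a part of proportion ε/x of some block. Then it reaches
far more than that in a further block, so about 1/x of Z already reaches a proportion ε/x there.
After t such steps a single vertex is left, and it reaches nearly all of every other block via t
blocks (`Sparse.exists_reach`). Sorting vertices by the level nearest the apex in which they have a
neighbour turns such walks into a levelling, at a bounded loss (`grow`).

A bi-levelling of height at most 3t+1 is then built (`exists_biLev`). Take a vertex v that reaches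
nearly everything in two disjoint ways. A levelling grown from v along the first way yields induced
paths from v to the vertices y of one block; a second levelling is grown from v inside what the
first one misses. Sets missed by both form a third way, and some y reaches nearly everything along
it. The second levelling hangs from a vertex s of the path between v and y, and s becomes the apex:
one arm follows the path from s to y and continues along the third way, the other arm is the second
levelling.

The remaining steps use a finer scale y = n^{d₀} with d₀ = min d c and y^J ≥ n. For each reached set
there is a scale z = y^j such that z·y vertices of the base cover a part of it, while z vertices
cover only a small proportion (`exists_rate`), and pigeonhole makes z common to many blocks. Cutting
a cover into about y pieces of at most z vertices gives pieces that are useful for one block and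
nearly harmless for all others. This raises the height by one (`BiLev.extend`), as often as needed
to make it ℓ. For the final grading, peeling the left base grades forwards
(`Sparse.exists_grading`). On the right, a union bound picks one piece per block (`exists_select`)
so that, after trimming, each piece covers its own block and sees no other; unions of initial
segments of pieces grade backwards. Only the last cut costs a factor y, whence the size n^{-d};
every other loss depends only on ℓ, c, d, k and λ', and K is chosen to absorb it. -/

namespace BiGrade

universe u v

/-! ### Levellings as lists of indexed sets, base first and apex last. -/

section

variable {V : Type*} {ι : Type*} {G : SimpleGraph V}

open Classical in
/-- The vertices of `C` with a neighbour in `S`. -/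
noncomputable def nbr (G : SimpleGraph V) (S C : Finset V) : Finset V :=
  C.filter fun c => ∃ s ∈ S, G.Adj s c

open Classical in
/-- The vertices of `C` without neighbours in `S`. -/
noncomputable def nonNbr (G : SimpleGraph V) (S C : Finset V) : Finset V :=
  C.filter fun c => ¬ ∃ s ∈ S, G.Adj s c

theorem mem_nbr {S C : Finset V} {c : V} : c ∈ nbr G S C ↔ c ∈ C ∧ ∃ s ∈ S, G.Adj s c := by
  classical
  simp [nbr]

theorem mem_nonNbr {S C : Finset V} {c : V} :
    c ∈ nonNbr G S C ↔ c ∈ C ∧ ∀ s ∈ S, ¬ G.Adj s c := by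
  classical
  simp [nonNbr]

theorem nbr_subset (S C : Finset V) : nbr G S C ⊆ C := by
  classical
  exact Finset.filter_subset _ _

theorem nonNbr_subset (S C : Finset V) : nonNbr G S C ⊆ C := by
  classical
  exact Finset.filter_subset _ _

theorem card_nbr_add_card_nonNbr (S C : Finset V) :
    (nbr G S C).card + (nonNbr G S C).card = C.card := by
  classical
  exact Finset.card_filter_add_card_filter_not _

theorem nbr_mono {S S' C C' : Finset V} (hS : S ⊆ S') (hC : C ⊆ C') :
    nbr G S C ⊆ nbr G S' C' := by
  intro c hc
  rw [mem_nbr] at hc ⊢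
  obtain ⟨h, s, hs, hsc⟩ := hc
  exact ⟨hC h, s, hS hs, hsc⟩

theorem nonNbr_mono {S C C' : Finset V} (hC : C ⊆ C') : nonNbr G S C ⊆ nonNbr G S C' := by
  intro c hc
  rw [mem_nonNbr] at hc ⊢
  exact ⟨hC hc.1, hc.2⟩

theorem covers_nbr (S C : Finset V) : Covers G S (nbr G S C) := fun _ hb => (mem_nbr.1 hb).2

theorem anticomplete_nonNbr (S C : Finset V) : Anticomplete G S (nonNbr G S C) :=
  fun a ha _ hb => (mem_nonNbr.1 hb).2 a ha

theorem anticomplete_mono {X X' Y Y' : Finset V} (h : Anticomplete G X Y) (hX : X' ⊆ X)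
    (hY : Y' ⊆ Y) : Anticomplete G X' Y' := fun a ha b hb => h a (hX ha) b (hY hb)

theorem anticomplete_symm {X Y : Finset V} (h : Anticomplete G X Y) : Anticomplete G Y X :=
  fun a ha b hb hab => h b hb a ha hab.symm

theorem covers_mono {X X' Y Y' : Finset V} (h : Covers G X Y) (hX : X ⊆ X') (hY : Y' ⊆ Y) :
    Covers G X' Y' := fun b hb =>
  let ⟨a, ha, hab⟩ := h b (hY hb)
  ⟨a, hX ha, hab⟩

theorem nbr_eq_of_covers {S C : Finset V} (h : Covers G S C) : nbr G S C = C :=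
  (nbr_subset _ _).antisymm fun c hc => mem_nbr.2 ⟨hc, h c hc⟩

/-- The set of vertices reached from `S` by stepping successively into the sets of a list. -/
noncomputable def reach (G : SimpleGraph V) : Finset V → List (ι × Finset V) → Finset V
  | S, [] => S
  | S, u :: U => reach G (nbr G S u.2) U

theorem reach_append_singleton (S : Finset V) (U : List (ι × Finset V)) (u : ι × Finset V) :
    reach G S (U ++ [u]) = nbr G (reach G S U) u.2 := by
  induction U generalizing S with
  | nil => rfl
  | cons a U ih => exact ih _

theorem reach_mono {S S' : Finset V} (U : List (ι × Finset V)) (h : S ⊆ S') :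
    reach G S U ⊆ reach G S' U := by
  induction U generalizing S S' with
  | nil => exact h
  | cons a U ih => exact ih (nbr_mono h (Finset.Subset.refl _))

theorem exists_mem_reach {S : Finset V} {U : List (ι × Finset V)} {c : V}
    (h : c ∈ reach G S U) : ∃ s ∈ S, c ∈ reach G {s} U := by
  induction U generalizing S with
  | nil => exact ⟨c, h, by simp [reach]⟩
  | cons a U ih =>
    obtain ⟨y, hy, hc⟩ := ih h
    obtain ⟨hya, s, hs, hsy⟩ := mem_nbr.1 hy
    refine ⟨s, hs, reach_mono U ?_ hc⟩
    rw [Finset.singleton_subset_iff, mem_nbr]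
    exact ⟨hya, s, by simp, hsy⟩

/-- A list of vertex sets, the last of which is listed first, forms a levelling: each set covers
the one before it in the list, and is anticomplete to all the sets before that. -/
def Lev (G : SimpleGraph V) : List (ι × Finset V) → Prop
  | [] => True
  | [_] => True
  | b :: a :: l => Covers G a.2 b.2 ∧ (∀ x ∈ l, Anticomplete G x.2 b.2) ∧ Lev G (a :: l)

theorem Lev.tail {a : ι × Finset V} {l : List (ι × Finset V)} (h : Lev G (a :: l)) :
    Lev G l := by
  cases l with
  | nil => trivial
  | cons b l => exact h.2.2

theorem Lev.of_suffix {l l' : List (ι × Finset V)} (h : Lev G l) (hs : l' <:+ l) : Lev G l' := by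
  obtain ⟨p, rfl⟩ := hs
  induction p with
  | nil => exact h
  | cons a p ih => exact ih (Lev.tail h)

theorem Lev.of_prefix {l l' : List (ι × Finset V)} (h : Lev G (l ++ l')) : Lev G l := by
  induction l with
  | nil => trivial
  | cons b l ih =>
    cases l with
    | nil => trivial
    | cons a l =>
      exact ⟨h.1, fun x hx => h.2.1 x (List.mem_append_left _ hx), ih h.2.2⟩

theorem Lev.replace_head {b b' : ι × Finset V} {l : List (ι × Finset V)} (h : Lev G (b :: l))
    (hb : b'.2 ⊆ b.2) : Lev G (b' :: l) := by
  cases l with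
  | nil => trivial
  | cons a l =>
    exact ⟨covers_mono h.1 (Finset.Subset.refl _) hb,
      fun x hx => anticomplete_mono (h.2.1 x hx) (Finset.Subset.refl _) hb, h.2.2⟩

/-- Shrinking the second set can destroy only the covering of the head, which is therefore assumed
afresh. -/
theorem Lev.replace_second {b b' a a' : ι × Finset V} {l : List (ι × Finset V)}
    (h : Lev G (b :: a :: l)) (hb : b'.2 ⊆ b.2) (ha : a'.2 ⊆ a.2) (hc : Covers G a'.2 b'.2) :
    Lev G (b' :: a' :: l) :=
  ⟨hc, fun x hx => anticomplete_mono (h.2.1 x hx) (Finset.Subset.refl _) hb, h.2.2.replace_head ha⟩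

theorem Lev.anticomplete_append {l l' : List (ι × Finset V)} {s : ι × Finset V}
    (h : Lev G (l ++ s :: l')) : ∀ x ∈ l, ∀ y ∈ l', Anticomplete G y.2 x.2 := by
  induction l with
  | nil => simp
  | cons b l ih =>
    intro x hx y hy
    rcases List.mem_cons.1 hx with rfl | hx
    · cases l with
      | nil => exact h.2.1 y hy
      | cons a l => exact h.2.1 y (by simp [hy])
    · exact ih (Lev.tail h) x hx y hy

/-- Gluing at a shared set `s`: coverings and all pairs on one side, including those with `s`, are
settled by the two levellings, so only pairs straddling `s` remain. -/
theorem Lev.append {l l' : List (ι × Finset V)} {s : ι × Finset V} (h : Lev G (l ++ [s]))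
    (h' : Lev G (s :: l')) (hc : ∀ x ∈ l, ∀ y ∈ l', Anticomplete G y.2 x.2) :
    Lev G (l ++ s :: l') := by
  induction l with
  | nil => exact h'
  | cons b l ih =>
    have ih' := ih (Lev.tail h) fun x hx => hc x (List.mem_cons_of_mem _ hx)
    cases l with
    | nil => exact ⟨h.1, fun y hy => hc b (by simp) y hy, ih'⟩
    | cons a l =>
      refine ⟨h.1, fun y hy => ?_, ih'⟩
      rcases List.mem_append.1 hy with hy | hy
      · exact h.2.1 y (List.mem_append_left _ hy)
      · rcases List.mem_cons.1 hy with rfl | hy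
        · exact h.2.1 y (by simp)
        · exact hc b (by simp) y hy

/-- Between singletons covering is adjacency, hence symmetric: such a levelling is an induced path
and may be read from either end. -/
theorem Lev.reverse {l : List (ι × Finset V)} (h : Lev G l) (hs : ∀ p ∈ l, p.2.card = 1) :
    Lev G l.reverse := by
  induction l with
  | nil => trivial
  | cons b l ih =>
    have ih' := ih h.tail fun p hp => hs p (List.mem_cons_of_mem _ hp)
    cases l with
    | nil => trivial
    | cons a l =>
      rw [List.reverse_cons] at ih'
      rw [List.reverse_cons, List.reverse_cons, List.append_assoc]
      refine Lev.append ih' ⟨?_, by simp, trivial⟩ ?_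
      · obtain ⟨u, hu⟩ := Finset.card_eq_one.1 (hs a (by simp))
        obtain ⟨w, hw⟩ := Finset.card_eq_one.1 (hs b (by simp))
        have := h.1
        rw [hu, hw] at this
        rw [hu, hw]
        obtain ⟨a', ha', hadj⟩ := this w (by simp)
        rw [Finset.mem_singleton] at ha'
        subst ha'
        intro z hz
        rw [Finset.mem_singleton] at hz
        subst hz
        exact ⟨w, by simp, hadj.symm⟩
      · intro x hx y hy
        have hy' : y ∈ [b] := hy
        rw [List.mem_singleton] at hy'
        subst hy'
        exact anticomplete_symm (h.2.1 x (by simpa using hx))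

theorem Lev.head_subset_reach {l : List (ι × Finset V)} {b s : ι × Finset V}
    (h : Lev G (b :: (l ++ [s]))) : b.2 ⊆ reach G s.2 (l.reverse ++ [b]) := by
  induction l generalizing b with
  | nil =>
    intro c hc
    exact mem_nbr.2 ⟨hc, h.1 c hc⟩
  | cons a l ih =>
    intro c hc
    rw [reach_append_singleton, mem_nbr]
    obtain ⟨y, hy, hyc⟩ := h.1 c hc
    refine ⟨hc, y, ?_, hyc⟩
    rw [List.reverse_cons]
    exact ih h.2.2 hy

/-- Walking towards the apex, one neighbour per level, gives an induced path because non-consecutive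
levels are anticomplete. The indices are kept, so each vertex still records its block. -/
theorem Lev.exists_path {l : List (ι × Finset V)} {d : ι × Finset V} (h : Lev G (d :: l))
    {w : V} (hw : w ∈ d.2) :
    ∃ l' : List (ι × Finset V), Lev G ((d.1, {w}) :: l') ∧
      List.Forall₂ (fun p q => p.1 = q.1 ∧ p.2 ⊆ q.2 ∧ p.2.card = 1) l' l := by
  induction l generalizing d w with
  | nil => exact ⟨[], trivial, List.Forall₂.nil⟩
  | cons a l ih =>
    obtain ⟨y, hy, hyw⟩ := h.1 w hw
    obtain ⟨l', hl', hf⟩ := ih h.2.2 hy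
    refine ⟨(a.1, {y}) :: l', ⟨?_, ?_, hl'⟩, List.Forall₂.cons ⟨rfl, by simpa using hy, by simp⟩ hf⟩
    · intro z hz
      simp only [Finset.mem_singleton] at hz
      subst hz
      exact ⟨y, by simp, hyw⟩
    · intro x hx
      obtain ⟨q, hq, -, hxq, -⟩ : ∃ q ∈ l, x.1 = q.1 ∧ x.2 ⊆ q.2 ∧ x.2.card = 1 := by
        clear hl' ih h
        induction hf with
        | nil => simp at hx
        | cons h1 _ ih =>
          rcases List.mem_cons.1 hx with rfl | hx
          · exact ⟨_, by simp, h1⟩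
          · obtain ⟨q, hq, h⟩ := ih hx
            exact ⟨q, by simp [hq], h⟩
      exact anticomplete_mono (h.2.1 q hq) hxq (by simpa using hw)

theorem Lev.nonempty {l : List (ι × Finset V)} {b : ι × Finset V} (h : Lev G (b :: l))
    (hb : b.2.Nonempty) : ∀ p ∈ l, p.2.Nonempty := by
  induction l generalizing b with
  | nil => simp
  | cons a l ih =>
    obtain ⟨c, hc⟩ := hb
    obtain ⟨y, hy, -⟩ := h.1 c hc
    intro p hp
    rcases List.mem_cons.1 hp with rfl | hp
    · exact ⟨y, hy⟩
    · exact ih h.2.2 ⟨y, hy⟩ p hp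

end

/-! ### Pigeonhole, and growing levellings through prescribed sets. -/

section

variable {V : Type*} {ι : Type*} {G : SimpleGraph V}

theorem exists_popular {α : Type*} {q : ℕ} (hq : 0 < q) (S : Finset α) (P : ℕ → α → Prop)
    (h : ∀ c ∈ S, ∃ i < q, P i c) :
    ∃ i < q, ∃ S' ⊆ S, S.card ≤ q * S'.card ∧ ∀ c ∈ S', P i c := by
  classical
  by_contra! hcon
  have h1 : S.card ≤ ∑ i ∈ Finset.range q, (S.filter (P i)).card := by
    refine le_trans (Finset.card_le_card ?_) Finset.card_biUnion_le
    intro c hc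
    obtain ⟨i, hi, hP⟩ := h c hc
    exact Finset.mem_biUnion.2 ⟨i, Finset.mem_range.2 hi, Finset.mem_filter.2 ⟨hc, hP⟩⟩
  have h2 : ∑ i ∈ Finset.range q, q * (S.filter (P i)).card < ∑ _i ∈ Finset.range q, S.card := by
    refine Finset.sum_lt_sum_of_nonempty ⟨0, Finset.mem_range.2 hq⟩ fun i hi => ?_
    by_contra! hle
    obtain ⟨c, hc, hPc⟩ := hcon i (Finset.mem_range.1 hi) _ (Finset.filter_subset _ _) hle
    exact hPc (Finset.mem_filter.1 hc).2
  rw [← Finset.mul_sum, Finset.sum_const, Finset.card_range, smul_eq_mul] at h2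
  exact absurd (Nat.lt_of_mul_lt_mul_left h2) (not_lt.2 h1)

/-- Pigeonhole twice: inside each `C b`, and then over `b`, so that one class serves all of `F'`. -/
theorem exists_popular_family {q : ℕ} (hq : 0 < q) (F : Finset ι) (C : ι → Finset V)
    (P : ℕ → V → Prop) (h : ∀ b ∈ F, ∀ c ∈ C b, ∃ i < q, P i c) :
    ∃ i < q, ∃ F' ⊆ F, F.card ≤ q * F'.card ∧ ∃ C' : ι → Finset V,
      ∀ b ∈ F', C' b ⊆ C b ∧ (C b).card ≤ q * (C' b).card ∧ ∀ c ∈ C' b, P i c := by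
  classical
  obtain ⟨i, hi, F', hF', hF, hC⟩ := exists_popular hq F
    (fun i b => ∃ S' ⊆ C b, (C b).card ≤ q * S'.card ∧ ∀ c ∈ S', P i c)
    fun b hb => exists_popular hq (C b) P (h b hb)
  choose! C' hC' using hC
  exact ⟨i, hi, F', hF', hF, C', fun b hb => hC' b hb⟩

/-- In a levelling the last entry of the list with a neighbour of `c` is the one nearest the apex.
Cutting there leaves a suffix on top of which `c` fits: its head sees `c` and the rest does not. -/
theorem exists_last_suffix {α : Type*} (P : α → Prop) (l : List α) (h : ∃ x ∈ l, P x) :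
    ∃ j < l.length, ∃ s r, l.drop j = s :: r ∧ P s ∧ ∀ x ∈ r, ¬ P x := by
  induction l with
  | nil => simp at h
  | cons a l ih =>
    by_cases hl : ∃ x ∈ l, P x
    · obtain ⟨j, hj, s, r, h⟩ := ih hl
      exact ⟨j + 1, by simpa using hj, s, r, by simpa using h⟩
    · refine ⟨0, by simp, a, l, rfl, ?_, fun x hx hP => hl ⟨x, hx, hP⟩⟩
      obtain ⟨x, hx, hP⟩ := h
      rcases List.mem_cons.1 hx with rfl | hx
      · exact hP
      · exact absurd ⟨x, hx, hP⟩ hl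

/-- If the first set of a levelling reaches the sets `C b` via the sets of `U`, then a part of the
levelling extends, via subsets of some of the sets of `U`, to a levelling that reaches large
parts of many of the sets `C b`. -/
theorem grow (W : ℕ) (U : List (ι × Finset V)) :
    ∀ (a : ι × Finset V) (l : List (ι × Finset V)) (F : Finset ι) (C : ι → Finset V),
      Lev G (a :: l) → l.length + 1 + U.length ≤ W →
      (∀ b ∈ F, Covers G (reach G a.2 U) (C b)) →
      ∃ (l₁ l₂ : List (ι × Finset V)) (F' : Finset ι) (C' : ι → Finset V),
        l₂ ≠ [] ∧ l₂ <:+ a :: l ∧ (l₁.map Prod.fst).Sublist (U.map Prod.fst).reverse ∧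
        (∀ p ∈ l₁, ∃ u ∈ U, p.1 = u.1 ∧ p.2 ⊆ u.2) ∧ Lev G (l₁ ++ l₂) ∧ F' ⊆ F ∧
        F.card ≤ W ^ (U.length + 1) * F'.card ∧
        ∀ b ∈ F', C' b ⊆ C b ∧ (C b).card ≤ W ^ (U.length + 1) * (C' b).card ∧
          Lev G ((b, C' b) :: (l₁ ++ l₂)) := by
  classical
  induction U with
  | nil =>
    intro a l F C hl hW hC
    obtain ⟨j, hj, F', hF', hcard, C', hb⟩ := exists_popular_family (q := W) (by omega) F C
      (fun j c => ∃ s r, (a :: l).drop j = s :: r ∧ (∃ y ∈ s.2, G.Adj y c) ∧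
        ∀ x ∈ r, ¬ ∃ y ∈ x.2, G.Adj y c) (by
        intro b hb c hc
        obtain ⟨j, hj, h⟩ := exists_last_suffix (fun x : ι × Finset V => ∃ y ∈ x.2, G.Adj y c)
          (a :: l) ⟨a, by simp, hC b hb c hc⟩
        exact ⟨j, by simp at hj hW; omega, h⟩)
    -- `W` only bounds the number of positions. A popular position beyond the end of the list
    -- satisfies nothing, so every surviving `C b` is empty and empty sets do.
    by_cases hd : (a :: l).drop j = []
    · refine ⟨[], a :: l, F', fun _ => ∅, by simp, List.suffix_refl _, by simp, by simp, by simpa,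
        hF', by simpa using hcard, fun b hbF => ⟨by simp, ?_, ?_⟩⟩
      · have h0 : C' b = ∅ := by
          refine Finset.eq_empty_of_forall_notMem fun c hc => ?_
          obtain ⟨s, r, h, -⟩ := (hb b hbF).2.2 c hc
          rw [hd] at h
          simp at h
        simpa [h0] using (hb b hbF).2.1
      · exact ⟨fun _ h => by simp at h, fun _ _ _ _ _ h => by simp at h, hl⟩
    · obtain ⟨s, r, hsr⟩ := List.exists_cons_of_ne_nil hd
      have hsuf : s :: r <:+ a :: l := hsr ▸ List.drop_suffix _ _
      refine ⟨[], s :: r, F', C', by simp, hsuf, by simp, by simp, hl.of_suffix hsuf, hF',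
        by simpa using hcard, fun b hbF => ⟨(hb b hbF).1, by simpa using (hb b hbF).2.1, ?_⟩⟩
      refine ⟨fun c hc => ?_, fun x hx y hy c hc hyc => ?_, hl.of_suffix hsuf⟩
      · obtain ⟨s', r', h, h', -⟩ := (hb b hbF).2.2 c hc
        rw [hsr] at h
        obtain ⟨rfl, rfl⟩ := List.cons.inj h
        exact h'
      · obtain ⟨s', r', h, -, h'⟩ := (hb b hbF).2.2 c hc
        rw [hsr] at h
        obtain ⟨rfl, rfl⟩ := List.cons.inj h
        exact h' x hx ⟨y, hy, hyc⟩
  | cons u U ih =>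
    intro a l F C hl hW hC
    -- `T j` fits on top of the suffix at position `j`. Every vertex of `u.2` with a neighbour in
    -- `a.2` is in some `T j`, so one of these sets still reaches a popular share via `U`.
    set T : ℕ → Finset V := fun j => u.2.filter fun c => ∃ s r, (a :: l).drop j = s :: r ∧
      (∃ y ∈ s.2, G.Adj y c) ∧ ∀ x ∈ r, ¬ ∃ y ∈ x.2, G.Adj y c with hT
    obtain ⟨j, hj, F₁, hF₁, hcard, C₁, hb⟩ := exists_popular_family (q := W) (by omega) F C
      (fun j c => ∃ y ∈ reach G (T j) U, G.Adj y c) (by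
        intro b hb c hc
        obtain ⟨y, hy, hyc⟩ := hC b hb c hc
        obtain ⟨z, hz, hyz⟩ := exists_mem_reach (show y ∈ reach G (nbr G a.2 u.2) U from hy)
        obtain ⟨hzu, hza⟩ := mem_nbr.1 hz
        obtain ⟨j, hj, h⟩ := exists_last_suffix (fun x : ι × Finset V => ∃ y ∈ x.2, G.Adj y z)
          (a :: l) ⟨a, by simp, hza⟩
        refine ⟨j, by simp at hj hW; omega, y, reach_mono U ?_ hyz, hyc⟩
        exact Finset.singleton_subset_iff.2 (Finset.mem_filter.2 ⟨hzu, h⟩))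
    obtain ⟨l', hl', hTl, hlev⟩ : ∃ l', l' <:+ a :: l ∧ l' ≠ [] ∧ Lev G ((u.1, T j) :: l') := by
      by_cases hd : (a :: l).drop j = []
      · have : T j = ∅ := by simp [hT, hd]
        refine ⟨a :: l, List.suffix_refl _, by simp, ?_⟩
        rw [this]
        exact ⟨fun _ h => by simp at h, fun _ _ _ _ _ h => by simp at h, hl⟩
      · obtain ⟨s, r, hsr⟩ := List.exists_cons_of_ne_nil hd
        have hsuf : s :: r <:+ a :: l := hsr ▸ List.drop_suffix _ _
        refine ⟨s :: r, hsuf, by simp, fun c hc => ?_, fun x hx y hy c hc hyc => ?_,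
          hl.of_suffix hsuf⟩
        · obtain ⟨s', r', h, h', -⟩ := (Finset.mem_filter.1 hc).2
          rw [hsr] at h
          obtain ⟨rfl, rfl⟩ := List.cons.inj h
          exact h'
        · obtain ⟨s', r', h, -, h'⟩ := (Finset.mem_filter.1 hc).2
          rw [hsr] at h
          obtain ⟨rfl, rfl⟩ := List.cons.inj h
          exact h' x hx ⟨y, hy, hyc⟩
    have hlen : l'.length + 1 + U.length ≤ W := by
      have := hl'.length_le
      simp at this hW
      omega
    obtain ⟨l₁, l₂, F', C', hne, hsuf, hsub, hmem, hlev', hF', hcF, hC'⟩ :=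
      ih (u.1, T j) l' F₁ C₁ hlev hlen (fun b hb' c hc => (hb b hb').2.2 c hc)
    have hpow : ∀ {x y z : ℕ}, x ≤ W * y → y ≤ W ^ (U.length + 1) * z →
        x ≤ W ^ ((u :: U).length + 1) * z := by
      intro x y z h1 h2
      calc x ≤ W * y := h1
        _ ≤ W * (W ^ (U.length + 1) * z) := Nat.mul_le_mul_left _ h2
        _ = _ := by rw [List.length_cons, pow_succ W (U.length + 1)]; ring
    have hC'' : ∀ b ∈ F', C' b ⊆ C b ∧ (C b).card ≤ W ^ ((u :: U).length + 1) * (C' b).card ∧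
        Lev G ((b, C' b) :: (l₁ ++ l₂)) := fun b hbF =>
      ⟨(hC' b hbF).1.trans (hb b (hF' hbF)).1, hpow (hb b (hF' hbF)).2.1 (hC' b hbF).2.1,
        (hC' b hbF).2.2⟩
    have hsub' : ((l₁ ++ [(u.1, T j)]).map Prod.fst).Sublist ((u :: U).map Prod.fst).reverse := by
      simpa using hsub
    have hmem' : ∀ p ∈ l₁ ++ [(u.1, T j)], ∃ v ∈ u :: U, p.1 = v.1 ∧ p.2 ⊆ v.2 := by
      intro p hp
      rcases List.mem_append.1 hp with hp | hp
      · obtain ⟨v, hv, h⟩ := hmem p hp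
        exact ⟨v, by simp [hv], h⟩
      · rw [List.mem_singleton] at hp
        subst hp
        exact ⟨u, by simp, rfl, Finset.filter_subset _ _⟩
    -- The inductive call may have kept `T j` or cut below it. If kept, it belongs to the new sets,
    -- as a part of `u`, and not to the old levelling.
    rcases List.suffix_cons_iff.1 hsuf with rfl | hsuf'
    · refine ⟨l₁ ++ [(u.1, T j)], l', F', C', hTl, hl', hsub', hmem', by simpa using hlev',
        hF'.trans hF₁, hpow hcard hcF, ?_⟩
      simpa using hC''
    · refine ⟨l₁, l₂, F', C', hne, hsuf'.trans hl', ?_, ?_, hlev', hF'.trans hF₁,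
        hpow hcard hcF, hC''⟩
      · refine List.Sublist.trans ?_ hsub'
        rw [List.map_append]
        exact List.sublist_append_left _ _
      · exact fun p hp => hmem' p (List.mem_append_left _ hp)

/-- A partition of a finite set into `q` parts of size at most `m`. -/
theorem exists_parts {α : Type*} (Y : Finset α) (q m : ℕ) (h : Y.card ≤ q * m) :
    ∃ Z : ℕ → Finset α, (∀ a, Z a ⊆ Y) ∧ (∀ a, (Z a).card ≤ m) ∧ ∀ y ∈ Y, ∃ a < q, y ∈ Z a := by
  classical
  induction q generalizing Y with
  | zero =>
    have : Y = ∅ := by simpa using h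
    exact ⟨fun _ => ∅, by simp, by simp, by simp [this]⟩
  | succ q ih =>
    obtain ⟨Z₀, hZ₀, hcard⟩ := Finset.exists_subset_card_eq (min_le_left Y.card m)
    obtain ⟨Z, h1, h2, h3⟩ := ih (Y \ Z₀) (by
      rw [Finset.card_sdiff_of_subset hZ₀, hcard]
      rw [Nat.succ_mul] at h
      rcases le_total Y.card m with h' | h'
      · simp [min_eq_left h']
      · rw [min_eq_right h']; omega)
    refine ⟨fun a => if a = q then Z₀ else Z a, fun a => ?_, fun a => ?_, fun y hy => ?_⟩
    · by_cases ha : a = q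
      · simpa [ha] using hZ₀
      · simpa [ha] using (h1 a).trans Finset.sdiff_subset
    · by_cases ha : a = q
      · simp [ha, hcard]
      · simpa [ha] using h2 a
    · by_cases hy' : y ∈ Z₀
      · exact ⟨q, by omega, by simpa using hy'⟩
      · obtain ⟨a, ha, hya⟩ := h3 y (Finset.mem_sdiff.2 ⟨hy, hy'⟩)
        exact ⟨a, by omega, by simpa [ha.ne] using hya⟩

/-- If a set of at most `q * m` vertices reaches `E`, then some `m` of them reach at least
`1 / q` of `E`. -/
theorem exists_part {Y E : Finset V} {q m : ℕ} (hq : 0 < q) (h : Y.card ≤ q * m)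
    (R : V → V → Prop) (hR : ∀ c ∈ E, ∃ y ∈ Y, R y c) :
    ∃ Z ⊆ Y, Z.card ≤ m ∧ ∃ E' ⊆ E, E.card ≤ q * E'.card ∧ ∀ c ∈ E', ∃ y ∈ Z, R y c := by
  classical
  obtain ⟨Z, h1, h2, h3⟩ := exists_parts Y q m h
  obtain ⟨a, -, E', hE', ha, h⟩ := exists_popular hq E (fun a c => ∃ y ∈ Z a, R y c) (by
    intro c hc
    obtain ⟨y, hy, hyc⟩ := hR c hc
    obtain ⟨a, ha, hya⟩ := h3 y hy
    exact ⟨a, ha, y, hya, hyc⟩)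
  exact ⟨Z a, h1 a, h2 a, E', hE', ha, h⟩

end

/-! ### Expansion: one vertex reaching nearly everything; partial coverings. -/

section

variable {V : Type*} {ι : Type*} {G : SimpleGraph V}

/-- Disjoint nonempty sets with linkage at most `ε`, such that every part of one of them of at
least `ε / x` of its size has neighbours in all but a proportion `ε` of each other one. -/
structure Sparse (G : SimpleGraph V) (A : ι → Finset V) (ε x : ℝ) : Prop where
  nonempty : ∀ i, (A i).Nonempty
  disjoint : ∀ i j, i ≠ j → Disjoint (A i) (A j)
  link : ∀ i j, i ≠ j → ∀ v ∈ A i, ((nbr G {v} (A j)).card : ℝ) ≤ ε * (A j).card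
  exp : ∀ i j, i ≠ j → ∀ Y ⊆ A j, ε * (A j).card ≤ x * Y.card →
    ((nonNbr G Y (A i)).card : ℝ) ≤ ε * (A i).card

variable {A : ι → Finset V} {ε x : ℝ}

theorem Sparse.card_pos (h : Sparse G A ε x) (i : ι) : (0 : ℝ) < (A i).card := by
  exact_mod_cast (h.nonempty i).card_pos

theorem card_nbr_add_card_nonNbr' (S C : Finset V) :
    ((nbr G S C).card : ℝ) + (nonNbr G S C).card = C.card := by
  exact_mod_cast card_nbr_add_card_nonNbr S C

theorem card_nbr_ge {R C B : Finset V} {ε κ : ℝ} (hC : C ⊆ B)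
    (hR : ((nonNbr G R B).card : ℝ) ≤ ε * B.card) (hκ : κ * B.card ≤ C.card) :
    (κ - ε) * B.card ≤ (nbr G R C).card := by
  have h1 := card_nbr_add_card_nonNbr' (G := G) R C
  have h2 : ((nonNbr G R C).card : ℝ) ≤ (nonNbr G R B).card := by
    exact_mod_cast Finset.card_le_card (nonNbr_mono hC)
  linarith

/-- Each step through a set of `U` first enlarges the reach from proportion ε/x to at least κ - ε ≥
5ε, and this surplus pays for replacing the starting set by about 1/x of it. The alternative
`Z'.card ≤ 1` is where the shrinking stops. -/
theorem Sparse.exists_small_reach (h : Sparse G A ε x) (hx : 1 ≤ x) {n κ : ℝ}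
    (hn : ∀ X : Finset V, (X.card : ℝ) ≤ n) (hκ : 6 * ε ≤ κ) (i₀ : ι) (Z : Finset V)
    (hZ : Z ⊆ A i₀) (hZc : ε * (A i₀).card ≤ Z.card) (U : List (ι × Finset V))
    (hU : ∀ u ∈ U, u.2 ⊆ A u.1 ∧ κ * (A u.1).card ≤ u.2.card)
    (hnd : (i₀ :: U.map Prod.fst).Nodup) :
    ∃ Z' ⊆ Z, ((Z'.card : ℝ) * x ^ U.length ≤ n ∨ Z'.card ≤ 1) ∧
      ∃ j ∈ i₀ :: U.map Prod.fst, reach G Z' U ⊆ A j ∧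
        ε * (A j).card ≤ x * (reach G Z' U).card := by
  induction U using List.reverseRecOn with
  | nil =>
    refine ⟨Z, Finset.Subset.refl _, Or.inl (by simpa using hn Z), i₀, by simp, hZ, hZc.trans ?_⟩
    exact le_mul_of_one_le_left (Nat.cast_nonneg _) hx
  | append_singleton U u ih =>
    have hnd' : (i₀ :: U.map Prod.fst).Nodup ∧ u.1 ∉ i₀ :: U.map Prod.fst := by
      have : ((i₀ :: U.map Prod.fst) ++ [u.1]).Nodup := by simpa using hnd
      rw [List.nodup_append] at this
      exact ⟨this.1, fun hm => this.2.2 _ hm u.1 (by simp) rfl⟩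
    obtain ⟨Z', hZ', hsmall, j, hj, hRj, hR⟩ :=
      ih (fun v hv => hU v (List.mem_append_left _ hv)) hnd'.1
    have huj : u.1 ≠ j := fun e => hnd'.2 (e ▸ hj)
    obtain ⟨huA, huκ⟩ := hU u (by simp)
    have hE := card_nbr_ge huA (h.exp u.1 j huj _ hRj hR) huκ
    have hAu := h.card_pos u.1
    rw [← reach_append_singleton] at hE
    have hsub : ∀ Y : Finset V, reach G Y (U ++ [u]) ⊆ A u.1 := fun Y => by
      rw [reach_append_singleton]
      exact (nbr_subset _ _).trans huA
    by_cases h1 : Z'.card ≤ 1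
    · refine ⟨Z', hZ', Or.inr h1, u.1, by simp, hsub _, ?_⟩
      nlinarith
    -- With `q` parts, `q ≤ 3 * x`, the best part reaches at least 5ε/(3x) ≥ ε/x of the block. The
    -- lower bound `2 * x ≤ q` compensates the factor 2 lost in rounding the part size `m`, so that
    -- `m * x ≤ Z'.card` unless `m ≤ 1`.
    · set q := ⌈2 * x⌉₊ with hq
      have hq2 : 2 * x ≤ q := Nat.le_ceil _
      have hq3 : (q : ℝ) ≤ 3 * x := by
        have := (Nat.ceil_lt_add_one (show 0 ≤ 2 * x by linarith)).le
        linarith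
      have hq0 : 0 < q := by
        have : (0 : ℝ) < q := by linarith
        exact_mod_cast this
      obtain ⟨m, hm, hm'⟩ : ∃ m : ℕ, Z'.card ≤ q * m ∧ (m ≤ 1 ∨ m * q ≤ 2 * Z'.card) := by
        by_cases hle : Z'.card ≤ q
        · exact ⟨1, by simpa, Or.inl le_rfl⟩
        · refine ⟨(Z'.card + q - 1) / q, ?_, Or.inr ?_⟩
          · have := Nat.div_add_mod (Z'.card + q - 1) q
            have := Nat.mod_lt (Z'.card + q - 1) hq0
            omega
          · have := Nat.div_mul_le_self (Z'.card + q - 1) q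
            omega
      obtain ⟨Z'', hZ'', hcard, E', hE', hEc, hER⟩ := exists_part hq0 hm
        (fun z c => c ∈ reach G {z} (U ++ [u])) (fun c hc => exists_mem_reach (G := G) hc)
      refine ⟨Z'', hZ''.trans hZ', ?_, u.1, by simp, hsub _, ?_⟩
      · rcases hm' with hm' | hm'
        · exact Or.inr (hcard.trans hm')
        · left
          rcases hsmall with hs | hs
          · have h2 : (m : ℝ) * q ≤ 2 * Z'.card := by exact_mod_cast hm'
            have h3 : (Z''.card : ℝ) ≤ m := by exact_mod_cast hcard
            have h4 : (Z''.card : ℝ) * x ≤ Z'.card := by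
              have : (m : ℝ) * (2 * x) ≤ m * q := by gcongr
              nlinarith
            calc (Z''.card : ℝ) * x ^ (U ++ [u]).length = (Z''.card * x) * x ^ U.length := by
                  rw [List.length_append, List.length_singleton, pow_succ]; ring
              _ ≤ Z'.card * x ^ U.length := by gcongr
              _ ≤ n := hs
          · exact absurd hs h1
      · have h2 : E' ⊆ reach G Z'' (U ++ [u]) := by
          intro c hc
          obtain ⟨z, hz, hcz⟩ := hER c hc
          exact reach_mono _ (Finset.singleton_subset_iff.2 hz) hcz
        have h3 : (E'.card : ℝ) ≤ (reach G Z'' (U ++ [u])).card := by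
          exact_mod_cast Finset.card_le_card h2
        have h4 : ((reach G Z' (U ++ [u])).card : ℝ) ≤ q * E'.card := by exact_mod_cast hEc
        have h5 : (q : ℝ) * E'.card ≤ 3 * x * (reach G Z'' (U ++ [u])).card := by gcongr
        nlinarith

/-- Some vertex of a large set `Z` reaches nearly all of each block via the sets of `U`. -/
theorem Sparse.exists_reach (h : Sparse G A ε x) (hε : 0 < ε) (hx : 1 ≤ x) {n κ : ℝ}
    (hn : ∀ X : Finset V, (X.card : ℝ) ≤ n) (hκ : 6 * ε ≤ κ) (i₀ : ι) (Z : Finset V)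
    (hZ : Z ⊆ A i₀) (hZc : ε * (A i₀).card ≤ Z.card) (U : List (ι × Finset V))
    (hU : ∀ u ∈ U, u.2 ⊆ A u.1 ∧ κ * (A u.1).card ≤ u.2.card)
    (hnd : (i₀ :: U.map Prod.fst).Nodup) (hlen : n ≤ x ^ U.length) :
    ∃ v ∈ Z, ∀ b ∉ i₀ :: U.map Prod.fst,
      ((nonNbr G (reach G {v} U) (A b)).card : ℝ) ≤ ε * (A b).card := by
  obtain ⟨Z', hZ', hs, j, hj, hRj, hR⟩ :=
    h.exists_small_reach hx hn hκ i₀ Z hZ hZc U hU hnd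
  have h1 : Z'.card ≤ 1 := by
    rcases hs with hs | hs
    · have hx0 : 0 < x ^ U.length := by positivity
      have : (Z'.card : ℝ) ≤ 1 := by
        by_contra! hc
        nlinarith
      exact_mod_cast this
    · exact hs
  have hAj := h.card_pos j
  -- A nonempty reach excludes `Z' = ∅`, so `Z'` is a single vertex.
  have h2 : (reach G Z' U).Nonempty := by
    rw [Finset.nonempty_iff_ne_empty]
    intro he
    rw [he] at hR
    simp only [Finset.card_empty, Nat.cast_zero, mul_zero] at hR
    nlinarith
  obtain ⟨c, hc⟩ := h2
  obtain ⟨v, hv, -⟩ := exists_mem_reach hc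
  have h3 : Z' = {v} := by
    refine (Finset.eq_of_subset_of_card_le ?_ ?_).symm
    · simpa using hv
    · simpa using h1
  subst h3
  exact ⟨v, hZ' (by simp), fun b hb => h.exp b j (fun e => hb (e ▸ hj)) _ hRj hR⟩

/-- Insert the vertices of `S` one at a time and stop when at least `g` sets are half covered.
Choose `F₁` to contain all sets half covered just before; every other set was then more than half
uncovered, and the last vertex takes at most a quarter of it. -/
theorem exists_thin (S : Finset V) (F : Finset ι) (C : ι → Finset V) (g : ℕ)
    (hgF : g ≤ F.card) (hcov : ∀ b ∈ F, Covers G S (C b))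
    (hlink : ∀ b ∈ F, ∀ s ∈ S, 4 * (nbr G {s} (C b)).card ≤ (C b).card) :
    ∃ S' ⊆ S, ∃ F₁ ⊆ F, F₁.card = g ∧ (∀ b ∈ F₁, (C b).card ≤ 2 * (nbr G S' (C b)).card) ∧
      ∀ b ∈ F, b ∉ F₁ → (C b).card ≤ 4 * (nonNbr G S' (C b)).card := by
  classical
  set H : Finset V → Finset ι := fun S => F.filter fun b => (C b).card ≤ 2 * (nbr G S (C b)).card
    with hH
  have hHS : g ≤ (H S).card := by
    have : H S = F := by
      refine Finset.filter_true_of_mem fun b hb => ?_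
      rw [nbr_eq_of_covers (hcov b hb)]
      omega
    rwa [this]
  clear hcov
  induction S using Finset.induction_on with
  | empty =>
    obtain ⟨F₁, hF₁, hc⟩ := Finset.exists_subset_card_eq hHS
    refine ⟨∅, Finset.Subset.refl _, F₁, hF₁.trans (Finset.filter_subset _ _), hc,
      fun b hb => (Finset.mem_filter.1 (hF₁ hb)).2, fun b _ _ => ?_⟩
    have : nonNbr G ∅ (C b) = C b := by
      ext c; simp [mem_nonNbr]
    rw [this]
    omega
  | insert s S hs ih =>
    by_cases hg : g ≤ (H S).card
    · obtain ⟨S', hS', h⟩ := ih (fun b hb t ht => hlink b hb t (Finset.mem_insert_of_mem ht)) hg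
      exact ⟨S', hS'.trans (Finset.subset_insert _ _), h⟩
    · have hsub : H S ⊆ H (insert s S) := by
        intro b hb
        obtain ⟨hb1, hb2⟩ := Finset.mem_filter.1 hb
        refine Finset.mem_filter.2 ⟨hb1, hb2.trans ?_⟩
        exact Nat.mul_le_mul_left _
          (Finset.card_le_card (nbr_mono (Finset.subset_insert _ _) (Finset.Subset.refl _)))
      obtain ⟨F₁, hF₁, hF₁', hc⟩ := Finset.exists_subsuperset_card_eq hsub (not_le.1 hg).le hHS
      refine ⟨insert s S, Finset.Subset.refl _, F₁, hF₁'.trans (Finset.filter_subset _ _), hc,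
        fun b hb => (Finset.mem_filter.1 (hF₁' hb)).2, fun b hb hbF => ?_⟩
      have h1 : 2 * (nbr G S (C b)).card < (C b).card := by
        by_contra! hc
        exact hbF (hF₁ (Finset.mem_filter.2 ⟨hb, hc⟩))
      have h2 : (nbr G (insert s S) (C b)).card ≤ (nbr G S (C b)).card + (nbr G {s} (C b)).card := by
        refine le_trans (Finset.card_le_card ?_) (Finset.card_union_le _ _)
        intro c hc
        obtain ⟨hc1, t, ht, htc⟩ := mem_nbr.1 hc
        rw [Finset.mem_union, mem_nbr, mem_nbr]
        rcases Finset.mem_insert.1 ht with rfl | ht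
        · exact Or.inr ⟨hc1, t, by simp, htc⟩
        · exact Or.inl ⟨hc1, t, ht, htc⟩
      have h3 := hlink b hb s (Finset.mem_insert_self _ _)
      have h4 := card_nbr_add_card_nonNbr (G := G) (insert s S) (C b)
      omega

end

/-! ### Growing from single vertices; bi-levellings with distinct block indices. -/

section

variable {V : Type*} {ι : Type*} {G : SimpleGraph V} {A : ι → Finset V} {ε x κ : ℝ}

/-- If no set of `U` were used, a single vertex would cover a proportion κ/w of a block, contrary to
the linkage. Hence `l₁ ≠ []`, which is what keeps both arms of the bi-levelling nonempty. -/
theorem Sparse.grow_singletons (h : Sparse G A ε x) (W w : ℕ) (U : List (ι × Finset V))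
    (hw : W ^ (U.length + 1) ≤ w) (hw0 : 0 < w) (a : ι × Finset V) (l : List (ι × Finset V))
    (F : Finset ι) (C : ι → Finset V) (hl : Lev G (a :: l)) (hW : l.length + 1 + U.length ≤ W)
    (hF : F.Nonempty) (hs : ∀ p ∈ a :: l, p.2.card = 1 ∧ p.2 ⊆ A p.1 ∧ p.1 ∉ F)
    (hC : ∀ b ∈ F, C b ⊆ A b ∧ κ * (A b).card ≤ (C b).card ∧ Covers G (reach G a.2 U) (C b))
    (hε : ε * w < κ) :
    ∃ (l₁ l₂ : List (ι × Finset V)) (F' : Finset ι) (C' : ι → Finset V),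
      l₁ ≠ [] ∧ l₂ ≠ [] ∧ l₂ <:+ a :: l ∧ (l₁.map Prod.fst).Sublist (U.map Prod.fst).reverse ∧
      (∀ p ∈ l₁, ∃ u ∈ U, p.1 = u.1 ∧ p.2 ⊆ u.2) ∧ Lev G (l₁ ++ l₂) ∧ F' ⊆ F ∧
      F.card ≤ w * F'.card ∧
      ∀ b ∈ F', C' b ⊆ C b ∧ κ / w * (A b).card ≤ (C' b).card ∧
        Lev G ((b, C' b) :: (l₁ ++ l₂)) := by
  obtain ⟨l₁, l₂, F', C', hne, hsuf, hsub, hmem, hlev, hF', hcard, hC'⟩ :=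
    grow W U a l F C hl hW fun b hb => (hC b hb).2.2
  have hw' : (0 : ℝ) < w := by exact_mod_cast hw0
  have hcard' : F.card ≤ w * F'.card := hcard.trans (Nat.mul_le_mul_right _ hw)
  have hsize : ∀ b ∈ F', κ / w * (A b).card ≤ (C' b).card := by
    intro b hb
    have h1 : ((C b).card : ℝ) ≤ w * (C' b).card := by
      exact_mod_cast (hC' b hb).2.1.trans (Nat.mul_le_mul_right _ hw)
    have h2 := (hC b (hF' hb)).2.1
    rw [div_mul_eq_mul_div, div_le_iff₀ hw']
    linarith
  refine ⟨l₁, l₂, F', C', ?_, hne, hsuf, hsub, hmem, hlev, hF', hcard',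
    fun b hb => ⟨(hC' b hb).1, hsize b hb, (hC' b hb).2.2⟩⟩
  rintro rfl
  have hF'ne : F'.Nonempty := by
    rw [Finset.nonempty_iff_ne_empty]
    rintro rfl
    have := hF.card_pos
    rw [Finset.card_empty, mul_zero] at hcard'
    omega
  obtain ⟨b, hb⟩ := hF'ne
  obtain ⟨s, r, rfl⟩ := List.exists_cons_of_ne_nil hne
  have hlevb := (hC' b hb).2.2.1
  obtain ⟨hs1, hsA, hsF⟩ := hs s (hsuf.subset (by simp))
  obtain ⟨y, hy⟩ := Finset.card_eq_one.1 hs1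
  have hsb : s.1 ≠ b := fun e => hsF (e ▸ hF' hb)
  have h1 := h.link s.1 b hsb y (hsA (by simp [hy]))
  have h2 : (C' b).card ≤ (nbr G {y} (A b)).card := by
    refine Finset.card_le_card fun c hc => mem_nbr.2 ⟨(hC b (hF' hb)).1 ((hC' b hb).1 hc), ?_⟩
    obtain ⟨z, hz, hzc⟩ := hlevb c hc
    exact ⟨z, hy ▸ hz, hzc⟩
  have h2' : ((C' b).card : ℝ) ≤ (nbr G {y} (A b)).card := by exact_mod_cast h2
  have h3 := hsize b hb
  have h4 := h.card_pos b
  have h5 : ε < κ / w := by rwa [lt_div_iff₀ hw']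
  nlinarith

theorem Sparse.card_nbr_singleton_le (h : Sparse G A ε x) {i b : ι} {s : V} {C : Finset V}
    (hib : i ≠ b) (hs : s ∈ A i) (hC : C ⊆ A b) (hκ : κ * (A b).card ≤ C.card) (hε : 4 * ε ≤ κ) :
    4 * (nbr G {s} C).card ≤ C.card := by
  have h1 := h.link i b hib s hs
  have h2 : ((nbr G {s} C).card : ℝ) ≤ (nbr G {s} (A b)).card := by
    exact_mod_cast Finset.card_le_card (nbr_mono (Finset.Subset.refl _) hC)
  have h3 := h.card_pos b
  have : (4 : ℝ) * (nbr G {s} C).card ≤ C.card := by nlinarith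
  exact_mod_cast this

theorem Sparse.exists_thin (h : Sparse G A ε x) (S : Finset V) (i : ι) (F : Finset ι)
    (C : ι → Finset V) (g : ℕ) (hS : S ⊆ A i) (hi : i ∉ F)
    (hgF : g ≤ F.card) (hcov : ∀ b ∈ F, Covers G S (C b))
    (hC : ∀ b ∈ F, C b ⊆ A b ∧ κ * (A b).card ≤ (C b).card) (hε : 4 * ε ≤ κ) :
    ∃ S' ⊆ S, ∃ F₁ ⊆ F, F₁.card = g ∧
      (∀ b ∈ F₁, κ / 2 * (A b).card ≤ (nbr G S' (C b)).card) ∧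
      ∀ b ∈ F, b ∉ F₁ → κ / 4 * (A b).card ≤ (nonNbr G S' (C b)).card := by
  obtain ⟨S', hS', F₁, hF₁, hg, h1, h2⟩ := BiGrade.exists_thin S F C g hgF hcov
    fun b hb s hs => h.card_nbr_singleton_le (fun e : i = b => hi (e ▸ hb)) (hS hs) (hC b hb).1
      (hC b hb).2 hε
  refine ⟨S', hS', F₁, hF₁, hg, fun b hb => ?_, fun b hb hbF => ?_⟩
  · have : ((C b).card : ℝ) ≤ 2 * (nbr G S' (C b)).card := by exact_mod_cast h1 b hb
    have h4 := (hC b (hF₁ hb)).2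
    linarith
  · have : ((C b).card : ℝ) ≤ 4 * (nonNbr G S' (C b)).card := by exact_mod_cast h2 b hb hbF
    have h4 := (hC b hb).2
    linarith

/-- Fewer than `a` vertices of `X` can fail `P`, so those satisfying `P` are numerous enough to
include one satisfying `Q`. -/
theorem exists_mem_and {X : Finset V} {a : ℝ} {P Q : V → Prop}
    (hP : ∀ Z ⊆ X, a ≤ Z.card → ∃ v ∈ Z, P v) (hQ : ∀ Z ⊆ X, a ≤ Z.card → ∃ v ∈ Z, Q v)
    (ha : 2 * a ≤ X.card) : ∃ v ∈ X, P v ∧ Q v := by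
  classical
  have h1 : ((X.filter P).card : ℝ) + (X.filter fun v => ¬ P v).card = X.card := by
    exact_mod_cast Finset.card_filter_add_card_filter_not P
  rcases le_total a (X.filter P).card with h | h
  · obtain ⟨v, hv, hq⟩ := hQ _ (Finset.filter_subset _ _) h
    exact ⟨v, (Finset.mem_filter.1 hv).1, (Finset.mem_filter.1 hv).2, hq⟩
  · obtain ⟨v, hv, hp⟩ := hP (X.filter fun v => ¬ P v) (Finset.filter_subset _ _) (by linarith)
    exact absurd hp (Finset.mem_filter.1 hv).2

/-- A bi-levelling inside the sets `A i`, given by the lists `L`, `M` of levels apart from the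
apex `s`, that reaches large sets `C b ⊆ A b` for `b ∈ F`. -/
structure BiLev (G : SimpleGraph V) (A : ι → Finset V) (κ : ℝ) (L : List (ι × Finset V))
    (s : ι × Finset V) (M : List (ι × Finset V)) (F : Finset ι) (C : ι → Finset V) : Prop where
  left_ne : L ≠ []
  right_ne : M ≠ []
  apex : s.2.card = 1
  nodup : ((L ++ s :: M).map Prod.fst).Nodup
  notMem : ∀ b ∈ F, b ∉ (L ++ s :: M).map Prod.fst
  sub : ∀ p ∈ L ++ s :: M, p.2 ⊆ A p.1
  pool : ∀ b ∈ F, C b ⊆ A b ∧ κ * (A b).card ≤ (C b).card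
  left : ∀ b ∈ F, Lev G ((b, C b) :: (L ++ [s]))
  right : ∀ b ∈ F, Lev G ((b, C b) :: (M ++ [s]))
  anti : ∀ p ∈ L, ∀ q ∈ M, Anticomplete G p.2 q.2

theorem eq_of_suffix_singleton {α : Type*} {l : List α} {a : α} (h : l <:+ [a]) (hl : l ≠ []) :
    l = [a] := by
  rcases List.suffix_cons_iff.1 h with h | h
  · exact h
  · exact absurd (List.suffix_nil.1 h) hl

end

/-! ### A bi-levelling of height at most 3t + 1. -/

section

variable {V : Type*} {ι : Type*} {G : SimpleGraph V} {A : ι → Finset V} {ε x κ : ℝ}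

/-- Glue a bi-levelling together from a levelling `M₁` attached to the end `s` of an induced path
`w :: R` and a levelling `L₁` growing from the other end `w`. -/
theorem BiLev.of_path {L₁ M₁ r R : List (ι × Finset V)} {s w : ι × Finset V} {F : Finset ι}
    {C C' : ι → Finset V} (hL : L₁ ≠ []) (hM : M₁ ≠ []) (hR : (s :: r).reverse = w :: R)
    (hsing : ∀ p ∈ s :: r, p.2.card = 1)
    (hnd : (L₁.map Prod.fst).Nodup ∧ ((s :: r).map Prod.fst).Nodup ∧ (M₁.map Prod.fst).Nodup)
    (hd₁ : ∀ p ∈ L₁, ∀ q ∈ s :: r, p.1 ≠ q.1) (hd₂ : ∀ p ∈ L₁, ∀ q ∈ M₁, p.1 ≠ q.1)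
    (hd₃ : ∀ p ∈ s :: r, ∀ q ∈ M₁, p.1 ≠ q.1)
    (hF₁ : ∀ p ∈ L₁, p.1 ∉ F) (hF₂ : ∀ p ∈ s :: r, p.1 ∉ F) (hF₃ : ∀ p ∈ M₁, p.1 ∉ F)
    (hsub₁ : ∀ p ∈ L₁, p.2 ⊆ A p.1) (hsub₂ : ∀ p ∈ s :: r, p.2 ⊆ A p.1)
    (hsub₃ : ∀ p ∈ M₁, p.2 ⊆ A p.1)
    (hC : ∀ b ∈ F, C' b ⊆ A b ∧ κ * (A b).card ≤ (C' b).card)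
    (hCC : ∀ b ∈ F, C' b ⊆ C b)
    (hlevL : ∀ b ∈ F, Lev G ((b, C' b) :: (L₁ ++ [w])))
    (hlevP : Lev G (s :: r)) (hlevMP : Lev G (M₁ ++ s :: r))
    (hlevM : ∀ b ∈ F, Lev G ((b, C b) :: (M₁ ++ s :: r)))
    (hCR : ∀ b ∈ F, ∀ y ∈ R, Anticomplete G y.2 (C' b))
    (hLR : ∀ p ∈ L₁, ∀ y ∈ R, Anticomplete G y.2 p.2)
    (hLM : ∀ p ∈ L₁, ∀ q ∈ M₁, Anticomplete G p.2 q.2) :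
    BiLev G A κ (L₁ ++ r.reverse) s M₁ F C' where
  left_ne := by simp [hL]
  right_ne := hM
  apex := hsing s (by simp)
  nodup := by
    obtain ⟨h1, h2, h3⟩ := hnd
    have e : ((L₁ ++ r.reverse ++ s :: M₁).map Prod.fst) =
        L₁.map Prod.fst ++ (((s :: r).map Prod.fst).reverse ++ M₁.map Prod.fst) := by simp
    rw [e, List.nodup_append, List.nodup_append]
    refine ⟨h1, ⟨List.nodup_reverse.2 h2, h3, ?_⟩, ?_⟩
    · intro a ha b hb
      rw [List.mem_reverse] at ha
      obtain ⟨p, hp, rfl⟩ := List.mem_map.1 ha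
      obtain ⟨q, hq, rfl⟩ := List.mem_map.1 hb
      exact hd₃ p hp q hq
    · intro a ha b hb
      obtain ⟨p, hp, rfl⟩ := List.mem_map.1 ha
      rcases List.mem_append.1 hb with hb | hb
      · rw [List.mem_reverse] at hb
        obtain ⟨q, hq, rfl⟩ := List.mem_map.1 hb
        exact hd₁ p hp q hq
      · obtain ⟨q, hq, rfl⟩ := List.mem_map.1 hb
        exact hd₂ p hp q hq
  notMem := by
    intro b hb hm
    obtain ⟨p, hp, rfl⟩ := List.mem_map.1 hm
    simp only [List.mem_append, List.mem_reverse, List.mem_cons] at hp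
    rcases hp with (hp | hp) | hp | hp
    · exact hF₁ p hp hb
    · exact hF₂ p (by simp [hp]) hb
    · exact hF₂ p (by simp [hp]) hb
    · exact hF₃ p hp hb
  sub := by
    intro p hp
    simp only [List.mem_append, List.mem_reverse, List.mem_cons] at hp
    rcases hp with (hp | hp) | hp | hp
    · exact hsub₁ p hp
    · exact hsub₂ p (by simp [hp])
    · exact hsub₂ p (by simp [hp])
    · exact hsub₃ p hp
  pool := hC
  left := by
    intro b hb
    -- The path is a levelling with apex `w`; the left arm traverses it the other way, from `s` to
    -- `w`, and goes on through `L₁`.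
    have e : L₁ ++ r.reverse ++ [s] = L₁ ++ w :: R := by
      rw [← hR]; simp
    rw [e]
    refine Lev.append (l := (b, C' b) :: L₁) (hlevL b hb) (hR ▸ hlevP.reverse hsing) ?_
    intro p hp y hy
    rcases List.mem_cons.1 hp with rfl | hp
    · exact hCR b hb y hy
    · exact hLR p hp y hy
  right := by
    intro b hb
    have h1 : Lev G ((b, C b) :: (M₁ ++ [s]) ++ r) := by simpa using hlevM b hb
    exact h1.of_prefix.replace_head (hCC b hb)
  anti := by
    intro p hp q hq
    rcases List.mem_append.1 hp with hp | hp
    · exact hLM p hp q hq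
    · exact hlevMP.anticomplete_append q hq p (List.mem_reverse.1 hp)

theorem forall₂_exists_right {R : (ι × Finset V) → (ι × Finset V) → Prop}
    {l l' : List (ι × Finset V)} (h : List.Forall₂ R l l') : ∀ p ∈ l, ∃ q ∈ l', R p q := by
  induction h with
  | nil => simp
  | cons h1 _ ih =>
    intro p hp
    rcases List.mem_cons.1 hp with rfl | hp
    · exact ⟨_, by simp, h1⟩
    · obtain ⟨q, hq, h⟩ := ih p hp
      exact ⟨q, by simp [hq], h⟩

theorem forall₂_map_fst {R : (ι × Finset V) → (ι × Finset V) → Prop}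
    {l l' : List (ι × Finset V)} (h : List.Forall₂ R l l') (hR : ∀ p q, R p q → p.1 = q.1) :
    l.map Prod.fst = l'.map Prod.fst := by
  induction h with
  | nil => rfl
  | cons h1 _ ih => rw [List.map_cons, List.map_cons, ih, hR _ _ h1]

-- The bounds κ and ε₀ precede `g` because neither depends on the number of blocks wanted; this lets
-- later steps ask for as many blocks as they need.
set_option maxHeartbeats 4000000 in
theorem exists_biLev (t : ℕ) : ∃ κ ε₀ : ℝ, 0 < κ ∧ 0 < ε₀ ∧ ∀ g : ℕ, ∃ N : ℕ,
    ∀ (V : Type u) (ι : Type v) [Fintype ι] (G : SimpleGraph V) (A : ι → Finset V) (ε x n : ℝ),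
      Sparse G A ε x → 0 < ε → ε ≤ ε₀ → 1 ≤ x → n ≤ x ^ t → (∀ X : Finset V, (X.card : ℝ) ≤ n) →
      N ≤ Fintype.card ι → ∃ L s M F C, BiLev G A κ L s M F C ∧ g ≤ F.card ∧
        L.length + M.length ≤ 3 * t + 1 := by
  classical
  -- The longest list to which `grow` is applied: a path of at most `t + 2` vertices, continued
  -- through at most `t` sets.
  set W : ℕ := 2 * t + 2 with hW
  obtain ⟨w, hw, hw1⟩ : ∃ w : ℕ, w = W ^ (t + 1) ∧ 1 ≤ w := ⟨_, rfl, Nat.one_le_pow _ _ (by omega)⟩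
  have hw1' : (1 : ℝ) ≤ w := by exact_mod_cast hw1
  have hw0 : (0 : ℝ) < w := by linarith
  -- The proportions left after the four growths. Each divides by `w`; the other factors pay for the
  -- thinnings and for the proportion ε that a reach may miss.
  obtain ⟨κ₂, hκ₂⟩ : ∃ κ₂ : ℝ, κ₂ = 1 / 2 / w := ⟨_, rfl⟩
  obtain ⟨κ₅, hκ₅⟩ : ∃ κ₅ : ℝ, κ₅ = κ₂ / 8 / w := ⟨_, rfl⟩
  obtain ⟨κ₇, hκ₇⟩ : ∃ κ₇ : ℝ, κ₇ = κ₅ / 4 / w := ⟨_, rfl⟩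
  obtain ⟨κ, hκ⟩ : ∃ κ : ℝ, κ = κ₇ / 2 / w := ⟨_, rfl⟩
  have hκ₂0 : 0 < κ₂ := by rw [hκ₂]; positivity
  have hκ₅0 : 0 < κ₅ := by rw [hκ₅]; positivity
  have hκ₇0 : 0 < κ₇ := by rw [hκ₇]; positivity
  have hκ0 : 0 < κ := by rw [hκ]; positivity
  have hdiv : ∀ a : ℝ, 0 < a → a / w ≤ a := fun a ha => div_le_self ha.le hw1'
  have hκ₂le : κ₂ ≤ 1 / 2 := hκ₂ ▸ hdiv _ (by norm_num)
  have hκ₅le : κ₅ ≤ κ₂ / 8 := hκ₅ ▸ hdiv _ (by positivity)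
  have hκ₇le : κ₇ ≤ κ₅ / 4 := hκ₇ ▸ hdiv _ (by positivity)
  have hκle : κ ≤ κ₇ / 2 := hκ ▸ hdiv _ (by positivity)
  have hκ₂w : κ₂ * w = 1 / 2 := by rw [hκ₂]; field_simp
  have hκ₅w : κ₅ * w = κ₂ / 8 := by rw [hκ₅]; field_simp
  have hκ₇w : κ₇ * w = κ₅ / 4 := by rw [hκ₇]; field_simp
  have hκw : κ * w = κ₇ / 2 := by rw [hκ]; field_simp
  refine ⟨κ, κ / 8, hκ0, by positivity, fun g => ?_⟩
  obtain ⟨g₁, hg₁⟩ : ∃ g₁, g₁ = w * (w * (g + 1)) := ⟨_, rfl⟩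
  -- Read from the outside in: `2 * t` indices for the two ways from `v`, one for `v`, a growth, the
  -- index `b₀` and a spare, a growth, then `t` indices for the third way. The two factors `w` in
  -- `g₁` are the last two growths.
  refine ⟨w * (w * (g₁ + t) + 2) + 1 + 2 * t, ?_⟩
  intro V ι _ G A ε x n h hε hε₀ hx hnx hn hN
  have hεw : ε * w ≤ κ₇ / 16 := by nlinarith
  have hcardF : ∀ {X Y Z : ℕ}, X ≤ w * Y → w * Z ≤ X → Z ≤ Y := fun h1 h2 =>
    Nat.le_of_mul_le_mul_left (h2.trans h1) hw1
  -- the index sets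
  obtain ⟨T₁, -, hT₁⟩ := Finset.exists_subset_card_eq
    (show t ≤ (Finset.univ : Finset ι).card by rw [Finset.card_univ]; omega)
  have hc1 : ((Finset.univ : Finset ι) \ T₁).card = Fintype.card ι - t := by
    rw [Finset.card_sdiff_of_subset (Finset.subset_univ _), hT₁, Finset.card_univ]
  obtain ⟨T₂, hT₂s, hT₂⟩ := Finset.exists_subset_card_eq
    (show t ≤ ((Finset.univ : Finset ι) \ T₁).card by omega)
  have hc2 : (((Finset.univ : Finset ι) \ T₁) \ T₂).card = Fintype.card ι - t - t := by
    rw [Finset.card_sdiff_of_subset hT₂s, hT₂, hc1]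
  obtain ⟨i₀, hi₀⟩ : (((Finset.univ : Finset ι) \ T₁) \ T₂).Nonempty := by
    rw [← Finset.card_pos]; omega
  obtain ⟨F₁, hF₁⟩ : ∃ F₁, F₁ = (((Finset.univ : Finset ι) \ T₁) \ T₂).erase i₀ := ⟨_, rfl⟩
  have hF₁c : F₁.card = Fintype.card ι - t - t - 1 := by
    rw [hF₁, Finset.card_erase_of_mem hi₀, hc2]
  have hF₁mem : ∀ b ∈ F₁, b ≠ i₀ ∧ b ∉ T₁ ∧ b ∉ T₂ := by
    intro b hb
    rw [hF₁] at hb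
    simp only [Finset.mem_erase, Finset.mem_sdiff, Finset.mem_univ, true_and] at hb
    exact ⟨hb.1, hb.2.1, hb.2.2⟩
  have hi₀T : i₀ ∉ T₁ ∧ i₀ ∉ T₂ := by
    simp only [Finset.mem_sdiff, Finset.mem_univ, true_and] at hi₀
    exact hi₀
  have hT₁₂ : ∀ b ∈ T₂, b ∉ T₁ := by
    intro b hb
    have := hT₂s hb
    simp only [Finset.mem_sdiff, Finset.mem_univ, true_and] at this
    exact this
  -- a vertex reaching nearly everything in two ways
  set U : Finset ι → (ι → Finset V) → List (ι × Finset V) :=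
    fun T B => T.toList.map fun i => (i, B i) with hU
  have hUfst : ∀ T B, (U T B).map Prod.fst = T.toList := by
    intro T B
    simp [hU, Function.comp_def]
  have hUlen : ∀ T B, (U T B).length = T.card := by
    intro T B
    simp [hU]
  have hUmem : ∀ T B, ∀ u ∈ U T B, u.1 ∈ T ∧ u.2 = B u.1 := by
    intro T B u hu
    simp only [hU, List.mem_map, Finset.mem_toList] at hu
    obtain ⟨i, hi, rfl⟩ := hu
    exact ⟨hi, rfl⟩
  have hreach : ∀ T : Finset ι, T.card = t → i₀ ∉ T → ∀ Z ⊆ A i₀, ε * (A i₀).card ≤ Z.card →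
      ∃ v ∈ Z, ∀ b ∉ i₀ :: T.toList,
        ((nonNbr G (reach G {v} (U T A)) (A b)).card : ℝ) ≤ ε * (A b).card := by
    intro T hT hiT Z hZ hZc
    have := h.exists_reach hε hx (κ := 1) hn (by linarith) i₀ Z hZ hZc (U T A) (by
      intro u hu
      rw [(hUmem T A u hu).2, one_mul]
      exact ⟨Finset.Subset.refl _, le_rfl⟩) (by
      rw [hUfst, List.nodup_cons]
      exact ⟨by simpa using hiT, Finset.nodup_toList _⟩) (by rwa [hUlen, hT])
    rwa [hUfst] at this
  obtain ⟨v, hvA, hv₁, hv₂⟩ := exists_mem_and (hreach T₁ hT₁ hi₀T.1) (hreach T₂ hT₂ hi₀T.2) (by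
    have := h.card_pos i₀
    nlinarith)
  have hv₁' : ∀ b ∈ F₁, ((nonNbr G (reach G {v} (U T₁ A)) (A b)).card : ℝ) ≤ ε * (A b).card := by
    intro b hb
    refine hv₁ b ?_
    simp only [List.mem_cons, Finset.mem_toList, not_or]
    exact ⟨(hF₁mem b hb).1, (hF₁mem b hb).2.1⟩
  have hv₂' : ∀ b ∈ F₁, ((nonNbr G (reach G {v} (U T₂ A)) (A b)).card : ℝ) ≤ ε * (A b).card := by
    intro b hb
    refine hv₂ b ?_
    simp only [List.mem_cons, Finset.mem_toList, not_or]
    exact ⟨(hF₁mem b hb).1, (hF₁mem b hb).2.2⟩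
  have hvs : ∀ F ⊆ F₁, ∀ p ∈ [((i₀, {v}) : ι × Finset V)],
      p.2.card = 1 ∧ p.2 ⊆ A p.1 ∧ p.1 ∉ F := by
    intro F hF p hp
    rw [List.mem_singleton] at hp
    subst hp
    exact ⟨by simp, by simpa using hvA, fun hm => (hF₁mem _ (hF hm)).1 rfl⟩
  have hFne : ∀ F : Finset ι, 1 ≤ F.card → F.Nonempty := fun F hF => Finset.card_pos.1 hF
  -- the first levelling, used to find paths ending in `v`
  obtain ⟨Q, l₂, F₂, C₂, hQne, hl₂, hsuf, hQsub, hQmem, -, hF₂, hF₂c, hC₂⟩ :=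
    h.grow_singletons (κ := 1 / 2) W w (U T₂ A) (by rw [hUlen, hT₂, hw]) hw1 (i₀, {v}) [] F₁
      (fun b => nbr G (reach G {v} (U T₂ A)) (A b)) trivial (by rw [hUlen, hT₂]; simp; omega)
      (hFne _ (by
        have := Nat.le_mul_of_pos_left (w * (g₁ + t) + 2) hw1
        omega)) (hvs F₁ (Finset.Subset.refl _))
      (fun b hb => ⟨nbr_subset _ _, by
        have := card_nbr_ge (Finset.Subset.refl _) (hv₂' b hb) (show 1 * ((A b).card : ℝ) ≤ _ by
          rw [one_mul])
        have := h.card_pos b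
        nlinarith, covers_nbr _ _⟩) (by linarith)
  obtain rfl := eq_of_suffix_singleton hsuf hl₂
  rw [← hκ₂] at hC₂
  have hF₂c' : w * (g₁ + t) + 2 ≤ F₂.card := hcardF hF₂c (by rw [hF₁c]; omega)
  obtain ⟨q, Q, rfl⟩ := List.exists_cons_of_ne_nil hQne
  have hQT : ∀ p ∈ q :: Q, p.1 ∈ T₂ ∧ p.2 ⊆ A p.1 := by
    intro p hp
    obtain ⟨u, hu, h1, h2⟩ := hQmem p hp
    obtain ⟨h3, h4⟩ := hUmem _ _ u hu
    rw [h1]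
    exact ⟨h3, h4 ▸ h2⟩
  -- Thinning with `g = 1` singles out one block for the far end of the path. In the other blocks
  -- the parts missed by `S` are anticomplete to the whole first levelling, hence to any path inside
  -- it.
  obtain ⟨S, hS, F', hF', hF'c, hD, hF'n⟩ := h.exists_thin q.2 q.1 F₂ C₂ 1 (hQT q (by simp)).2
    (fun hm => (hF₁mem _ (hF₂ hm)).2.2 (hQT q (by simp)).1) (by omega)
    (fun b hb => (hC₂ b hb).2.2.1) (fun b hb => ⟨(hC₂ b hb).1.trans (nbr_subset _ _),
      (hC₂ b hb).2.1⟩) (by linarith)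
  obtain ⟨b₀, rfl⟩ := Finset.card_eq_one.1 hF'c
  have hb₀ : b₀ ∈ F₂ := hF' (by simp)
  obtain ⟨D, hDdef⟩ : ∃ D, D = nbr G S (C₂ b₀) := ⟨_, rfl⟩
  obtain ⟨lQ, hlQ⟩ : ∃ lQ, lQ = (q.1, S) :: (Q ++ [(i₀, {v})]) := ⟨_, rfl⟩
  have hDlev : Lev G ((b₀, D) :: lQ) := by
    rw [hDdef, hlQ]
    exact (hC₂ b₀ hb₀).2.2.replace_second (nbr_subset _ _) hS (covers_nbr _ _)
  have hDc : κ₂ / 2 * (A b₀).card ≤ D.card := hDdef ▸ hD b₀ (by simp)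
  have hDA : D ⊆ A b₀ := by
    rw [hDdef]
    exact (nbr_subset _ _).trans ((hC₂ b₀ hb₀).1.trans (nbr_subset _ _))
  obtain ⟨F₃, hF₃⟩ : ∃ F₃, F₃ = F₂.erase b₀ := ⟨_, rfl⟩
  have hF₃c : w * (g₁ + t) + 1 ≤ F₃.card := by
    rw [hF₃, Finset.card_erase_of_mem hb₀]; omega
  have hF₃₂ : ∀ b ∈ F₃, b ∈ F₂ ∧ b ≠ b₀ := by
    intro b hb
    rw [hF₃, Finset.mem_erase] at hb
    exact ⟨hb.2, hb.1⟩
  have hF₃₁ : F₃ ⊆ F₁ := fun b hb => hF₂ (hF₃₂ b hb).1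
  obtain ⟨C₃, hC₃⟩ : ∃ C₃ : ι → Finset V, C₃ = fun b => nonNbr G S (C₂ b) := ⟨_, rfl⟩
  have hC₃A : ∀ b ∈ F₃, C₃ b ⊆ A b := by
    intro b hb
    rw [hC₃]
    exact (nonNbr_subset _ _).trans ((hC₂ b (hF₃₂ b hb).1).1.trans (nbr_subset _ _))
  have hC₃c : ∀ b ∈ F₃, κ₂ / 4 * (A b).card ≤ (C₃ b).card := by
    intro b hb
    rw [hC₃]
    exact hF'n b (hF₃₂ b hb).1 (by simpa using (hF₃₂ b hb).2)
  have hQC₃ : ∀ b ∈ F₃, ∀ p ∈ lQ, Anticomplete G p.2 (C₃ b) := by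
    intro b hb p hp
    rw [hlQ] at hp
    rw [hC₃]
    rcases List.mem_cons.1 hp with rfl | hp
    · exact anticomplete_nonNbr _ _
    · exact anticomplete_mono ((hC₂ b (hF₃₂ b hb).1).2.2.2.1 p hp) (Finset.Subset.refl _)
        (nonNbr_subset _ _)
  have hlQmem : ∀ p ∈ lQ, (p.1 = i₀ ∨ p.1 ∈ T₂) ∧ p.2 ⊆ A p.1 := by
    intro p hp
    rw [hlQ] at hp
    simp only [List.mem_cons, List.mem_append, List.not_mem_nil, or_false] at hp
    rcases hp with rfl | hp | rfl
    · exact ⟨Or.inr (hQT q (by simp)).1, hS.trans (hQT q (by simp)).2⟩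
    · exact ⟨Or.inr (hQT p (by simp [hp])).1, (hQT p (by simp [hp])).2⟩
    · exact ⟨Or.inl rfl, by simpa using hvA⟩
  have hlQnd : (lQ.map Prod.fst).Nodup ∧ lQ.length ≤ t + 1 := by
    have h1 : ((q :: Q).map Prod.fst).Nodup := hQsub.nodup (by
      rw [List.nodup_reverse, hUfst]; exact Finset.nodup_toList _)
    have h2 := hQsub.length_le
    rw [List.length_reverse, List.length_map, List.length_map, hUlen, hT₂] at h2
    have e : lQ.map Prod.fst = (q :: Q).map Prod.fst ++ [i₀] := by rw [hlQ]; simp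
    refine ⟨?_, by rw [hlQ]; simp at h2 ⊢; omega⟩
    rw [e, List.nodup_append]
    refine ⟨h1, by simp, ?_⟩
    intro a ha b hb
    rw [List.mem_singleton] at hb
    subst hb
    rintro rfl
    obtain ⟨p, hp, hpa⟩ := List.mem_map.1 ha
    exact hi₀T.2 (hpa ▸ (hQT p hp).1)
  -- the second levelling
  obtain ⟨M, l₂, F₄, C₅, hMne, hl₂, hsuf, hMsub, hMmem, -, hF₄, hF₄c, hC₅⟩ :=
    h.grow_singletons (κ := κ₂ / 8) W w (U T₁ A) (by rw [hUlen, hT₁, hw]) hw1 (i₀, {v}) [] F₃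
      (fun b => nbr G (reach G {v} (U T₁ A)) (C₃ b)) trivial (by rw [hUlen, hT₁]; simp; omega)
      (hFne _ (by omega)) (hvs F₃ hF₃₁)
      (fun b hb => ⟨(nbr_subset _ _).trans (hC₃A b hb), by
        have := card_nbr_ge (hC₃A b hb) (hv₁' b (hF₃₁ hb)) (hC₃c b hb)
        have := h.card_pos b
        nlinarith, covers_nbr _ _⟩) (by linarith)
  obtain rfl := eq_of_suffix_singleton hsuf hl₂
  rw [← hκ₅] at hC₅
  have hC₅₃ : ∀ b ∈ F₄, C₅ b ⊆ C₃ b := fun b hb => (hC₅ b hb).1.trans (nbr_subset _ _)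
  have hF₄c' : g₁ + t ≤ F₄.card := hcardF hF₄c (by omega)
  obtain ⟨m, M, rfl⟩ := List.exists_cons_of_ne_nil hMne
  have hMT : ∀ p ∈ m :: M, p.1 ∈ T₁ ∧ p.2 ⊆ A p.1 := by
    intro p hp
    obtain ⟨u, hu, h1, h2⟩ := hMmem p hp
    obtain ⟨h3, h4⟩ := hUmem _ _ u hu
    rw [h1]
    exact ⟨h3, h4 ▸ h2⟩
  -- The blocks of `F₅` stay reachable by the second levelling and form the final pool. The
  -- remaining blocks have large parts missed by both levellings, from which the third way is made.
  obtain ⟨S', hS', F₅, hF₅, hF₅c, hC₆, hC₆n⟩ := h.exists_thin m.2 m.1 F₄ C₅ g₁ (hMT m (by simp)).2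
    (fun hm => (hF₁mem _ (hF₃₁ (hF₄ hm))).2.1 (hMT m (by simp)).1) (by omega)
    (fun b hb => (hC₅ b hb).2.2.1) (fun b hb => ⟨(hC₅₃ b hb).trans (hC₃A b (hF₄ hb)),
      (hC₅ b hb).2.1⟩) (by linarith)
  obtain ⟨lM, hlM⟩ : ∃ lM, lM = (m.1, S') :: M := ⟨_, rfl⟩
  have hlMmem : ∀ p ∈ lM, p.1 ∈ T₁ ∧ p.2 ⊆ A p.1 := by
    intro p hp
    rw [hlM] at hp
    rcases List.mem_cons.1 hp with rfl | hp
    · exact ⟨(hMT m (by simp)).1, hS'.trans (hMT m (by simp)).2⟩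
    · exact hMT p (by simp [hp])
  have hlMnd : (lM.map Prod.fst).Nodup ∧ lM.length ≤ t := by
    have h1 : ((m :: M).map Prod.fst).Nodup := hMsub.nodup (by
      rw [List.nodup_reverse, hUfst]; exact Finset.nodup_toList _)
    have h2 := hMsub.length_le
    rw [List.length_reverse, List.length_map, List.length_map, hUlen, hT₁] at h2
    refine ⟨by rw [hlM]; simpa using h1, by rw [hlM]; simpa using h2⟩
  obtain ⟨C₆, hC₆def⟩ : ∃ C₆ : ι → Finset V, C₆ = fun b => nbr G S' (C₅ b) := ⟨_, rfl⟩
  have hC₆lev : ∀ b ∈ F₅, Lev G ((b, C₆ b) :: (lM ++ [(i₀, {v})])) := by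
    intro b hb
    rw [hC₆def, hlM]
    exact (hC₅ b (hF₅ hb)).2.2.replace_second (nbr_subset _ _) hS' (covers_nbr _ _)
  have hC₆₃ : ∀ b ∈ F₅, C₆ b ⊆ C₃ b := by
    intro b hb
    rw [hC₆def]
    exact (nbr_subset _ _).trans (hC₅₃ b (hF₅ hb))
  obtain ⟨E, hE⟩ : ∃ E : ι → Finset V, E = fun b => nonNbr G S' (C₅ b) := ⟨_, rfl⟩
  have hEC₃ : ∀ b ∈ F₄, E b ⊆ C₃ b := by
    intro b hb
    rw [hE]
    exact (nonNbr_subset _ _).trans (hC₅₃ b hb)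
  have hME : ∀ b ∈ F₄, ∀ p ∈ lM, Anticomplete G p.2 (E b) := by
    intro b hb p hp
    rw [hlM] at hp
    rw [hE]
    rcases List.mem_cons.1 hp with rfl | hp
    · exact anticomplete_nonNbr _ _
    · exact anticomplete_mono ((hC₅ b hb).2.2.2.1 p (List.mem_append_left _ hp))
        (Finset.Subset.refl _) (nonNbr_subset _ _)
  -- the vertex at the far end of the path
  obtain ⟨T₃, hT₃s, hT₃⟩ := Finset.exists_subset_card_eq (show t ≤ (F₄ \ F₅).card by
    rw [Finset.card_sdiff_of_subset hF₅, hF₅c]; omega)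
  have hT₃mem : ∀ b ∈ T₃, b ∈ F₄ ∧ b ∉ F₅ := fun b hb => Finset.mem_sdiff.1 (hT₃s hb)
  obtain ⟨y, hyD, hy⟩ := h.exists_reach hε hx (κ := κ₅ / 4) hn (by linarith) b₀ D hDA (by
      have := h.card_pos b₀
      nlinarith) (U T₃ E) (by
      intro u hu
      obtain ⟨h1, h2⟩ := hUmem _ _ u hu
      have h3 := hT₃mem _ h1
      rw [h2]
      refine ⟨(hEC₃ _ h3.1).trans (hC₃A _ (hF₄ h3.1)), ?_⟩
      rw [hE]
      exact hC₆n _ h3.1 h3.2) (by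
      rw [hUfst, List.nodup_cons]
      refine ⟨?_, Finset.nodup_toList _⟩
      rw [Finset.mem_toList]
      exact fun hm => (hF₃₂ _ (hF₄ (hT₃mem _ hm).1)).2 rfl) (by rwa [hUlen, hT₃])
  rw [hUfst] at hy
  obtain ⟨P, hPlev, hPf⟩ := hDlev.exists_path hyD
  have hPfst : P.map Prod.fst = lQ.map Prod.fst := forall₂_map_fst hPf fun _ _ h => h.1
  have hPsing : ∀ p ∈ (b₀, {y}) :: P, p.2.card = 1 := by
    intro p hp
    rcases List.mem_cons.1 hp with rfl | hp
    · simp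
    · obtain ⟨q, -, h⟩ := forall₂_exists_right hPf p hp
      exact h.2.2
  have hPmem : ∀ p ∈ P, (p.1 = i₀ ∨ p.1 ∈ T₂) ∧ p.2 ⊆ A p.1 ∧ ∃ q ∈ lQ, p.2 ⊆ q.2 := by
    intro p hp
    obtain ⟨q, hq, h1, h2, -⟩ := forall₂_exists_right hPf p hp
    have := hlQmem q hq
    rw [h1]
    exact ⟨this.1, h2.trans this.2, q, hq, h2⟩
  have hb₀mem := hF₁mem b₀ (hF₂ hb₀)
  -- The first levelling has the single vertex `v` as its apex, so the path from `y` must end at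
  -- `v`.
  obtain ⟨Pr, hPr⟩ : ∃ Pr, P.reverse = (i₀, {v}) :: Pr := by
    have h1 := List.rel_reverse hPf
    rw [hlQ, List.reverse_cons, List.reverse_append] at h1
    change List.Forall₂ _ P.reverse ((i₀, {v}) :: (Q.reverse ++ [(q.1, S)])) at h1
    cases h2 : P.reverse with
    | nil => rw [h2] at h1; cases h1
    | cons z Pr =>
      rw [h2] at h1
      obtain ⟨⟨hz1, hz2, hz3⟩, -⟩ := List.forall₂_cons.1 h1
      refine ⟨Pr, ?_⟩
      have e : z = (i₀, {v}) := Prod.ext hz1 (Finset.eq_of_subset_of_card_le hz2 (by simp [hz3]))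
      rw [e]
  have hPrev : ((b₀, {y}) :: P).reverse = (i₀, {v}) :: (Pr ++ [(b₀, {y})]) := by
    rw [List.reverse_cons, hPr]; rfl
  have hPlen : (Pr ++ [(b₀, ({y} : Finset V))]).length ≤ t + 1 := by
    have h1 := congrArg List.length hPr
    have h2 := congrArg List.length hPfst
    simp at h1 h2 ⊢
    omega
  have hPmem' : ∀ p ∈ (i₀, {v}) :: (Pr ++ [(b₀, {y})]),
      p.2.card = 1 ∧ p.2 ⊆ A p.1 ∧ (p.1 = b₀ ∨ p.1 = i₀ ∨ p.1 ∈ T₂) := by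
    intro p hp
    rw [← hPrev, List.mem_reverse] at hp
    refine ⟨hPsing p hp, ?_⟩
    rcases List.mem_cons.1 hp with rfl | hp
    · exact ⟨by simpa using hDA hyD, Or.inl rfl⟩
    · exact ⟨(hPmem p hp).2.1, Or.inr (hPmem p hp).1⟩
  have hPF : ∀ b ∈ F₃, ∀ p : ι × Finset V, (p.1 = b₀ ∨ p.1 = i₀ ∨ p.1 ∈ T₂) → p.1 ≠ b := by
    intro b hb p hp e
    have h1 := hF₁mem b (hF₃₁ hb)
    rw [e] at hp
    rcases hp with hp | hp | hp
    · exact (hF₃₂ b hb).2 hp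
    · exact h1.1 hp
    · exact h1.2.2 hp
  -- attach the second levelling to the path
  obtain ⟨M₁, l₂, F₇, C₇, hM₁ne, hl₂, hsuf, hM₁sub, hM₁mem, hM₁lev, hF₇, hF₇c, hC₇⟩ :=
    h.grow_singletons (κ := κ₅ / 4) W w lM.reverse (by
        rw [hw]
        refine Nat.pow_le_pow_right (by omega) ?_
        rw [List.length_reverse]
        omega) hw1 (i₀, {v})
      (Pr ++ [(b₀, {y})]) F₅ C₆ (hPrev ▸ hPlev.reverse hPsing)
      (by rw [List.length_reverse]; omega)
      (hFne _ (by rw [hF₅c, hg₁]; exact Nat.mul_pos hw1 (Nat.mul_pos hw1 (by omega))))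
      (fun p hp => ⟨(hPmem' p hp).1, (hPmem' p hp).2.1,
        fun hm => hPF _ (hF₄ (hF₅ hm)) p (hPmem' p hp).2.2 rfl⟩)
      (fun b hb => ⟨(hC₆₃ b hb).trans (hC₃A b (hF₄ (hF₅ hb))), by
        have h1 := hC₆ b hb
        have h2 := h.card_pos b
        rw [hC₆def]
        nlinarith, by
        intro c hc
        have h1 := (hC₆lev b hb).head_subset_reach hc
        rw [reach_append_singleton] at h1
        exact (mem_nbr.1 h1).2⟩) (by linarith)
  rw [← hκ₇] at hC₇
  have hF₇c' : w * (g + 1) ≤ F₇.card := hcardF hF₇c (by rw [hF₅c, hg₁])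
  -- Vertices of the second levelling may have neighbours all along the path. Growth has cut the
  -- path, keeping the portion from `y` to `s`; the new levelling hangs from `s`, the future apex.
  obtain ⟨s, r, rfl⟩ := List.exists_cons_of_ne_nil hl₂
  have hF₇₃ : F₇ ⊆ F₃ := (hF₇.trans hF₅).trans hF₄
  -- the levelling growing from the far end
  obtain ⟨L₁, l₂, F₈, C₉, hL₁ne, hl₂, hsuf', hL₁sub, hL₁mem, -, hF₈, hF₈c, hC₉⟩ :=
    h.grow_singletons (κ := κ₇ / 2) W w (U T₃ E) (by rw [hUlen, hT₃, hw]) hw1 (b₀, {y}) [] F₇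
      (fun b => nbr G (reach G {y} (U T₃ E)) (C₇ b)) trivial (by rw [hUlen, hT₃]; simp; omega)
      (hFne _ (le_trans (Nat.mul_pos hw1 (by omega)) hF₇c')) (by
        intro p hp
        rw [List.mem_singleton] at hp
        subst hp
        exact ⟨by simp, by simpa using hDA hyD, fun hm => (hF₃₂ _ (hF₇₃ hm)).2 rfl⟩)
      (fun b hb => by
        have hCA : C₇ b ⊆ A b := (hC₇ b hb).1.trans ((hC₆₃ b (hF₇ hb)).trans (hC₃A b (hF₇₃ hb)))
        refine ⟨(nbr_subset _ _).trans hCA, ?_, covers_nbr _ _⟩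
        have := card_nbr_ge hCA (hy b (by
          simp only [List.mem_cons, Finset.mem_toList, not_or]
          exact ⟨(hF₃₂ b (hF₇₃ hb)).2, fun hm => (hT₃mem b hm).2 (hF₇ hb)⟩)) (hC₇ b hb).2.1
        have := h.card_pos b
        nlinarith) (by linarith)
  obtain rfl := eq_of_suffix_singleton hsuf' hl₂
  rw [← hκ] at hC₉
  have hF₈c' : g + 1 ≤ F₈.card := hcardF hF₈c hF₇c'
  have hC₉₇ : ∀ b ∈ F₈, C₉ b ⊆ C₇ b := fun b hb => (hC₉ b hb).1.trans (nbr_subset _ _)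
  have hC₉₃ : ∀ b ∈ F₈, C₉ b ⊆ C₃ b := fun b hb =>
    (hC₉₇ b hb).trans ((hC₇ b (hF₈ hb)).1.trans (hC₆₃ b (hF₇ (hF₈ hb))))
  have hL₁T : ∀ p ∈ L₁, p.1 ∈ T₃ ∧ p.2 ⊆ E p.1 := by
    intro p hp
    obtain ⟨u, hu, h1, h2⟩ := hL₁mem p hp
    obtain ⟨h3, h4⟩ := hUmem _ _ u hu
    rw [h1]
    exact ⟨h3, h4 ▸ h2⟩
  have hM₁T : ∀ p ∈ M₁, p.1 ∈ T₁ ∧ ∃ q ∈ lM, p.1 = q.1 ∧ p.2 ⊆ q.2 := by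
    intro p hp
    obtain ⟨u, hu, h1, h2⟩ := hM₁mem p hp
    rw [List.mem_reverse] at hu
    rw [h1]
    exact ⟨(hlMmem u hu).1, u, hu, rfl, h2⟩
  have hsr := hsuf.subset
  obtain ⟨R, hR, hRP⟩ : ∃ R, (s :: r).reverse = (b₀, {y}) :: R ∧ ∀ p ∈ R, p ∈ P := by
    have h1 : (s :: r).reverse <+: (b₀, {y}) :: P := by
      rw [← List.reverse_suffix, List.reverse_reverse, hPrev]
      exact hsuf
    cases h2 : (s :: r).reverse with
    | nil => simp at h2
    | cons z R =>
      rw [h2] at h1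
      obtain ⟨rfl, h3⟩ := List.cons_prefix_cons.1 h1
      exact ⟨R, rfl, h3.subset⟩
  have hrlen : r.length ≤ t + 1 := by
    have := hsuf.length_le
    simp only [List.length_cons] at this
    omega
  have hT₃F₃ : ∀ b ∈ T₃, b ∈ F₃ := fun b hb => hF₄ (hT₃mem b hb).1
  refine ⟨L₁ ++ r.reverse, s, M₁, F₈, C₉, BiLev.of_path (C := C₇) hL₁ne hM₁ne hR
    (fun p hp => (hPmem' p (hsr hp)).1) ⟨?_, ?_, ?_⟩ ?_ ?_ ?_ ?_ ?_ ?_ ?_ ?_ ?_ ?_ hC₉₇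
    (fun b hb => (hC₉ b hb).2.2) ?_ hM₁lev (fun b hb => (hC₇ b (hF₈ hb)).2.2) ?_ ?_ ?_,
    by omega, ?_⟩
  · exact hL₁sub.nodup (by rw [List.nodup_reverse, hUfst]; exact Finset.nodup_toList _)
  · refine (hsuf.sublist.map Prod.fst).nodup ?_
    rw [← hPrev, List.map_reverse, List.nodup_reverse, List.map_cons, hPfst, List.nodup_cons]
    refine ⟨fun hm => ?_, hlQnd.1⟩
    obtain ⟨p, hp, hpb⟩ := List.mem_map.1 hm
    rcases (hlQmem p hp).1 with h1 | h1
    · exact hb₀mem.1 (hpb.symm.trans h1)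
    · exact hb₀mem.2.2 ((show p.1 = b₀ from hpb) ▸ h1)
  · refine hM₁sub.nodup ?_
    rw [List.map_reverse, List.reverse_reverse]
    exact hlMnd.1
  · intro p hp q hq e
    exact hPF _ (hT₃F₃ _ (hL₁T p hp).1) q (hPmem' q (hsr hq)).2.2 e.symm
  · intro p hp q hq e
    exact (hF₁mem _ (hF₃₁ (hT₃F₃ _ (hL₁T p hp).1))).2.1 (e ▸ (hM₁T q hq).1)
  · intro p hp q hq e
    have h1 := (hM₁T q hq).1
    rw [← e] at h1
    rcases (hPmem' p (hsr hp)).2.2 with h2 | h2 | h2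
    · exact hb₀mem.2.1 (h2 ▸ h1)
    · exact hi₀T.1 (h2 ▸ h1)
    · exact hT₁₂ _ h2 h1
  · exact fun p hp hm => (hT₃mem _ (hL₁T p hp).1).2 (hF₇ (hF₈ hm))
  · exact fun p hp hm => hPF _ (hF₇₃ (hF₈ hm)) p (hPmem' p (hsr hp)).2.2 rfl
  · exact fun p hp hm => (hF₁mem _ (hF₃₁ (hF₇₃ (hF₈ hm)))).2.1 (hM₁T p hp).1
  · intro p hp
    have h1 := hL₁T p hp
    exact h1.2.trans ((hEC₃ _ (hT₃mem _ h1.1).1).trans (hC₃A _ (hT₃F₃ _ h1.1)))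
  · exact fun p hp => (hPmem' p (hsr hp)).2.1
  · intro p hp
    obtain ⟨-, q, hq, h1, h2⟩ := hM₁T p hp
    rw [h1]
    exact h2.trans (hlMmem q hq).2
  · exact fun b hb => ⟨(hC₉₃ b hb).trans (hC₃A b (hF₇₃ (hF₈ hb))), (hC₉ b hb).2.1⟩
  · exact (hPrev ▸ hPlev.reverse hPsing).of_suffix hsuf
  · intro b hb z hz
    obtain ⟨-, -, q, hq, h1⟩ := hPmem z (hRP z hz)
    exact anticomplete_mono (hQC₃ b (hF₇₃ (hF₈ hb)) q hq) h1 (hC₉₃ b hb)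
  · intro p hp z hz
    obtain ⟨-, -, q, hq, h1⟩ := hPmem z (hRP z hz)
    have h2 := hL₁T p hp
    exact anticomplete_mono (hQC₃ p.1 (hT₃F₃ _ h2.1) q hq) h1
      (h2.2.trans (hEC₃ _ (hT₃mem _ h2.1).1))
  · intro p hp z hz
    obtain ⟨-, q, hq, -, h1⟩ := hM₁T z hz
    have h2 := hL₁T p hp
    exact anticomplete_symm (anticomplete_mono (hME p.1 (hT₃mem _ h2.1).1 q hq) h1 h2.2)
  -- At most `t` levels in `L₁`, `t + 1` path vertices other than `s`, and `t` levels in `M₁`.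
  · have h1 := hL₁sub.length_le
    have h2 := hM₁sub.length_le
    rw [List.length_reverse, List.length_map, List.length_map, hUlen, hT₃] at h1
    rw [List.length_reverse, List.length_map, List.length_map, List.length_reverse] at h2
    have := hlMnd.2
    simp only [List.length_append, List.length_reverse]
    omega

end

/-! ### Covering rates, and increasing the height by one. -/

section

variable {V : Type*} {ι : Type*} {G : SimpleGraph V} {A : ι → Finset V} {ε x κ : ℝ}

/-- Some part `C'` of `C` is covered by `y ^ (j + 1)` vertices of `S`, while `y ^ j` vertices of
`S` never cover more than a small part of it. -/
theorem exists_rate {S C : Finset V} {n y τ : ℝ} {J : ℕ} (hn : n ≤ y ^ J)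
    (hS : (S.card : ℝ) ≤ n) (hτ0 : 0 < τ) (hτ1 : τ ≤ 1) (hcov : Covers G S C) (hC : C.Nonempty)
    (hlink : ∀ s ∈ S, ((nbr G {s} C).card : ℝ) < τ ^ J * C.card) :
    ∃ j < J, ∃ C' ⊆ C, τ ^ J * C.card ≤ C'.card ∧ ∃ Y ⊆ S, (Y.card : ℝ) ≤ y ^ (j + 1) ∧
      Covers G Y C' ∧
      ∀ Y' ⊆ S, (Y'.card : ℝ) ≤ y ^ j → ((nbr G Y' C').card : ℝ) ≤ τ * C'.card := by
  classical
  have hC0 : (0 : ℝ) < C.card := by exact_mod_cast hC.card_pos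
  -- The threshold falls from all of `C` at `j = J` to `τ ^ J` at `j = 0`, more than one vertex can
  -- cover. At the least good exponent `j + 1`, failure at `j` says that `y ^ j` vertices cover less
  -- than τ times what `Y` covers.
  let P : ℕ → Prop := fun j => ∃ Y ⊆ S, (Y.card : ℝ) ≤ y ^ j ∧
    τ ^ (J - j) * C.card ≤ (nbr G Y C).card
  have hPJ : P J := ⟨S, Finset.Subset.refl _, hS.trans hn, by
    rw [nbr_eq_of_covers hcov]; simp⟩
  have hP0 : ¬ P 0 := by
    rintro ⟨Y, hYS, hY, hYC⟩
    rw [pow_zero] at hY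
    have hY1 : Y.card ≤ 1 := by exact_mod_cast hY
    rw [Nat.sub_zero] at hYC
    rcases Y.eq_empty_or_nonempty with rfl | ⟨s, hs⟩
    · have : nbr G ∅ C = ∅ := by
        ext c; simp [mem_nbr]
      rw [this] at hYC
      have : 0 < τ ^ J * C.card := by positivity
      simp at hYC
      linarith
    · have hYs : Y ⊆ {s} := by
        intro z hz
        rw [Finset.mem_singleton]
        exact Finset.card_le_one.1 hY1 z hz s hs
      have h1 : ((nbr G Y C).card : ℝ) ≤ (nbr G {s} C).card := by
        exact_mod_cast Finset.card_le_card (nbr_mono hYs (Finset.Subset.refl _))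
      have := hlink s (hYS hs)
      linarith
  have hex : ∃ j, P j := ⟨J, hPJ⟩
  obtain ⟨j, hj⟩ : ∃ j, Nat.find hex = j + 1 := by
    refine Nat.exists_eq_succ_of_ne_zero fun h0 => hP0 ?_
    exact h0 ▸ Nat.find_spec hex
  have hjJ : j + 1 ≤ J := hj ▸ Nat.find_min' hex hPJ
  obtain ⟨Y, hYS, hY, hYC⟩ : P (j + 1) := hj ▸ Nat.find_spec hex
  refine ⟨j, hjJ, nbr G Y C, nbr_subset _ _, le_trans ?_ hYC, Y, hYS, hY, covers_nbr _ _, ?_⟩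
  · exact mul_le_mul_of_nonneg_right
      (pow_le_pow_of_le_one hτ0.le hτ1 (Nat.sub_le _ _)) hC0.le
  · intro Y' hY' hc
    have h1 : ¬ P j := Nat.find_min hex (by omega)
    have h2 : ((nbr G Y' C).card : ℝ) < τ ^ (J - j) * C.card := by
      by_contra! hle
      exact h1 ⟨Y', hY', hc, hle⟩
    have h3 : ((nbr G Y' (nbr G Y C)).card : ℝ) ≤ (nbr G Y' C).card := by
      exact_mod_cast Finset.card_le_card (nbr_mono (Finset.Subset.refl _) (nbr_subset _ _))
    have h4 : τ ^ (J - j) = τ * τ ^ (J - (j + 1)) := by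
      rw [← pow_succ']
      congr 1
      omega
    rw [h4, mul_assoc] at h2
    have := mul_le_mul_of_nonneg_left hYC hτ0.le
    linarith

/-- The exponent is made common to a `1 / J` share of the blocks. With a common `z`, a piece of at
most `z` vertices taken from the cover of one block covers little of any other. -/
theorem Sparse.exists_rate (h : Sparse G A ε x) {n y τ : ℝ} {J : ℕ} (hJ : 0 < J) (hy : 1 ≤ y)
    (hny : n ≤ y ^ J) (hn : ∀ X : Finset V, (X.card : ℝ) ≤ n) (hτ0 : 0 < τ) (hτ1 : τ ≤ 1)
    (hκ : 0 < κ) (S : Finset V) (i : ι) (F : Finset ι) (C : ι → Finset V) (hS : S ⊆ A i)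
    (hi : i ∉ F) (hcov : ∀ b ∈ F, Covers G S (C b))
    (hC : ∀ b ∈ F, C b ⊆ A b ∧ κ * (A b).card ≤ (C b).card) (hε : ε < τ ^ J * κ) :
    ∃ z : ℝ, 1 ≤ z ∧ ∃ F' ⊆ F, F.card ≤ J * F'.card ∧ ∃ C' Y : ι → Finset V, ∀ b ∈ F',
      C' b ⊆ C b ∧ τ ^ J * κ * (A b).card ≤ (C' b).card ∧ Y b ⊆ S ∧
      ((Y b).card : ℝ) ≤ z * y ∧ Covers G (Y b) (C' b) ∧
      ∀ Y' ⊆ S, (Y'.card : ℝ) ≤ z → ((nbr G Y' (C' b)).card : ℝ) ≤ τ * (C' b).card := by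
  classical
  obtain ⟨j, -, F', hF', hc, hP⟩ := exists_popular hJ F
    (fun j b => ∃ C' ⊆ C b, τ ^ J * (C b).card ≤ C'.card ∧ ∃ Y ⊆ S, (Y.card : ℝ) ≤ y ^ (j + 1) ∧
      Covers G Y C' ∧
      ∀ Y' ⊆ S, (Y'.card : ℝ) ≤ y ^ j → ((nbr G Y' C').card : ℝ) ≤ τ * C'.card) (by
    intro b hb
    have hA := h.card_pos b
    obtain ⟨hCA, hCκ⟩ := hC b hb
    have hC0 : (0 : ℝ) < (C b).card := lt_of_lt_of_le (by positivity) hCκ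
    refine BiGrade.exists_rate hny (hn S) hτ0 hτ1 (hcov b hb)
      (Finset.card_pos.1 (by exact_mod_cast hC0)) fun s hs => ?_
    have h1 := h.link i b (fun e => hi (e ▸ hb)) s (hS hs)
    have h2 : ((nbr G {s} (C b)).card : ℝ) ≤ (nbr G {s} (A b)).card := by
      exact_mod_cast Finset.card_le_card (nbr_mono (Finset.Subset.refl _) hCA)
    have h3 : ε * (A b).card < τ ^ J * κ * (A b).card := mul_lt_mul_of_pos_right hε hA
    have h4 : τ ^ J * (κ * (A b).card) ≤ τ ^ J * (C b).card := by gcongr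
    linarith)
  choose! C' hC' hsize Y hY hYc hYcov hmin using hP
  refine ⟨y ^ j, one_le_pow₀ hy, F', hF', hc, C', Y, fun b hb => ⟨hC' b hb, ?_, hY b hb, ?_,
    hYcov b hb, hmin b hb⟩⟩
  · have h4 : τ ^ J * (κ * (A b).card) ≤ τ ^ J * (C b).card := by
      gcongr
      exact (hC b (hF' hb)).2
    have := hsize b hb
    linarith
  · rw [← pow_succ]
    exact hYc b hb

/-- Rounding `z ≥ 1` down loses at most a factor 2, so `⌈2 * y⌉₊` pieces of `⌊z⌋₊` vertices suffice.
-/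
theorem exists_floor_bounds {z y : ℝ} (hz : 1 ≤ z) (hy : 1 ≤ y) : ∃ q m : ℕ, 0 < q ∧
    (q : ℝ) ≤ 3 * y ∧ (m : ℝ) ≤ z ∧ ∀ k : ℕ, (k : ℝ) ≤ z * y → k ≤ q * m := by
  refine ⟨⌈2 * y⌉₊, ⌊z⌋₊, Nat.ceil_pos.2 (by linarith), ?_, Nat.floor_le (by linarith), ?_⟩
  · have := (Nat.ceil_lt_add_one (show 0 ≤ 2 * y by linarith)).le
    linarith
  · intro k hk
    have h1 : z ≤ 2 * (⌊z⌋₊ : ℝ) := by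
      have h2 := (Nat.lt_floor_add_one z).le
      have h3 : (1 : ℝ) ≤ ⌊z⌋₊ := by exact_mod_cast Nat.le_floor (by simpa using hz)
      linarith
    have h4 : 2 * y ≤ (⌈2 * y⌉₊ : ℝ) := Nat.le_ceil _
    have h5 : (k : ℝ) ≤ ⌈2 * y⌉₊ * ⌊z⌋₊ := by
      calc (k : ℝ) ≤ z * y := hk
        _ ≤ 2 * ⌊z⌋₊ * y := by gcongr
        _ = 2 * y * ⌊z⌋₊ := by ring
        _ ≤ _ := by gcongr
    exact_mod_cast h5

/-- The height of a bi-levelling can be increased by one. -/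
theorem BiLev.extend {L M : List (ι × Finset V)} {s : ι × Finset V} {F : Finset ι}
    {C : ι → Finset V} (hB : BiLev G A κ L s M F C) (h : Sparse G A ε x) {n y : ℝ} {J g : ℕ}
    (hJ : 0 < J) (hy : 1 ≤ y) (hyx : y ≤ x) (hny : n ≤ y ^ J)
    (hn : ∀ X : Finset V, (X.card : ℝ) ≤ n) (hκ : 0 < κ) (hε : 16 * ε ≤ (1 / 8) ^ J * κ)
    (hε0 : 0 < ε) (hF : J * (g + 1) ≤ F.card) :
    ∃ L' M' F' C', BiLev G A ((1 / 8) ^ J * κ / 4) L' s M' F' C' ∧ g ≤ F'.card ∧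
      L'.length + M'.length = L.length + M.length + 1 := by
  classical
  obtain ⟨a, L, rfl⟩ := List.exists_cons_of_ne_nil hB.left_ne
  obtain ⟨m, M, rfl⟩ := List.exists_cons_of_ne_nil hB.right_ne
  have ham : ∀ b ∈ F, b ≠ a.1 ∧ b ≠ m.1 := by
    intro b hb
    have := hB.notMem b hb
    simp at this
    exact ⟨this.1, this.2.2.2.1⟩
  have haA : a.2 ⊆ A a.1 := hB.sub a (by simp)
  have hmA : m.2 ⊆ A m.1 := hB.sub m (by simp)
  obtain ⟨κ₁, hκ₁⟩ : ∃ κ₁ : ℝ, κ₁ = (1 / 8) ^ J * κ := ⟨_, rfl⟩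
  have hκ₁0 : 0 < κ₁ := by rw [hκ₁]; positivity
  rw [← hκ₁] at hε ⊢
  -- Below, `S` retains half of each set, `Z` spoils at most 1/8, and `B` misses at most ε ≤ κ₁/16
  -- of the block, so more than κ₁/4 remains.
  obtain ⟨z, hz, F₁, hF₁, hF₁c, C₁, Y, hY⟩ := h.exists_rate (τ := 1 / 8) hJ hy hny hn (by norm_num)
    (by norm_num) hκ m.2 m.1 F C hmA (fun hm => (ham _ hm).2 rfl) (fun b hb => (hB.right b hb).1)
    hB.pool (by rw [← hκ₁]; linarith)
  rw [← hκ₁] at hY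
  have hC₁A : ∀ b ∈ F₁, C₁ b ⊆ A b := fun b hb => (hY b hb).1.trans (hB.pool b (hF₁ hb)).1
  have hF₁c' : g + 1 ≤ F₁.card := Nat.le_of_mul_le_mul_left (hF.trans hF₁c) hJ
  -- All blocks but one, `b₁`, remain half covered by the left arm. The part of `b₁` missed by `S`
  -- can hold a new right-hand level, being anticomplete to the left arm.
  obtain ⟨S, hS, F₂, hF₂, hF₂c, hS1, hS2⟩ := exists_thin a.2 F₁ C₁ (F₁.card - 1) (by omega)
    (fun b hb => covers_mono (hB.left b (hF₁ hb)).1 (Finset.Subset.refl _) (hY b hb).1)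
    (fun b hb s hs => h.card_nbr_singleton_le (fun e => (ham _ (hF₁ hb)).1 e.symm) (haA hs)
      (hC₁A b hb) (hY b hb).2.1 (by linarith))
  obtain ⟨b₁, hb₁⟩ : (F₁ \ F₂).Nonempty := by
    rw [← Finset.card_pos, Finset.card_sdiff_of_subset hF₂]
    omega
  obtain ⟨hb₁, hb₁n⟩ := Finset.mem_sdiff.1 hb₁
  obtain ⟨q, r, hq0, hq, hr, hqr⟩ := exists_floor_bounds hz hy
  obtain ⟨-, -, hYS, hYc, hYcov, -⟩ := hY b₁ hb₁
  obtain ⟨Z, hZ, hZr, B, hBE, hBc, hBcov⟩ := exists_part (E := nonNbr G S (C₁ b₁)) hq0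
    (hqr _ hYc) G.Adj (fun c hc => hYcov c (nonNbr_subset _ _ hc))
  have hZz : (Z.card : ℝ) ≤ z := le_trans (by exact_mod_cast hZr) hr
  have hBC : B ⊆ C b₁ := hBE.trans ((nonNbr_subset _ _).trans (hY b₁ hb₁).1)
  have hBA : B ⊆ A b₁ := hBC.trans (hB.pool b₁ (hF₁ hb₁)).1
  -- Cutting the cover costs a factor of at most 3y, and `y ≤ x` is what leaves `B` large enough to
  -- expand.
  have hBbig : ε * (A b₁).card ≤ x * B.card := by
    have h1 : ((nonNbr G S (C₁ b₁)).card : ℝ) ≤ q * B.card := by exact_mod_cast hBc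
    have h2 : ((C₁ b₁).card : ℝ) ≤ 4 * (nonNbr G S (C₁ b₁)).card := by
      exact_mod_cast hS2 b₁ hb₁ hb₁n
    have h3 := (hY b₁ hb₁).2.1
    have h4 : (q : ℝ) * B.card ≤ 3 * x * B.card := by
      gcongr
      linarith
    have h5 := h.card_pos b₁
    nlinarith
  have hF₂₁ : ∀ b ∈ F₂, b ∈ F₁ ∧ b ≠ b₁ := fun b hb => ⟨hF₂ hb, fun e => hb₁n (e ▸ hb)⟩
  obtain ⟨C₃, hC₃⟩ : ∃ C₃ : ι → Finset V, C₃ = fun b => nonNbr G Z (nbr G S (C₁ b)) := ⟨_, rfl⟩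
  have hC₃₁ : ∀ b, C₃ b ⊆ C₁ b := fun b => by
    rw [hC₃]
    exact (nonNbr_subset _ _).trans (nbr_subset _ _)
  have hC₃c : ∀ b ∈ F₂, 3 / 8 * κ₁ * (A b).card ≤ (C₃ b).card := by
    intro b hb
    have h1 : ((C₁ b).card : ℝ) ≤ 2 * (nbr G S (C₁ b)).card := by exact_mod_cast hS1 b hb
    have h2 := card_nbr_add_card_nonNbr' (G := G) Z (nbr G S (C₁ b))
    have h3 : ((nbr G Z (nbr G S (C₁ b))).card : ℝ) ≤ (nbr G Z (C₁ b)).card := by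
      exact_mod_cast Finset.card_le_card (nbr_mono (Finset.Subset.refl _) (nbr_subset _ _))
    obtain ⟨-, h4, -, -, -, h5⟩ := hY b (hF₂ hb)
    have h6 := h5 Z (hZ.trans hYS) hZz
    rw [hC₃]
    dsimp only
    linarith
  have hlev : ∀ b ∈ F, Lev G ((b, C b) :: a :: (L ++ [s])) := hB.left
  have hlevM : ∀ b ∈ F, Lev G ((b, C b) :: m :: (M ++ [s])) := hB.right
  have hC₄ : ∀ b, nbr G B (C₃ b) ⊆ C₃ b := fun b => nbr_subset _ _
  refine ⟨(a.1, S) :: L, (b₁, B) :: (m.1, Z) :: M, F₂, fun b => nbr G B (C₃ b), ?_, by omega, ?_⟩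
  swap
  · simp only [List.length_cons]; omega
  refine ⟨by simp, by simp, hB.apex, ?_, ?_, ?_, ?_, ?_, ?_, ?_⟩
  · have e : (((a.1, S) :: L ++ s :: (b₁, B) :: (m.1, Z) :: M).map Prod.fst).Perm
        (b₁ :: (a :: L ++ s :: m :: M).map Prod.fst) := by
      simp only [List.cons_append, List.map_cons, List.map_append]
      have h1 : (a.1 :: (L.map Prod.fst ++ s.1 :: b₁ :: m.1 :: M.map Prod.fst)) =
        (a.1 :: (L.map Prod.fst ++ [s.1])) ++ b₁ :: (m.1 :: M.map Prod.fst) := by simp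
      have h2 : (a.1 :: (L.map Prod.fst ++ s.1 :: m.1 :: M.map Prod.fst)) =
        (a.1 :: (L.map Prod.fst ++ [s.1])) ++ (m.1 :: M.map Prod.fst) := by simp
      rw [h1, h2]
      exact List.perm_middle
    rw [e.nodup_iff, List.nodup_cons]
    exact ⟨hB.notMem b₁ (hF₁ hb₁), hB.nodup⟩
  · intro b hb hm
    have h1 := hB.notMem b (hF₁ (hF₂ hb))
    have h2 := (hF₂₁ b hb).2
    simp at h1 hm
    tauto
  · intro p hp
    simp only [List.cons_append, List.mem_cons, List.mem_append] at hp
    rcases hp with rfl | hp | rfl | rfl | rfl | hp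
    · exact hS.trans haA
    · exact hB.sub p (by simp [hp])
    · exact hB.sub p (by simp)
    · exact hBA
    · exact hZ.trans (hYS.trans hmA)
    · exact hB.sub p (by simp [hp])
  · intro b hb
    refine ⟨(hC₄ b).trans ((hC₃₁ b).trans (hC₁A b (hF₂ hb))), ?_⟩
    have h1 := card_nbr_ge ((hC₃₁ b).trans (hC₁A b (hF₂ hb)))
      (h.exp b b₁ (hF₂₁ b hb).2 B hBA hBbig) (hC₃c b hb)
    have h2 := h.card_pos b
    nlinarith
  · intro b hb
    refine (hlev b (hF₁ (hF₂ hb))).replace_second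
      ((hC₄ b).trans ((hC₃₁ b).trans (hY b (hF₂ hb)).1)) hS ?_
    refine covers_mono (covers_nbr S (C₁ b)) (Finset.Subset.refl _) ((hC₄ b).trans ?_)
    rw [hC₃]
    exact nonNbr_subset _ _
  · intro b hb
    refine ⟨covers_nbr _ _, ?_, ?_⟩
    · intro p hp
      rcases List.mem_cons.1 hp with rfl | hp
      · refine anticomplete_mono (anticomplete_nonNbr Z (nbr G S (C₁ b))) (Finset.Subset.refl _) ?_
        refine (hC₄ b).trans ?_
        rw [hC₃]
      · exact anticomplete_mono ((hlevM b (hF₁ (hF₂ hb))).2.1 p hp) (Finset.Subset.refl _)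
          ((hC₄ b).trans ((hC₃₁ b).trans (hY b (hF₂ hb)).1))
    · exact (hlevM b₁ (hF₁ hb₁)).replace_second hBC (hZ.trans hYS) hBcov
  · intro p hp p' hp'
    have hpB : Anticomplete G p.2 B := by
      rcases List.mem_cons.1 hp with rfl | hp
      · exact anticomplete_mono (anticomplete_nonNbr S (C₁ b₁)) (Finset.Subset.refl _) hBE
      · exact anticomplete_mono ((hlev b₁ (hF₁ hb₁)).2.1 p (by simp [hp])) (Finset.Subset.refl _)
          hBC
    obtain ⟨p₀, hp₀, hpp⟩ : ∃ p₀ ∈ a :: L, p.2 ⊆ p₀.2 := by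
      rcases List.mem_cons.1 hp with rfl | hp
      · exact ⟨a, by simp, hS⟩
      · exact ⟨p, by simp [hp], Finset.Subset.refl _⟩
    simp only [List.mem_cons] at hp'
    rcases hp' with rfl | rfl | hp'
    · exact hpB
    · exact anticomplete_mono (hB.anti p₀ hp₀ m (by simp)) hpp (hZ.trans hYS)
    · exact anticomplete_mono (hB.anti p₀ hp₀ p' (by simp [hp'])) hpp (Finset.Subset.refl _)

end

/-! ### Forward gradings, representatives without bad pairs, and colour classes. -/

section

variable {V : Type*} {ι : Type*} {G : SimpleGraph V} {A : ι → Finset V} {ε x κ : ℝ}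

/-- Peel off one block at a time by thinning with `g = 1`: the block half covered by `S'` gets the
largest index, and the others retreat to what `S'` misses. Adding `S'` to the earlier sets `Y`
covers the new last block without touching the smaller ones. Each round costs a factor of at most 4.
-/
theorem Sparse.exists_grading (h : Sparse G A ε x) (S : Finset V) (i : ι) (hS : S ⊆ A i) (k : ℕ) :
    ∀ (F : Finset ι) (C : ι → Finset V) (κ : ℝ), i ∉ F → k ≤ F.card →
      (∀ b ∈ F, Covers G S (C b)) → (∀ b ∈ F, C b ⊆ A b ∧ κ * (A b).card ≤ (C b).card) →
      0 ≤ κ → 4 ^ k * ε ≤ κ →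
      ∃ (e : ℕ → ι) (D : ℕ → Finset V), (∀ j < k, e j ∈ F) ∧
        (∀ j < k, ∀ l < k, e j = e l → j = l) ∧
        (∀ j < k, D j ⊆ C (e j) ∧ (C (e j)).card ≤ 4 ^ k * (D j).card) ∧
        ∀ j < k, ∃ Y ⊆ S, (∀ l < k, j ≤ l → Covers G Y (D l)) ∧
          ∀ l < j, Anticomplete G Y (D l) := by
  classical
  induction k with
  | zero =>
    intro F C κ _ _ _ _ _ _
    exact ⟨fun _ => i, fun _ => ∅, by simp, by simp, by simp, by simp⟩
  | succ k ih =>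
    intro F C κ hi hk hcov hC hκ hε
    have hp : (1 : ℝ) ≤ 4 ^ k := one_le_pow₀ (by norm_num)
    have hp0 : (0 : ℝ) < 4 ^ k := by linarith
    have hε4 : 4 * ε ≤ κ := by
      rcases le_total ε 0 with h0 | h0
      · linarith
      · rw [pow_succ] at hε
        nlinarith
    obtain ⟨S', hS', F₁, hF₁, hc, h1, h2⟩ := BiGrade.exists_thin S F C 1 (by omega) hcov
      fun b hb s hs => h.card_nbr_singleton_le (fun e : i = b => hi (e ▸ hb)) (hS hs) (hC b hb).1
        (hC b hb).2 hε4
    obtain ⟨b, rfl⟩ := Finset.card_eq_one.1 hc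
    have hb : b ∈ F := hF₁ (by simp)
    have hmem : ∀ l ∈ F.erase b, l ∈ F ∧ l ≠ b := fun l hl =>
      ⟨Finset.mem_of_mem_erase hl, Finset.ne_of_mem_erase hl⟩
    obtain ⟨e, D, he, hinj, hD, hY⟩ := ih (F.erase b) (fun l => nonNbr G S' (C l)) (κ / 4)
      (fun hm => hi (hmem _ hm).1) (by rw [Finset.card_erase_of_mem hb]; omega)
      (fun l hl => covers_mono (hcov l (hmem l hl).1) (Finset.Subset.refl _) (nonNbr_subset _ _))
      (fun l hl => ⟨(nonNbr_subset _ _).trans (hC l (hmem l hl).1).1, by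
        have h3 : ((C l).card : ℝ) ≤ 4 * (nonNbr G S' (C l)).card := by
          exact_mod_cast h2 l (hmem l hl).1 (by simpa using (hmem l hl).2)
        have h4 := (hC l (hmem l hl).1).2
        linarith⟩) (by positivity)
      (by rw [pow_succ] at hε; linarith)
    refine ⟨fun j => if j = k then b else e j, fun j => if j = k then nbr G S' (C b) else D j,
      ?_, ?_, ?_, ?_⟩
    · intro j hj
      by_cases hjk : j = k
      · simpa [hjk] using hb
      · simpa [hjk] using (hmem _ (he j (by omega))).1
    · intro j hj l hl hjl
      by_cases hjk : j = k <;> by_cases hlk : l = k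
      · omega
      · simp only [hjk, hlk, if_true, if_false] at hjl
        exact absurd hjl.symm (hmem _ (he l (by omega))).2
      · simp only [hjk, hlk, if_true, if_false] at hjl
        exact absurd hjl (hmem _ (he j (by omega))).2
      · simp only [hjk, hlk, if_false] at hjl
        exact hinj j (by omega) l (by omega) hjl
    · intro j hj
      by_cases hjk : j = k
      · simp only [hjk, if_true]
        refine ⟨nbr_subset _ _, (h1 b (by simp)).trans (Nat.mul_le_mul_right _ ?_)⟩
        have : 1 ≤ 4 ^ k := Nat.one_le_pow _ _ (by norm_num)
        rw [pow_succ]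
        omega
      · simp only [hjk, if_false]
        obtain ⟨h3, h4⟩ := hD j (by omega)
        obtain ⟨h5, h6⟩ := hmem _ (he j (by omega))
        refine ⟨h3.trans (nonNbr_subset _ _), (h2 (e j) h5 (by simpa using h6)).trans ?_⟩
        rw [pow_succ', mul_assoc]
        exact Nat.mul_le_mul_left _ h4
    · intro j hj
      have hanti : ∀ l < k, Anticomplete G S' (D l) := fun l hl =>
        anticomplete_mono (anticomplete_nonNbr S' (C (e l))) (Finset.Subset.refl _) (hD l hl).1
      by_cases hjk : j = k
      · refine ⟨S', hS', ?_, ?_⟩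
        · intro l hl hjl
          have : l = k := by omega
          simp only [this, if_true]
          exact covers_nbr _ _
        · intro l hl
          have : l ≠ k := by omega
          simp only [this, if_false]
          exact hanti l (by omega)
      · obtain ⟨Y, hYS, hY1, hY2⟩ := hY j (by omega)
        refine ⟨Y ∪ S', Finset.union_subset hYS hS', ?_, ?_⟩
        · intro l hl hjl
          by_cases hlk : l = k
          · simp only [hlk, if_true]
            exact covers_mono (covers_nbr S' (C b)) Finset.subset_union_right
              (Finset.Subset.refl _)
          · simp only [hlk, if_false]
            exact covers_mono (hY1 l (by omega) hjl) Finset.subset_union_left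
              (Finset.Subset.refl _)
        · intro l hl
          have : l ≠ k := by omega
          simp only [this, if_false]
          intro z hz
          rcases Finset.mem_union.1 hz with hz | hz
          · exact hY2 l hl z hz
          · exact hanti l (by omega) z hz

/-- The probability that a uniform tuple takes two given values, in multiplied form, for the union
bound in `exists_tuple`. -/
theorem card_piFinset_fibre {I : Type*} [Fintype I] [DecidableEq I] (C : I → Finset V) {i j : I}
    (hij : i ≠ j) (a b : V) :
    (Fintype.piFinset (Function.update (Function.update C i {a}) j {b})).card *
      ((C i).card * (C j).card) = (Fintype.piFinset C).card := by
  classical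
  rw [Fintype.card_piFinset, Fintype.card_piFinset]
  have e : ∀ l, (Function.update (Function.update C i {a}) j {b} l).card =
      Function.update (Function.update (fun l => (C l).card) i 1) j 1 l := by
    intro l
    by_cases hlj : l = j
    · subst hlj; simp
    · by_cases hli : l = i
      · subst hli; simp [hij]
      · simp [hlj, hli]
  simp_rw [e]
  rw [Finset.prod_update_of_mem (Finset.mem_univ j),
    Finset.prod_update_of_mem (show i ∈ Finset.univ \ {j} by simp [hij])]
  have h1 := Finset.mul_prod_erase Finset.univ (fun l => (C l).card) (Finset.mem_univ j)
  have h2 := Finset.mul_prod_erase (Finset.univ.erase j) (fun l => (C l).card)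
    (show i ∈ Finset.univ.erase j by simp [hij])
  rw [← h1, ← h2, Finset.sdiff_singleton_eq_erase, Finset.sdiff_singleton_eq_erase]
  ring

/-- If few pairs are bad, then there is a choice of representatives without bad pairs. -/
theorem exists_tuple {I : Type*} [Fintype I] (C : I → Finset V) (hC : ∀ i, (C i).Nonempty)
    (Bad : I → I → V → V → Prop) (θ : ℝ) (hθ : θ * (Fintype.card I : ℝ) ^ 2 < 1) (hθ0 : 0 ≤ θ)
    (hBad : ∀ i j, i ≠ j → ∀ T ⊆ C i ×ˢ C j, (∀ p ∈ T, Bad i j p.1 p.2) →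
      (T.card : ℝ) ≤ θ * ((C i).card * (C j).card)) :
    ∃ f : I → V, (∀ i, f i ∈ C i) ∧ ∀ i j, i ≠ j → ¬ Bad i j (f i) (f j) := by
  classical
  by_contra! hcon
  set T := Fintype.piFinset C with hT
  have hT0 : 0 < T.card := by
    rw [hT, Fintype.card_piFinset]
    exact Finset.prod_pos fun i _ => (hC i).card_pos
  set B : I × I → Finset (V × V) := fun ij =>
    (C ij.1 ×ˢ C ij.2).filter fun p => Bad ij.1 ij.2 p.1 p.2 with hB
  have hsub : T ⊆ (Finset.univ : Finset I).offDiag.biUnion fun ij => (B ij).biUnion fun p =>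
      Fintype.piFinset (Function.update (Function.update C ij.1 {p.1}) ij.2 {p.2}) := by
    intro f hf
    have hf' := Fintype.mem_piFinset.1 hf
    obtain ⟨i, j, hij, hbad⟩ := hcon f hf'
    refine Finset.mem_biUnion.2 ⟨(i, j), by simp [hij], Finset.mem_biUnion.2 ⟨(f i, f j), ?_, ?_⟩⟩
    · exact Finset.mem_filter.2 ⟨Finset.mem_product.2 ⟨hf' i, hf' j⟩, hbad⟩
    · rw [Fintype.mem_piFinset]
      intro l
      by_cases hlj : l = j
      · subst hlj; simp
      · by_cases hli : l = i
        · subst hli; simp [hlj]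
        · simpa [hlj, hli] using hf' l
  have h1 : ∀ ij ∈ (Finset.univ : Finset I).offDiag, (((B ij).biUnion fun p => Fintype.piFinset
      (Function.update (Function.update C ij.1 {p.1}) ij.2 {p.2})).card : ℝ) ≤ θ * T.card := by
    rintro ⟨i, j⟩ hij
    have hij' : i ≠ j := by simpa using hij
    have h2 := hBad i j hij' (B (i, j)) (Finset.filter_subset _ _)
      fun p hp => (Finset.mem_filter.1 hp).2
    have hci : (0 : ℝ) < (C i).card := by exact_mod_cast (hC i).card_pos
    have hcj : (0 : ℝ) < (C j).card := by exact_mod_cast (hC j).card_pos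
    have h3 : ∀ p : V × V, ((Fintype.piFinset
        (Function.update (Function.update C i {p.1}) j {p.2})).card : ℝ) =
        T.card / ((C i).card * (C j).card) := by
      intro p
      rw [eq_div_iff (by positivity)]
      exact_mod_cast card_piFinset_fibre C hij' p.1 p.2
    calc (((B (i, j)).biUnion fun p => Fintype.piFinset
          (Function.update (Function.update C i {p.1}) j {p.2})).card : ℝ)
        ≤ ∑ p ∈ B (i, j), ((Fintype.piFinset
          (Function.update (Function.update C i {p.1}) j {p.2})).card : ℝ) := by
          exact_mod_cast Finset.card_biUnion_le
      _ = (B (i, j)).card * (T.card / ((C i).card * (C j).card)) := by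
          simp_rw [h3]
          rw [Finset.sum_const, nsmul_eq_mul]
      _ ≤ θ * ((C i).card * (C j).card) * (T.card / ((C i).card * (C j).card)) := by gcongr
      _ = θ * T.card := by field_simp
  have h2 : (T.card : ℝ) ≤ (Fintype.card I : ℝ) ^ 2 * (θ * T.card) := by
    calc (T.card : ℝ) ≤ ∑ ij ∈ (Finset.univ : Finset I).offDiag,
          (((B ij).biUnion fun p => Fintype.piFinset
            (Function.update (Function.update C ij.1 {p.1}) ij.2 {p.2})).card : ℝ) := by
          exact_mod_cast (Finset.card_le_card hsub).trans Finset.card_biUnion_le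
      _ ≤ ∑ ij ∈ (Finset.univ : Finset I).offDiag, θ * (T.card : ℝ) := Finset.sum_le_sum h1
      _ = ((Finset.univ : Finset I).offDiag.card : ℝ) * (θ * T.card) := by
          rw [Finset.sum_const, nsmul_eq_mul]
      _ ≤ (Fintype.card I : ℝ) ^ 2 * (θ * T.card) := by
          gcongr
          rw [Finset.offDiag_card, Finset.card_univ, sq]
          exact_mod_cast Nat.sub_le _ _
  have hT0' : (0 : ℝ) < T.card := by exact_mod_cast hT0
  nlinarith

/-- The members of `D` of colour `a`. -/
def colourClass (φ : V → ℕ) (D : Finset V) (a : ℕ) : Finset V := D.filter fun c => φ c = a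

theorem mem_colourClass {φ : V → ℕ} {D : Finset V} {a : ℕ} {c : V} :
    c ∈ colourClass φ D a ↔ c ∈ D ∧ φ c = a := by simp [colourClass]

theorem sum_card_colourClass_le (φ : V → ℕ) (D : Finset V) (s : Finset ℕ) :
    ∑ a ∈ s, (colourClass φ D a).card ≤ D.card := by
  unfold colourClass
  rw [Finset.sum_card_fiberwise_eq_card_filter]
  exact Finset.card_filter_le _ _

theorem card_le_sum_colourClass (φ : V → ℕ) {D : Finset V} {s : Finset ℕ}
    (h : ∀ c ∈ D, φ c ∈ s) : D.card ≤ ∑ a ∈ s, (colourClass φ D a).card := by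
  unfold colourClass
  rw [Finset.sum_card_fiberwise_eq_card_filter, Finset.filter_true_of_mem h]

/-- Few vertices lie in colour classes where `B` is dense. -/
theorem card_dense_le (φ : V → ℕ) {D B T : Finset V} {η : ℝ} (hη : 0 ≤ η) (hT : T ⊆ D)
    (h : ∀ c ∈ T, η * (colourClass φ D (φ c)).card ≤ (colourClass φ B (φ c)).card) :
    η * T.card ≤ B.card := by
  classical
  have h1 := card_le_sum_colourClass φ (D := T) (s := T.image φ)
    fun c hc => Finset.mem_image_of_mem φ hc
  have h2 := sum_card_colourClass_le φ B (T.image φ)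
  have h1' : (T.card : ℝ) ≤ ∑ a ∈ T.image φ, ((colourClass φ T a).card : ℝ) := by
    exact_mod_cast h1
  calc η * T.card ≤ η * ∑ a ∈ T.image φ, ((colourClass φ T a).card : ℝ) := by gcongr
    _ = ∑ a ∈ T.image φ, η * ((colourClass φ T a).card : ℝ) := by rw [Finset.mul_sum]
    _ ≤ ∑ a ∈ T.image φ, ((colourClass φ B a).card : ℝ) := by
      refine Finset.sum_le_sum fun a ha => ?_
      obtain ⟨c, hc, rfl⟩ := Finset.mem_image.1 ha
      refine le_trans ?_ (h c hc)
      have : (colourClass φ T (φ c)).card ≤ (colourClass φ D (φ c)).card :=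
        Finset.card_le_card (Finset.filter_subset_filter _ hT)
      gcongr
    _ ≤ B.card := by exact_mod_cast h2

/-- There are `q` colours, each contributing at most 1/(2q) of `D`. -/
theorem two_mul_card_le_of_small_classes (φ : V → ℕ) {D T : Finset V} {q : ℕ} (hT : T ⊆ D)
    (hφ : ∀ c ∈ D, φ c < q) (hq : 0 < q)
    (h : ∀ c ∈ T, 2 * q * (colourClass φ D (φ c)).card ≤ D.card) : 2 * T.card ≤ D.card := by
  classical
  have h1 := card_le_sum_colourClass φ (D := T) (s := Finset.range q)
    fun c hc => Finset.mem_range.2 (hφ c (hT hc))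
  have h2 : ∀ a ∈ Finset.range q, 2 * q * (colourClass φ T a).card ≤ D.card := by
    intro a _
    rcases (colourClass φ T a).eq_empty_or_nonempty with he | ⟨c, hc⟩
    · simp [he]
    · obtain ⟨hcT, rfl⟩ := mem_colourClass.1 hc
      refine le_trans (Nat.mul_le_mul_left _ ?_) (h c hcT)
      exact Finset.card_le_card (Finset.filter_subset_filter _ hT)
  have h3 := Finset.sum_le_sum h2
  rw [← Finset.mul_sum, Finset.sum_const, Finset.card_range, smul_eq_mul] at h3
  have h4 : q * (2 * T.card) ≤ q * D.card := by
    calc q * (2 * T.card) = 2 * q * T.card := by ring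
      _ ≤ _ := (Nat.mul_le_mul_left _ h1).trans h3
  exact Nat.le_of_mul_le_mul_left h4 hq

end

/-! ### Choosing one piece of a cover for every block simultaneously. -/

section

variable {V : Type*} {ι : Type*} {G : SimpleGraph V} {A : ι → Finset V} {ε x κ : ℝ}

/-- Double counting of the pairs with `v ∈ B c`. -/
theorem sum_card_dense_le {D D' : Finset V} (R : V → V → Prop) {b : ℝ}
    (h : ∀ v ∈ D, ∀ T ⊆ D', (∀ c ∈ T, R v c) → (T.card : ℝ) ≤ b)
    (B : V → Finset V) (hB : ∀ c ∈ D', B c ⊆ D ∧ ∀ v ∈ B c, R v c) :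
    ∑ c ∈ D', ((B c).card : ℝ) ≤ D.card * b := by
  classical
  have h1 := Finset.sum_card_bipartiteAbove_eq_sum_card_bipartiteBelow (s := D) (t := D')
    (fun v c => v ∈ B c)
  have h2 : ∀ c ∈ D', (Finset.bipartiteBelow (fun v c => v ∈ B c) D c) = B c := by
    intro c hc
    ext v
    simp only [Finset.bipartiteBelow, Finset.mem_filter]
    exact ⟨fun h => h.2, fun h => ⟨(hB c hc).1 h, h⟩⟩
  have h3 : ∑ c ∈ D', ((B c).card : ℝ) =
      ∑ v ∈ D, ((Finset.bipartiteAbove (fun v c => v ∈ B c) D' v).card : ℝ) := by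
    have h4 : ∑ c ∈ D', (B c).card =
        ∑ v ∈ D, (Finset.bipartiteAbove (fun v c => v ∈ B c) D' v).card := by
      rw [h1]
      exact Finset.sum_congr rfl fun c hc => by rw [h2 c hc]
    exact_mod_cast h4
  rw [h3]
  refine le_trans (Finset.sum_le_sum (g := fun _ => b) fun v hv => ?_) ?_
  · refine h v hv _ (Finset.filter_subset _ _) fun c hc => ?_
    simp only [Finset.bipartiteAbove, Finset.mem_filter] at hc
    exact (hB c hc.1).2 v hc.2
  · rw [Finset.sum_const, nsmul_eq_mul]

/-- Given coverings of `k` sets by parts, choose a part for each so that it covers much of its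
set but nothing chosen from the other sets, and so that the chosen sets have small linkage. -/
theorem exists_select {k : ℕ} (hk : 1 ≤ k) (D : Fin k → Finset V) (hD : ∀ i, (D i).Nonempty)
    (φ : Fin k → V → ℕ) {q : ℕ} (hq : 0 < q) (hφ : ∀ i, ∀ c ∈ D i, φ i c < q)
    (Z : Fin k → ℕ → Finset V) (hcov : ∀ i, ∀ c ∈ D i, ∃ z ∈ Z i (φ i c), G.Adj z c)
    {μ η : ℝ} (hη : 0 < η) (hη1 : η ≤ 1) (hμ0 : 0 ≤ μ) (hμ : 16 * (k : ℝ) ^ 3 * μ < η)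
    (hlink : ∀ i j, i ≠ j → ∀ v ∈ D i, ((nbr G {v} (D j)).card : ℝ) ≤ μ * (D j).card)
    (hZ : ∀ i j, i ≠ j → ∀ a, ((nbr G (Z i a) (D j)).card : ℝ) ≤ μ * (D j).card) :
    ∃ (a : Fin k → ℕ) (B : Fin k → Finset V), (∀ i, a i < q ∧ B i ⊆ D i ∧
      (D i).card ≤ 4 * q * (B i).card ∧ Covers G (Z i (a i)) (B i)) ∧
      ∀ i j, i ≠ j → Anticomplete G (Z i (a i)) (B j) ∧
        ∀ v ∈ B i, ((nbr G {v} (B j)).card : ℝ) ≤ 2 * η * (B j).card := by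
  classical
  have hk0 : (0 : ℝ) < k := by exact_mod_cast hk
  set R : Fin k → V → V → Prop := fun j v c =>
    η * (colourClass (φ j) (D j) (φ j c)).card ≤
      (nbr G {v} (colourClass (φ j) (D j) (φ j c))).card with hR
  set X₁ : Fin k → Fin k → V → Finset V := fun i j c => (D i).filter fun v => R j v c with hX₁
  -- What must be deleted from `D i` once the colour class of `c` is chosen in `D j`: vertices dense
  -- to that class would spoil the linkage, and vertices seen by its piece would spoil the
  -- anticompleteness.
  set X : Fin k → Fin k → V → Finset V := fun i j c =>
    X₁ i j c ∪ nbr G (Z j (φ j c)) (D i) with hX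
  -- Representatives come only from classes of proportion at least 1/(2q), so that the chosen
  -- classes are large; these vertices make up at least half of `D i`.
  set E : Fin k → Finset V := fun i =>
    (D i).filter fun c => (D i).card ≤ 2 * q * (colourClass (φ i) (D i) (φ i c)).card with hE
  have hE2 : ∀ i, (D i).card ≤ 2 * (E i).card := by
    intro i
    have h1 := two_mul_card_le_of_small_classes (φ i) (D := D i) (T := (D i).filter fun c =>
      ¬ (D i).card ≤ 2 * q * (colourClass (φ i) (D i) (φ i c)).card) (Finset.filter_subset _ _)
      (hφ i) hq fun c hc => (not_le.1 (Finset.mem_filter.1 hc).2).le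
    have h2 : (E i).card + _ = (D i).card := Finset.card_filter_add_card_filter_not
      (s := D i) (fun c => (D i).card ≤ 2 * q * (colourClass (φ i) (D i) (φ i c)).card)
    omega
  have hX₁sum : ∀ i j, i ≠ j →
      ∑ c ∈ D j, ((X₁ i j c).card : ℝ) ≤ (D i).card * (μ * (D j).card / η) := by
    intro i j hij
    refine sum_card_dense_le (R j) ?_ _
      fun c _ => ⟨Finset.filter_subset _ _, fun v hv => (Finset.mem_filter.1 hv).2⟩
    intro v hv T hT hRT
    rw [le_div_iff₀ hη, mul_comm]
    refine le_trans (card_dense_le (φ j) (B := nbr G {v} (D j)) hη.le hT fun c hc => ?_)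
      (hlink i j hij v hv)
    refine le_trans (hRT c hc) ?_
    have : nbr G {v} (colourClass (φ j) (D j) (φ j c)) ⊆
        colourClass (φ j) (nbr G {v} (D j)) (φ j c) := by
      intro z hz
      obtain ⟨h1, h2⟩ := mem_nbr.1 hz
      obtain ⟨h3, h4⟩ := mem_colourClass.1 h1
      exact mem_colourClass.2 ⟨mem_nbr.2 ⟨h3, h2⟩, h4⟩
    exact_mod_cast Finset.card_le_card this
  have hXsum : ∀ i j, i ≠ j →
      ∑ c ∈ D j, ((X i j c).card : ℝ) ≤ 2 * (μ / η) * ((D i).card * (D j).card) := by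
    intro i j hij
    calc ∑ c ∈ D j, ((X i j c).card : ℝ)
        ≤ ∑ c ∈ D j, (((X₁ i j c).card : ℝ) + μ * (D i).card) := by
          refine Finset.sum_le_sum fun c _ => ?_
          have h1 : ((X i j c).card : ℝ) ≤ (X₁ i j c).card + (nbr G (Z j (φ j c)) (D i)).card := by
            exact_mod_cast Finset.card_union_le _ _
          have h2 := hZ j i hij.symm (φ j c)
          linarith
      _ = (∑ c ∈ D j, ((X₁ i j c).card : ℝ)) + (D j).card * (μ * (D i).card) := by
          rw [Finset.sum_add_distrib, Finset.sum_const, nsmul_eq_mul]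
      _ ≤ (D i).card * (μ * (D j).card / η) + (D j).card * (μ / η * (D i).card) := by
          gcongr
          · exact hX₁sum i j hij
          · exact le_div_self hμ0 hη hη1
      _ = _ := by ring
  -- A pair is bad if deletion takes 1/(2k) of the class of the first representative; without bad
  -- pairs at most half of each class is deleted. On average a proportion 2μ/η of `D i` is deleted,
  -- `card_dense_le` loses 2k, and passing from `D` to `E` loses 4: this is `16 * k * (μ / η)`.
  obtain ⟨f, hf, hgood⟩ := exists_tuple E (fun i => by
      rw [← Finset.card_pos]
      have := (hD i).card_pos
      have := hE2 i
      omega)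
    (fun i j c c' => (1 / (2 * k : ℝ)) * (colourClass (φ i) (D i) (φ i c)).card ≤
      (colourClass (φ i) (X i j c') (φ i c)).card) (16 * k * (μ / η)) (by
      rw [Fintype.card_fin]
      have : 16 * k * (μ / η) * (k : ℝ) ^ 2 = 16 * (k : ℝ) ^ 3 * μ / η := by ring
      rw [this, div_lt_one hη]
      exact hμ) (by positivity) (by
      intro i j hij T hT hbad
      have h1 : T.card = ∑ c ∈ D j, (T.filter fun p => p.2 = c).card :=
        Finset.card_eq_sum_card_fiberwise fun p hp =>
          (Finset.mem_filter.1 (Finset.mem_product.1 (hT hp)).2).1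
      have h2 : ∀ c ∈ D j, ((T.filter fun p => p.2 = c).card : ℝ) ≤ 2 * k * (X i j c).card := by
        intro c _
        have h3 : (T.filter fun p => p.2 = c).card =
            ((T.filter fun p => p.2 = c).image Prod.fst).card := by
          refine (Finset.card_image_of_injOn ?_).symm
          intro p hp p' hp' hpp
          have e1 := (Finset.mem_filter.1 hp).2
          have e2 := (Finset.mem_filter.1 hp').2
          exact Prod.ext hpp (e1.trans e2.symm)
        have h4 := card_dense_le (φ i) (D := D i) (B := X i j c)
          (T := (T.filter fun p => p.2 = c).image Prod.fst) (η := 1 / (2 * k : ℝ))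
          (by positivity) (by
            intro z hz
            obtain ⟨p, hp, rfl⟩ := Finset.mem_image.1 hz
            exact (Finset.mem_filter.1
              (Finset.mem_product.1 (hT (Finset.mem_filter.1 hp).1)).1).1) (by
            intro z hz
            obtain ⟨p, hp, rfl⟩ := Finset.mem_image.1 hz
            obtain ⟨hpT, rfl⟩ := Finset.mem_filter.1 hp
            exact hbad p hpT)
        rw [← h3, one_div, inv_mul_le_iff₀ (by positivity)] at h4
        exact h4
      have h5 : (T.card : ℝ) ≤ 2 * k * (2 * (μ / η) * ((D i).card * (D j).card)) := by
        calc (T.card : ℝ) = ∑ c ∈ D j, ((T.filter fun p => p.2 = c).card : ℝ) := by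
              exact_mod_cast h1
          _ ≤ ∑ c ∈ D j, 2 * k * ((X i j c).card : ℝ) := Finset.sum_le_sum h2
          _ = 2 * k * ∑ c ∈ D j, ((X i j c).card : ℝ) := by rw [Finset.mul_sum]
          _ ≤ _ := by
            gcongr
            exact hXsum i j hij
      have hEi : ((D i).card : ℝ) ≤ 2 * (E i).card := by exact_mod_cast hE2 i
      have hEj : ((D j).card : ℝ) ≤ 2 * (E j).card := by exact_mod_cast hE2 j
      calc (T.card : ℝ) ≤ 2 * k * (2 * (μ / η) * ((D i).card * (D j).card)) := h5
        _ ≤ 2 * k * (2 * (μ / η) * ((2 * (E i).card) * (2 * (E j).card))) := by gcongr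
        _ = 16 * k * (μ / η) * ((E i).card * (E j).card) := by ring)
  obtain ⟨K, hK⟩ : ∃ K : Fin k → Finset V, K = fun i => colourClass (φ i) (D i) (φ i (f i)) :=
    ⟨_, rfl⟩
  set B : Fin k → Finset V := fun i =>
    K i \ (Finset.univ.erase i).biUnion fun j => colourClass (φ i) (X i j (f j)) (φ i (f i)) with hB
  have hBK : ∀ i, B i ⊆ K i := fun i => Finset.sdiff_subset
  have hKD : ∀ i, K i ⊆ D i := fun i => by
    rw [hK]
    exact Finset.filter_subset _ _
  have hBcard : ∀ i, ((K i).card : ℝ) ≤ 2 * (B i).card := by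
    intro i
    have h1 : ((K i).card : ℝ) ≤ (B i).card + ∑ j ∈ Finset.univ.erase i,
        ((colourClass (φ i) (X i j (f j)) (φ i (f i))).card : ℝ) := by
      have h2 : (K i).card ≤ (B i).card + ∑ j ∈ Finset.univ.erase i,
          (colourClass (φ i) (X i j (f j)) (φ i (f i))).card := by
        have h3 := Finset.card_le_card_sdiff_add_card (t := (Finset.univ.erase i).biUnion fun j =>
          colourClass (φ i) (X i j (f j)) (φ i (f i))) (s := K i)
        exact h3.trans (Nat.add_le_add_left Finset.card_biUnion_le _)
      exact_mod_cast h2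
    have h4 : ∑ j ∈ Finset.univ.erase i,
        ((colourClass (φ i) (X i j (f j)) (φ i (f i))).card : ℝ) ≤ (K i).card / 2 := by
      calc _ ≤ ∑ j ∈ Finset.univ.erase i, (1 / (2 * k : ℝ)) * ((K i).card : ℝ) := by
            refine Finset.sum_le_sum fun j hj => ?_
            rw [hK]
            exact (not_le.1 (hgood i j (Finset.ne_of_mem_erase hj).symm)).le
        _ = ((Finset.univ.erase i).card : ℝ) * ((1 / (2 * k : ℝ)) * ((K i).card : ℝ)) := by
            rw [Finset.sum_const, nsmul_eq_mul]
        _ ≤ k * ((1 / (2 * k : ℝ)) * ((K i).card : ℝ)) := by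
            gcongr
            refine (Finset.card_le_card (Finset.erase_subset _ _)).trans ?_
            rw [Finset.card_univ, Fintype.card_fin]
        _ = (K i).card / 2 := by field_simp
    linarith
  have hBnot : ∀ i j, i ≠ j → ∀ v ∈ B i, v ∉ X i j (f j) := by
    intro i j hij v hv hvX
    obtain ⟨h1, h2⟩ := Finset.mem_sdiff.1 hv
    refine h2 (Finset.mem_biUnion.2 ⟨j, by simp [hij.symm], mem_colourClass.2 ⟨hvX, ?_⟩⟩)
    rw [hK] at h1
    exact (mem_colourClass.1 h1).2
  refine ⟨fun i => φ i (f i), B, fun i => ⟨?_, (hBK i).trans (hKD i), ?_, ?_⟩,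
    fun i j hij => ⟨?_, ?_⟩⟩
  · exact hφ i _ (Finset.mem_filter.1 (hf i)).1
  · have h1 := (Finset.mem_filter.1 (hf i)).2
    have h2 : (K i).card ≤ 2 * (B i).card := by exact_mod_cast hBcard i
    have h3 : (D i).card ≤ 2 * q * (K i).card := by rw [hK]; exact h1
    calc (D i).card ≤ 2 * q * (K i).card := h3
      _ ≤ 2 * q * (2 * (B i).card) := Nat.mul_le_mul_left _ h2
      _ = _ := by ring
  · intro c hc
    have h1 := hBK i hc
    rw [hK] at h1
    obtain ⟨h2, h3⟩ := mem_colourClass.1 h1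
    obtain ⟨z, hz, hzc⟩ := hcov i c h2
    rw [h3] at hz
    exact ⟨z, hz, hzc⟩
  · intro z hz v hv hzv
    exact hBnot j i hij.symm v hv (Finset.mem_union_right _
      (mem_nbr.2 ⟨hKD j (hBK j hv), z, hz, hzv⟩))
  · intro v hv
    have h1 : ¬ R j v (f j) := fun h =>
      hBnot i j hij v hv (Finset.mem_union_left _
        (Finset.mem_filter.2 ⟨hKD i (hBK i hv), h⟩))
    have h2 : ((nbr G {v} (K j)).card : ℝ) < η * (K j).card := by
      rw [hK]
      exact not_le.1 h1
    have h3 : ((nbr G {v} (B j)).card : ℝ) ≤ (nbr G {v} (K j)).card := by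
      exact_mod_cast Finset.card_le_card (nbr_mono (Finset.Subset.refl _) (hBK j))
    have h4 := hBcard j
    nlinarith

end

/-! ### Exact height, small linkage and the backward grading. -/

section

variable {V : Type*} {ι : Type*} {G : SimpleGraph V} {A : ι → Finset V} {ε x κ : ℝ}

theorem BiLev.mono {L M : List (ι × Finset V)} {s : ι × Finset V} {F : Finset ι}
    {C : ι → Finset V} {κ' : ℝ} (hB : BiLev G A κ L s M F C) (h : κ' ≤ κ) :
    BiLev G A κ' L s M F C :=
  { hB with
    pool := fun b hb => ⟨(hB.pool b hb).1, le_trans (by gcongr) (hB.pool b hb).2⟩ }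

/-- Iterates `BiLev.extend`. The missing height is known only to be at most `j`, so the constants
must serve every possible number of rounds; hence the extrema. -/
theorem BiLev.exists_of_height {J : ℕ} (hJ : 0 < J) (ℓ g j : ℕ) : ∀ κ : ℝ, 0 < κ →
    ∃ (N : ℕ) (κ' ε₀ : ℝ), 0 < κ' ∧ 0 < ε₀ ∧
    ∀ (V : Type u) (ι : Type v) (G : SimpleGraph V) (A : ι → Finset V) (ε x y n : ℝ),
      Sparse G A ε x → 0 < ε → ε ≤ ε₀ → 1 ≤ y → y ≤ x → n ≤ y ^ J →
      (∀ X : Finset V, (X.card : ℝ) ≤ n) →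
      ∀ (L : List (ι × Finset V)) (s : ι × Finset V) (M : List (ι × Finset V)) (F : Finset ι)
        (C : ι → Finset V), BiLev G A κ L s M F C → N ≤ F.card → L.length + M.length ≤ ℓ →
        ℓ ≤ L.length + M.length + j →
        ∃ L' s' M' F' C', BiLev G A κ' L' s' M' F' C' ∧ g ≤ F'.card ∧
          L'.length + M'.length = ℓ := by
  induction j with
  | zero =>
    intro κ hκ
    refine ⟨g, κ, 1, hκ, one_pos, ?_⟩
    intro V ι G A ε x y n h hε hε₀ hy hyx hny hn L s M F C hB hF h1 h2
    exact ⟨L, s, M, F, C, hB, hF, by omega⟩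
  | succ j ih =>
    intro κ hκ
    obtain ⟨N, κ', ε₀, hκ', hε₀, H⟩ := ih ((1 / 8) ^ J * κ / 4) (by positivity)
    refine ⟨max g (J * (N + 1)), min κ κ', min ε₀ ((1 / 8) ^ J * κ / 16), lt_min hκ hκ',
      lt_min hε₀ (by positivity), ?_⟩
    intro V ι G A ε x y n h hε hεle hy hyx hny hn L s M F C hB hF h1 h2
    by_cases hℓ : L.length + M.length = ℓ
    · exact ⟨L, s, M, F, C, hB.mono (min_le_left _ _), (le_max_left _ _).trans hF, hℓ⟩
    · have hε' := hεle.trans (min_le_right _ _)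
      obtain ⟨L', M', F', C', hB', hF', hlen⟩ := hB.extend h hJ hy hyx hny hn hκ (by linarith) hε
        ((le_max_right _ _).trans hF)
      obtain ⟨L'', s'', M'', F'', C'', hB'', hF'', hlen'⟩ := H V ι G A ε x y n h hε
        (hεle.trans (min_le_left _ _)) hy hyx hny hn L' s M' F' C' hB' hF' (by omega) (by omega)
      exact ⟨L'', s'', M'', F'', C'', hB''.mono (min_le_right _ _), hF'', hlen'⟩

/-- A bi-levelling with many sets can be refined to a bi-grading of small linkage. -/
theorem BiLev.exists_graded {a m : ι × Finset V} {L M : List (ι × Finset V)} {s : ι × Finset V}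
    {F : Finset ι} {C : ι → Finset V} (hB : BiLev G A κ (a :: L) s (m :: M) F C)
    (h : Sparse G A ε x) {n y τ lam : ℝ} {J k : ℕ} (hJ : 0 < J) (hk : 1 ≤ k) (hy : 1 ≤ y)
    (hny : n ≤ y ^ J) (hn : ∀ X : Finset V, (X.card : ℝ) ≤ n) (hκ : 0 < κ) (hlam : 0 < lam)
    (hlam1 : lam ≤ 1) (hτ : τ = lam / (64 * k ^ 3 * 4 ^ k)) (hε0 : 0 < ε)
    (hε : 4 ^ k * ε < τ ^ J * κ) (hε' : ε ≤ τ * (τ ^ J * κ)) (hF : J * k ≤ F.card) :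
    ∃ (e : Fin k → ι) (B : Fin k → Finset V), Function.Injective e ∧
      (∀ i, e i ∈ F ∧ B i ⊆ C (e i) ∧
        τ ^ J * κ / (12 * 4 ^ k) * (A (e i)).card ≤ y * (B i).card) ∧
      (∀ i j, i ≠ j → ∀ v ∈ B i, ((nbr G {v} (B j)).card : ℝ) ≤ lam * (B j).card) ∧
      (∀ j, ∃ Y ⊆ a.2, (∀ i, j ≤ i → Covers G Y (B i)) ∧ ∀ i, i < j → Anticomplete G Y (B i)) ∧
      ∀ j, ∃ Y ⊆ m.2, (∀ i, i ≤ j → Covers G Y (B i)) ∧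
        ∀ i, j < i → Anticomplete G Y (B i) := by
  classical
  have hk0 : (1 : ℝ) ≤ k := by exact_mod_cast hk
  have h4k : (1 : ℝ) ≤ 4 ^ k := one_le_pow₀ (by norm_num)
  have hτ0 : 0 < τ := by rw [hτ]; positivity
  have hτ1 : τ ≤ 1 := by
    rw [hτ, div_le_one (by positivity)]
    have : (1 : ℝ) ≤ (k : ℝ) ^ 3 := one_le_pow₀ hk0
    nlinarith
  have ham : ∀ b ∈ F, b ≠ a.1 ∧ b ≠ m.1 := by
    intro b hb
    have := hB.notMem b hb
    simp at this
    exact ⟨this.1, this.2.2.2.1⟩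
  have haA : a.2 ⊆ A a.1 := hB.sub a (by simp)
  have hmA : m.2 ⊆ A m.1 := hB.sub m (by simp)
  obtain ⟨κ₁, hκ₁⟩ : ∃ κ₁ : ℝ, κ₁ = τ ^ J * κ := ⟨_, rfl⟩
  have hκ₁0 : 0 < κ₁ := by rw [hκ₁]; positivity
  rw [← hκ₁] at hε hε' ⊢
  obtain ⟨z, hz, F₁, hF₁, hF₁c, C₁, Y, hY⟩ := h.exists_rate (τ := τ) hJ hy hny hn hτ0 hτ1
    hκ m.2 m.1 F C hmA (fun hm => (ham _ hm).2 rfl) (fun b hb => (hB.right b hb).1)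
    hB.pool (by rw [← hκ₁]; nlinarith)
  rw [← hκ₁] at hY
  have hC₁A : ∀ b ∈ F₁, C₁ b ⊆ A b := fun b hb => (hY b hb).1.trans (hB.pool b (hF₁ hb)).1
  obtain ⟨e, D, he, hinj, hD, hfor⟩ := h.exists_grading a.2 a.1 haA k F₁ C₁ κ₁
    (fun hm => (ham _ (hF₁ hm)).1 rfl) (Nat.le_of_mul_le_mul_left (hF.trans hF₁c) hJ)
    (fun b hb => covers_mono (hB.left b (hF₁ hb)).1 (Finset.Subset.refl _) (hY b hb).1)
    (fun b hb => ⟨hC₁A b hb, (hY b hb).2.1⟩) hκ₁0.le hε.le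
  have hDA : ∀ j < k, D j ⊆ A (e j) := fun j hj => (hD j hj).1.trans (hC₁A _ (he j hj))
  have hDC₁ : ∀ j < k, ((C₁ (e j)).card : ℝ) ≤ 4 ^ k * (D j).card := fun j hj => by
    exact_mod_cast (hD j hj).2
  have hDc : ∀ j < k, κ₁ * (A (e j)).card ≤ 4 ^ k * (D j).card := fun j hj =>
    ((hY _ (he j hj)).2.1).trans (hDC₁ j hj)
  obtain ⟨q, r, hq0, hq, hr, hqr⟩ := exists_floor_bounds hz hy
  -- Each cover has at most `z * y` vertices and is cut into pieces of at most `z`. By the choice of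
  -- the rate, a piece covers at most a proportion `τ * 4 ^ k` of any `D j`.
  have hparts : ∀ i : Fin k, ∃ Z : ℕ → Finset V, (∀ b, Z b ⊆ Y (e i)) ∧ (∀ b, (Z b).card ≤ r) ∧
      ∀ w ∈ Y (e i), ∃ b < q, w ∈ Z b := fun i =>
    exists_parts _ q r (hqr _ (hY _ (he i i.2)).2.2.2.1)
  choose Z hZY hZr hZcov using hparts
  have hφ : ∀ (i : Fin k) (c : V), ∃ b, c ∈ D i → b < q ∧ ∃ w ∈ Z i b, G.Adj w c := by
    intro i c
    by_cases hc : c ∈ D i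
    · obtain ⟨w, hw, hwc⟩ := (hY _ (he i i.2)).2.2.2.2.1 c ((hD i i.2).1 hc)
      obtain ⟨b, hb, hwb⟩ := hZcov i w hw
      exact ⟨b, fun _ => ⟨hb, w, hwb, hwc⟩⟩
    · exact ⟨0, fun h => absurd h hc⟩
  choose φ hφ using hφ
  have hZm : ∀ (i : Fin k) b, Z i b ⊆ m.2 := fun i b =>
    (hZY i b).trans (hY _ (he i i.2)).2.2.1
  -- τ is defined so that `16 * k ^ 3 * μ = lam / 4 < η`, and the resulting linkage `2 * η` is
  -- `lam`.
  obtain ⟨b, B, hBprop, hBpair⟩ := exists_select (μ := τ * 4 ^ k) (η := lam / 2) (G := G) hk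
    (fun i : Fin k => D i)
    (fun i => by
      rw [← Finset.card_pos]
      have h1 := hDc i i.2
      have h2 := h.card_pos (e i)
      have h3 : (0 : ℝ) < (D i).card := by
        by_contra! hle
        have : 4 ^ k * ((D i).card : ℝ) ≤ 0 := mul_nonpos_of_nonneg_of_nonpos (by positivity) hle
        have : 0 < κ₁ * (A (e i)).card := by positivity
        linarith
      exact_mod_cast h3) φ hq0 (fun i c hc => (hφ i c hc).1) Z (fun i c hc => (hφ i c hc).2)
    (by positivity) (by linarith) (by positivity) (by
      have : 16 * (k : ℝ) ^ 3 * (τ * 4 ^ k) = lam / 4 := by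
        rw [hτ]
        field_simp
        ring
      rw [this]
      linarith)
    (fun i j hij v hv => by
      have h1 := h.link (e i) (e j) (fun hh => hij (Fin.ext (hinj i i.2 j j.2 hh))) v
        (hDA i i.2 hv)
      have h2 : ((nbr G {v} (D j)).card : ℝ) ≤ (nbr G {v} (A (e j))).card := by
        exact_mod_cast Finset.card_le_card (nbr_mono (Finset.Subset.refl _) (hDA j j.2))
      have h3 := hDc j j.2
      have h4 : ε * (A (e j)).card ≤ τ * κ₁ * (A (e j)).card := by gcongr
      have h5 : τ * (κ₁ * (A (e j)).card) ≤ τ * (4 ^ k * (D j).card) := by gcongr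
      linarith)
    (fun i j hij c => by
      have h1 := (hY _ (he j j.2)).2.2.2.2.2 (Z i c) (hZm i c)
        (le_trans (by exact_mod_cast hZr i c) hr)
      have h2 : ((nbr G (Z i c) (D j)).card : ℝ) ≤ (nbr G (Z i c) (C₁ (e j))).card := by
        exact_mod_cast Finset.card_le_card (nbr_mono (Finset.Subset.refl _) (hD j j.2).1)
      have h3 : τ * (C₁ (e j)).card ≤ τ * (4 ^ k * (D j).card) := by
        gcongr
        exact hDC₁ j j.2
      linarith)
  refine ⟨fun i => e i, B, fun i j hij => Fin.ext (hinj i i.2 j j.2 hij), fun i => ⟨hF₁ (he i i.2),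
    (hBprop i).2.1.trans ((hD i i.2).1.trans (hY _ (he i i.2)).1), ?_⟩, ?_, ?_, ?_⟩
  · have h1 : ((D i).card : ℝ) ≤ 4 * q * (B i).card := by exact_mod_cast (hBprop i).2.2.1
    have h2 := hDc i i.2
    rw [div_mul_eq_mul_div, div_le_iff₀ (by positivity)]
    calc κ₁ * (A (e i)).card ≤ 4 ^ k * (D i).card := h2
      _ ≤ 4 ^ k * (4 * q * (B i).card) := by gcongr
      _ ≤ 4 ^ k * (4 * (3 * y) * (B i).card) := by gcongr
      _ = _ := by ring
  · intro i j hij v hv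
    have := (hBpair i j hij).2 v hv
    linarith
  · intro j
    obtain ⟨Y', hY', h1, h2⟩ := hfor j j.2
    exact ⟨Y', hY', fun i hji => covers_mono (h1 i i.2 hji) (Finset.Subset.refl _) (hBprop i).2.1,
      fun i hij => anticomplete_mono (h2 i hij) (Finset.Subset.refl _) (hBprop i).2.1⟩
  · intro j
    -- Each chosen piece covers its own block and is anticomplete to the others, so any set of
    -- blocks could be separated this way; initial segments give the backward grading.
    refine ⟨(Finset.univ.filter fun i => i ≤ j).biUnion fun i => Z i (b i), ?_, ?_, ?_⟩
    · exact Finset.biUnion_subset.2 fun i _ => hZm i _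
    · intro i hij
      exact covers_mono (hBprop i).2.2.2 (Finset.subset_biUnion_of_mem (fun i => Z i (b i))
        (Finset.mem_filter.2 ⟨Finset.mem_univ i, hij⟩)) (Finset.Subset.refl _)
    · intro i hji w hw
      obtain ⟨l, hl, hwl⟩ := Finset.mem_biUnion.1 hw
      have hlj := (Finset.mem_filter.1 hl).2
      exact (hBpair l i (lt_of_le_of_lt hlj hji).ne).1 w hwl

/-- The expansion scale `x` limits the height through `n ≤ x ^ t`. The finer scale `y` is the only
one to appear in the size of the blocks; refining it raises `J`, which affects only the constants.
-/
theorem exists_biGrading {t J ℓ k : ℕ} (hJ : 0 < J) (hℓ : 3 * t + 1 ≤ ℓ) (hk : 1 ≤ k)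
    {lam : ℝ} (hlam : 0 < lam) (hlam1 : lam ≤ 1) : ∃ (N : ℕ) (κ ε₀ : ℝ), 0 < κ ∧ 0 < ε₀ ∧
    ∀ (V : Type u) (ι : Type v) [Fintype ι] (G : SimpleGraph V) (A : ι → Finset V)
      (ε x y n : ℝ), Sparse G A ε x → 0 < ε → ε ≤ ε₀ → 1 ≤ y → y ≤ x → n ≤ x ^ t → n ≤ y ^ J →
      (∀ X : Finset V, (X.card : ℝ) ≤ n) → N ≤ Fintype.card ι →
      ∃ (a : ι × Finset V) (L : List (ι × Finset V)) (s m : ι × Finset V)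
        (M : List (ι × Finset V)) (F : Finset ι) (C : ι → Finset V) (κ' : ℝ) (e : Fin k → ι)
        (B : Fin k → Finset V), BiLev G A κ' (a :: L) s (m :: M) F C ∧
        (a :: L).length + (m :: M).length = ℓ ∧ Function.Injective e ∧
      (∀ i, e i ∈ F ∧ B i ⊆ C (e i) ∧ κ * (A (e i)).card ≤ y * (B i).card) ∧
      (∀ i j, i ≠ j → ∀ v ∈ B i, ((nbr G {v} (B j)).card : ℝ) ≤ lam * (B j).card) ∧
      (∀ j, ∃ Y ⊆ a.2, (∀ i, j ≤ i → Covers G Y (B i)) ∧ ∀ i, i < j → Anticomplete G Y (B i)) ∧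
      ∀ j, ∃ Y ⊆ m.2, (∀ i, i ≤ j → Covers G Y (B i)) ∧
        ∀ i, j < i → Anticomplete G Y (B i) := by
  obtain ⟨τ, hτ⟩ : ∃ τ : ℝ, τ = lam / (64 * k ^ 3 * 4 ^ k) := ⟨_, rfl⟩
  have hk0 : (1 : ℝ) ≤ k := by exact_mod_cast hk
  have hτ0 : 0 < τ := by rw [hτ]; positivity
  obtain ⟨N₁, κ₁, ε₁, hκ₁, hε₁, H₁⟩ : ∃ (N₁ : ℕ) (κ₁ ε₁ : ℝ), 0 < κ₁ ∧ 0 < ε₁ ∧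
    ∀ (V : Type u) (ι : Type v) [Fintype ι] (G : SimpleGraph V) (A : ι → Finset V)
      (ε x y n : ℝ), Sparse G A ε x → 0 < ε → ε ≤ ε₁ → 1 ≤ y → y ≤ x → n ≤ x ^ t → n ≤ y ^ J →
      (∀ X : Finset V, (X.card : ℝ) ≤ n) → N₁ ≤ Fintype.card ι →
      ∃ L s M F C, BiLev G A κ₁ L s M F C ∧ J * k ≤ F.card ∧ L.length + M.length = ℓ := by
    obtain ⟨κ₀, ε₀, hκ₀, hε₀, H₀⟩ := exists_biLev.{u, v} t
    obtain ⟨N₂, κ₂, ε₂, hκ₂, hε₂, H₂⟩ := BiLev.exists_of_height.{u, v} hJ ℓ (J * k) ℓ κ₀ hκ₀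
    obtain ⟨N, H₀⟩ := H₀ N₂
    refine ⟨N, κ₂, min ε₀ ε₂, hκ₂, lt_min hε₀ hε₂, ?_⟩
    intro V ι _ G A ε x y n h hε hεle hy hyx hnx hny hn hN
    obtain ⟨L, s, M, F, C, hB, hF, hlen⟩ := H₀ V ι G A ε x n h hε (hεle.trans (min_le_left _ _))
      (hy.trans hyx) hnx hn hN
    exact H₂ V ι G A ε x y n h hε (hεle.trans (min_le_right _ _)) hy hyx hny hn L s M F C hB hF
      (hlen.trans hℓ) (by omega)
  refine ⟨N₁, τ ^ J * κ₁ / (12 * 4 ^ k), min ε₁ (min (τ ^ J * κ₁ / (2 * 4 ^ k))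
    (τ * (τ ^ J * κ₁))), by positivity, lt_min hε₁ (lt_min (by positivity) (by positivity)), ?_⟩
  intro V ι _ G A ε x y n h hε hεle hy hyx hnx hny hn hN
  obtain ⟨L, s, M, F, C, hB, hF, hlen⟩ := H₁ V ι G A ε x y n h hε (hεle.trans (min_le_left _ _)) hy
    hyx hnx hny hn hN
  obtain ⟨a, L, rfl⟩ := List.exists_cons_of_ne_nil hB.left_ne
  obtain ⟨m, M, rfl⟩ := List.exists_cons_of_ne_nil hB.right_ne
  have hε2 := (hεle.trans (min_le_right _ _)).trans (min_le_left _ _)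
  have hε3 := (hεle.trans (min_le_right _ _)).trans (min_le_right _ _)
  have hpos : 0 < τ ^ J * κ₁ := by positivity
  obtain ⟨e, B, h1, h2, h3, h4, h5⟩ := hB.exists_graded h hJ hk hy hny hn hκ₁ hlam hlam1 hτ hε (by
    rw [le_div_iff₀ (by positivity)] at hε2
    linarith) hε3 hF
  exact ⟨a, L, s, m, M, F, C, κ₁, e, B, hB, hlen, h1, h2, h3, h4, h5⟩

end

/-! ### From lists and finite families to levellings and blockades. -/

section

variable {V : Type*} {ι : Type*} {G : SimpleGraph V} {A : ι → Finset V} {κ : ℝ}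

/-- The levels of a levelling given as a list with its last level first. -/
def levelOf (l : List (ι × Finset V)) (i : ℕ) : Finset V :=
  l.reverse[i]?.elim ∅ Prod.snd

theorem levelOf_eq {l : List (ι × Finset V)} {i : ℕ} (hi : i < l.length) :
    levelOf l i = (l[l.length - 1 - i]).2 := by
  unfold levelOf
  rw [List.getElem?_eq_getElem (by simpa using hi), List.getElem_reverse]
  rfl

theorem levelOf_cons (c : ι × Finset V) (l : List (ι × Finset V)) :
    Function.update (levelOf l) l.length c.2 = levelOf (c :: l) := by
  funext i
  unfold levelOf
  rw [List.reverse_cons]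
  rcases lt_trichotomy i l.length with h | rfl | h
  · rw [Function.update_of_ne h.ne, List.getElem?_append_left (by simpa using h)]
  · rw [Function.update_self, List.getElem?_append_right (by simp)]
    simp
  · rw [Function.update_of_ne h.ne', List.getElem?_eq_none (by simp; omega),
      List.getElem?_eq_none (by simp; omega)]

theorem exists_levelOf_eq {l : List (ι × Finset V)} {i : ℕ} (hi : i < l.length) :
    ∃ p ∈ l, levelOf l i = p.2 :=
  ⟨_, List.getElem_mem _, levelOf_eq hi⟩

theorem levelOf_append_singleton_succ (l : List (ι × Finset V)) (s : ι × Finset V) (i : ℕ) :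
    levelOf (l ++ [s]) (i + 1) = levelOf l i := by
  simp [levelOf]

theorem levelOf_append_singleton_zero (l : List (ι × Finset V)) (s : ι × Finset V) :
    levelOf (l ++ [s]) 0 = s.2 := by
  simp [levelOf]

theorem Lev.getElem_covers {l : List (ι × Finset V)} (h : Lev G l) {i : ℕ}
    (hi : i + 1 < l.length) : Covers G (l[i + 1]).2 (l[i]).2 := by
  induction l generalizing i with
  | nil => simp at hi
  | cons b l ih =>
    cases i with
    | zero =>
      cases l with
      | nil => simp at hi
      | cons a l => exact h.1
    | succ i => exact ih h.tail (by simpa using hi)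

theorem Lev.getElem_anticomplete {l : List (ι × Finset V)} (h : Lev G l) {i j : ℕ}
    (hj : j < l.length) (hij : i + 2 ≤ j) : Anticomplete G (l[j]).2 (l[i]).2 := by
  induction l generalizing i j with
  | nil => simp at hj
  | cons b l ih =>
    obtain ⟨j, rfl⟩ : ∃ j', j = j' + 1 := ⟨j - 1, by omega⟩
    cases i with
    | zero =>
      cases l with
      | nil => simp at hj
      | cons a l =>
        obtain ⟨j, rfl⟩ : ∃ j', j = j' + 1 := ⟨j - 1, by omega⟩
        exact h.2.1 _ (List.getElem_mem _)
    | succ i => exact ih h.tail (by simpa using hj) (by omega)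

/-- Disjointness is not part of `Lev`; it comes from distinct block indices through
`pairwise_disjoint`. -/
theorem Lev.isLevelling {l : List (ι × Finset V)} {s : ι × Finset V} {k : ℕ}
    (h : Lev G (l ++ [s])) (hs : s.2.card = 1) (hk : l.length = k) (hk1 : 1 ≤ k)
    (hd : (l ++ [s]).Pairwise fun p q => Disjoint p.2 q.2) :
    IsLevelling G k (levelOf (l ++ [s])) := by
  have hlen : (l ++ [s]).length = k + 1 := by simp [hk]
  refine ⟨hk1, ?_, ?_, ?_, ?_⟩
  · intro i j hi hj hij
    rw [levelOf_eq (by omega), levelOf_eq (by omega)]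
    rw [List.pairwise_iff_getElem] at hd
    rcases lt_or_gt_of_ne hij with hij | hij
    · exact (hd _ _ (by omega) (by omega) (by omega)).symm
    · exact hd _ _ (by omega) (by omega) (by omega)
  · rw [levelOf_append_singleton_zero, hs]
  · intro i hi1 hi
    rw [levelOf_eq (by omega), levelOf_eq (by omega)]
    have := h.getElem_covers (i := (l ++ [s]).length - 1 - i) (by omega)
    convert this using 4
    omega
  · intro i j hi hik hj
    rw [levelOf_eq (by omega), levelOf_eq (by omega)]
    exact h.getElem_anticomplete (by omega) (by omega)

/-- The blockade with blocks `B 0`, …, `B (k - 1)`. -/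
def blockadeOf {k : ℕ} (B : Fin k → Finset V) (hne : ∀ i, (B i).Nonempty)
    (hd : ∀ i j, i ≠ j → Disjoint (B i) (B j)) : Blockade V where
  I := Finset.univ.image fun i : Fin k => ((i : ℕ) : ℤ)
  block z := if h : z.toNat < k then B ⟨z.toNat, h⟩ else ∅
  nonempty := by
    intro z hz
    obtain ⟨i, -, rfl⟩ := Finset.mem_image.1 hz
    simpa using hne i
  disjoint := by
    intro z hz w hw hzw
    obtain ⟨i, -, rfl⟩ := Finset.mem_image.1 hz
    obtain ⟨j, -, rfl⟩ := Finset.mem_image.1 hw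
    simpa using hd i j fun e => hzw (by rw [e])

section blockadeOf

variable {k : ℕ} {B : Fin k → Finset V} {hne : ∀ i, (B i).Nonempty}
  {hd : ∀ i j, i ≠ j → Disjoint (B i) (B j)}

theorem mem_blockadeOf_I {z : ℤ} : z ∈ (blockadeOf B hne hd).I ↔ ∃ i : Fin k, ((i : ℕ) : ℤ) = z := by
  simp [blockadeOf]

theorem blockadeOf_block (i : Fin k) : (blockadeOf B hne hd).block ((i : ℕ) : ℤ) = B i := by
  simp [blockadeOf]

theorem blockadeOf_length : (blockadeOf B hne hd).length = k := by
  unfold Blockade.length blockadeOf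
  rw [Finset.card_image_of_injective, Finset.card_univ, Fintype.card_fin]
  intro i j hij
  have h : ((i : ℕ) : ℤ) = ((j : ℕ) : ℤ) := hij
  exact Fin.ext (by exact_mod_cast h)

theorem mem_blockadeOf_unionOf {p : ℤ → Prop} {v : V} :
    v ∈ (blockadeOf B hne hd).unionOf p ↔ ∃ i : Fin k, p ((i : ℕ) : ℤ) ∧ v ∈ B i := by
  classical
  unfold Blockade.unionOf
  rw [Finset.mem_biUnion]
  constructor
  · rintro ⟨z, hz, hv⟩
    obtain ⟨hz, hp⟩ := Finset.mem_filter.1 hz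
    obtain ⟨i, rfl⟩ := mem_blockadeOf_I.1 hz
    rw [blockadeOf_block] at hv
    exact ⟨i, hp, hv⟩
  · rintro ⟨i, hp, hv⟩
    refine ⟨((i : ℕ) : ℤ), Finset.mem_filter.2 ⟨mem_blockadeOf_I.2 ⟨i, rfl⟩, hp⟩, ?_⟩
    rwa [blockadeOf_block]

theorem mem_blockadeOf_verts {v : V} : v ∈ (blockadeOf B hne hd).verts ↔ ∃ i, v ∈ B i := by
  unfold Blockade.verts
  rw [mem_blockadeOf_unionOf]
  simp

end blockadeOf

theorem card_filter_adj (v : V) (C : Finset V) [DecidablePred fun w => G.Adj v w] :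
    (C.filter fun w => G.Adj v w).card = (nbr G {v} C).card := by
  congr 1
  ext w
  simp [mem_nbr]

theorem card_nbr_le_maxDegreeTo {X Y : Finset V} {v : V} (hv : v ∈ X) :
    (nbr G {v} Y).card ≤ maxDegreeTo G X Y := by
  classical
  unfold maxDegreeTo
  refine le_trans (le_of_eq ?_) (Finset.le_sup hv)
  exact (card_filter_adj v Y).symm

theorem maxDegreeTo_le {X Y : Finset V} {a : ℝ} (ha : 0 ≤ a)
    (h : ∀ v ∈ X, ((nbr G {v} Y).card : ℝ) ≤ a) : (maxDegreeTo G X Y : ℝ) ≤ a := by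
  classical
  rw [← Nat.le_floor_iff ha]
  unfold maxDegreeTo
  refine Finset.sup_le fun v hv => ?_
  rw [Nat.le_floor_iff ha, card_filter_adj]
  exact h v hv

theorem linkage_le {𝓑 : Blockade V} {a : ℝ} (ha : 0 ≤ a)
    (h : ∀ i ∈ 𝓑.I, ∀ j ∈ 𝓑.I, i ≠ j → ∀ v ∈ 𝓑.block i,
      ((nbr G {v} (𝓑.block j)).card : ℝ) ≤ a * (𝓑.block j).card) : 𝓑.linkage G ≤ a := by
  unfold Blockade.linkage
  lift a to ℝ≥0 using ha
  rw [NNReal.coe_le_coe]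
  refine Finset.sup_le fun p hp => ?_
  obtain ⟨hi, hj, hij⟩ := Finset.mem_offDiag.1 hp
  have hpos : (0 : ℝ≥0) < (𝓑.block p.2).card := by
    exact_mod_cast (𝓑.nonempty _ hj).card_pos
  rw [div_le_iff₀ hpos, ← NNReal.coe_le_coe]
  push_cast
  exact maxDegreeTo_le (by positivity) (h _ hi _ hj hij)

theorem card_nbr_le_of_linkage {𝓑 : Blockade V} {a : ℝ} (h : 𝓑.linkage G ≤ a) {i j : ℤ}
    (hi : i ∈ 𝓑.I) (hj : j ∈ 𝓑.I) (hij : i ≠ j) {v : V} (hv : v ∈ 𝓑.block i) :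
    ((nbr G {v} (𝓑.block j)).card : ℝ) ≤ a * (𝓑.block j).card := by
  have h1 : ((maxDegreeTo G (𝓑.block i) (𝓑.block j) : ℝ≥0) / ((𝓑.block j).card : ℝ≥0) : ℝ≥0) ≤
      𝓑.linkage G := by
    unfold Blockade.linkage
    rw [NNReal.coe_le_coe]
    exact Finset.le_sup (f := fun p : ℤ × ℤ => (maxDegreeTo G (𝓑.block p.1) (𝓑.block p.2) : ℝ≥0) /
      ((𝓑.block p.2).card : ℝ≥0)) (b := (i, j)) (Finset.mem_offDiag.2 ⟨hi, hj, hij⟩)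
  have hpos : (0 : ℝ) < (𝓑.block j).card := by exact_mod_cast (𝓑.nonempty _ hj).card_pos
  have h2 := h1.trans h
  push_cast at h2
  rw [div_le_iff₀ hpos] at h2
  refine le_trans ?_ h2
  exact_mod_cast card_nbr_le_maxDegreeTo hv

theorem le_sizeOfSet {𝓐 : Blockade V} {X : Finset V} {i : ℤ} (hi : i ∈ 𝓐.I)
    (hX : X ⊆ 𝓐.block i) {a : ℝ} (ha : a * (𝓐.block i).card ≤ X.card) : a ≤ 𝓐.sizeOfSet X := by
  classical
  have hpos : (0 : ℝ) < (𝓐.block i).card := by exact_mod_cast (𝓐.nonempty _ hi).card_pos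
  rw [← le_div_iff₀ hpos] at ha
  refine ha.trans ?_
  unfold Blockade.sizeOfSet
  have h1 : ((X.card : ℝ≥0) / ((𝓐.block i).card : ℝ≥0) : ℝ≥0) ≤
      (𝓐.I.filter fun i => X ⊆ 𝓐.block i).sup fun i =>
        (X.card : ℝ≥0) / ((𝓐.block i).card : ℝ≥0) :=
    Finset.le_sup (f := fun i => (X.card : ℝ≥0) / ((𝓐.block i).card : ℝ≥0))
      (Finset.mem_filter.2 ⟨hi, hX⟩)
  have h2 := NNReal.coe_le_coe.2 h1
  push_cast at h2
  convert h2

/-- The conditions on the head are tested vertex by vertex. So a levelling that reaches each block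
of `𝓑` separately reaches their union. -/
theorem Lev.union {l : List (ι × Finset V)} {a c : ι × Finset V} {I : Type*} [Nonempty I]
    {b : I → ι × Finset V} (h : ∀ i, Lev G (b i :: a :: l))
    (hc : ∀ v ∈ c.2, ∃ i, v ∈ (b i).2) : Lev G (c :: a :: l) := by
  refine ⟨?_, ?_, (h (Classical.arbitrary I)).2.2⟩
  · intro v hv
    obtain ⟨i, hi⟩ := hc v hv
    exact (h i).1 v hi
  · intro x hx y hy v hv
    obtain ⟨i, hi⟩ := hc v hv
    exact (h i).2.1 x hx y hy v hi

theorem pairwise_disjoint {l : List (ι × Finset V)} (hnd : (l.map Prod.fst).Nodup)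
    (hsub : ∀ p ∈ l, p.2 ⊆ A p.1) (hA : ∀ i j, i ≠ j → Disjoint (A i) (A j)) :
    l.Pairwise fun p q => Disjoint p.2 q.2 := by
  have h1 : l.Pairwise fun p q => p.1 ≠ q.1 := List.pairwise_map.1 hnd
  refine h1.imp_of_mem fun hp hq hpq => ?_
  exact Finset.disjoint_of_subset_left (hsub _ hp)
    (Finset.disjoint_of_subset_right (hsub _ hq) (hA _ _ hpq))

/-- The levelling given by a list of levels and its apex. -/
def levellingOf (G : SimpleGraph V) (l : List (ι × Finset V)) (s : ι × Finset V)
    (h : IsLevelling G l.length (levelOf (l ++ [s]))) : Levelling G where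
  height := l.length
  level := levelOf (l ++ [s])
  isLevelling := h

theorem levellingOf_base {a s : ι × Finset V} {l : List (ι × Finset V)}
    (h : IsLevelling G (a :: l).length (levelOf (a :: l ++ [s]))) :
    (levellingOf G (a :: l) s h).base = a.2 := by
  change levelOf (a :: l ++ [s]) (a :: l).length = a.2
  rw [levelOf_eq (by simp)]
  simp

theorem levellingOf_reaches {s c : ι × Finset V} {l : List (ι × Finset V)} {X : Finset V}
    (h : IsLevelling G l.length (levelOf (l ++ [s]))) (hc : c.2 = X)
    (hlev : Lev G (c :: (l ++ [s]))) (hs : s.2.card = 1)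
    (hd : (c :: (l ++ [s])).Pairwise fun p q => Disjoint p.2 q.2) :
    (levellingOf G l s h).Reaches X := by
  have h1 : IsLevelling G (l.length + 1) (levelOf ((c :: l) ++ [s])) :=
    Lev.isLevelling (l := c :: l) hlev hs rfl (by omega) hd
  have h2 := levelOf_cons c (l ++ [s])
  rw [List.length_append, List.length_singleton, hc] at h2
  change IsLevelling G (l.length + 1) (Function.update (levelOf (l ++ [s])) (l.length + 1) X)
  rw [h2]
  exact h1

end

end BiGrade

/-! ### The theorem: choice of constants and verification. -/

open BiGrade in
theorem theorem8p1 (ℓ : ℤ) (c : ℝ) (hc : 0 < c) (hℓ : 3 * ⌈1 / c⌉ + 1 ≤ ℓ)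
    (k : ℕ) (hk : 1 ≤ k) (d lam' : ℝ) (hd : 0 < d) (hd1 : d ≤ 1)
    (hlam' : 0 < lam') (hlam'1 : lam' ≤ 1) :
    ∃ (K : ℕ) (lam : ℝ), 1 ≤ K ∧ 0 < lam ∧
      ∀ (V : Type*) [Fintype V] (G : SimpleGraph V) (𝓐 : Blockade V),
        𝓐.length = K → 𝓐.linkage G ≤ lam →
        ¬ 𝓐.Divergent G ((2 : ℝ) ^ (-6 - 2 * ℓ) / (K : ℝ))
            (((K : ℝ) ^ K)⁻¹ * (Fintype.card V : ℝ) ^ (-c)) →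
        ∃ (𝓛 𝓜 : Levelling G) (𝓑 : Blockade V),
          IsBiGrading 𝓛 𝓜 𝓑 ∧ IsRainbow 𝓐 𝓛 𝓜 𝓑 ∧
          𝓑.length = k ∧ (𝓛.height : ℤ) + (𝓜.height : ℤ) = ℓ ∧
          (2 : ℝ) ^ (-(k : ℤ) - 2 * ℓ) * ((K : ℝ) ^ K)⁻¹ * (Fintype.card V : ℝ) ^ (-d)
            ≤ 𝓐.sizeOf 𝓑 ∧
          𝓑.linkage G ≤ lam' := by
  have hceil : 0 < ⌈1 / c⌉ := Int.ceil_pos.2 (by positivity)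
  obtain ⟨t, ht⟩ := Int.eq_ofNat_of_zero_le hceil.le
  have hct : 1 ≤ c * t := by
    have h1 := Int.le_ceil (1 / c)
    rw [ht] at h1
    rw [div_le_iff₀ hc] at h1
    push_cast at h1
    linarith
  obtain ⟨ℓ', rfl⟩ := Int.eq_ofNat_of_zero_le (show 0 ≤ ℓ by omega)
  have hℓ' : 3 * t + 1 ≤ ℓ' := by
    rw [ht] at hℓ
    exact_mod_cast hℓ
  -- `d₀ ≤ c` makes the fine scale `n ^ d₀` at most `n ^ c`; `d₀ ≤ d` gives the required size.
  obtain ⟨d₀, hd₀, hd₀d, hd₀c⟩ : ∃ d₀ : ℝ, 0 < d₀ ∧ d₀ ≤ d ∧ d₀ ≤ c :=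
    ⟨min d c, lt_min hd hc, min_le_left _ _, min_le_right _ _⟩
  obtain ⟨J, hJ0, hJ⟩ : ∃ J : ℕ, 0 < J ∧ 1 ≤ d₀ * J := by
    refine ⟨⌈1 / d₀⌉₊, Nat.ceil_pos.2 (by positivity), ?_⟩
    have h1 := Nat.le_ceil (1 / d₀)
    rw [div_le_iff₀ hd₀] at h1
    linarith
  obtain ⟨N, κ, ε, hκ, hε, H⟩ := exists_biGrading hJ0 hℓ' hk hlam' hlam'1
  -- Besides supplying enough blocks, `K` absorbs every constant: already `1 / K` is below ε and κ,
  -- so the explicit powers of 2 in the statement are needed only to be at most 1.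
  obtain ⟨K, hK1, hKN, hKε, hKκ⟩ : ∃ K : ℕ, 1 ≤ K ∧ N ≤ K ∧ (K : ℝ)⁻¹ ≤ ε ∧ (K : ℝ)⁻¹ ≤ κ := by
    obtain ⟨K₁, hK₁⟩ := exists_nat_ge (ε⁻¹)
    obtain ⟨K₂, hK₂⟩ := exists_nat_ge (κ⁻¹)
    refine ⟨1 + N + K₁ + K₂, by omega, by omega, ?_, ?_⟩
    · rw [inv_le_comm₀ (by positivity) hε]
      refine hK₁.trans ?_
      exact_mod_cast (by omega : K₁ ≤ 1 + N + K₁ + K₂)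
    · rw [inv_le_comm₀ (by positivity) hκ]
      refine hK₂.trans ?_
      exact_mod_cast (by omega : K₂ ≤ 1 + N + K₁ + K₂)
  have hK1' : (1 : ℝ) ≤ K := by exact_mod_cast hK1
  have hKK : ((K : ℝ) ^ K)⁻¹ ≤ (K : ℝ)⁻¹ := by
    apply inv_anti₀ (by positivity)
    exact le_self_pow₀ hK1' (by omega)
  refine ⟨K, ε, hK1, hε, ?_⟩
  intro V _ G 𝓐 hlen hlink hdiv
  classical
  obtain ⟨n, hn⟩ : ∃ n : ℝ, n = Fintype.card V := ⟨_, rfl⟩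
  rw [← hn] at hdiv ⊢
  have hn1 : 1 ≤ n := by
    have h1 : 0 < 𝓐.I.card := by
      have : 𝓐.I.card = K := hlen
      omega
    obtain ⟨i, hi⟩ := Finset.card_pos.1 h1
    have h2 := (𝓐.nonempty i hi).card_pos
    have h3 := Finset.card_le_univ (𝓐.block i)
    rw [hn]
    exact_mod_cast h2.trans_le h3
  have hn0 : 0 < n := by linarith
  have hγ : (2 : ℝ) ^ (-6 - 2 * (ℓ' : ℤ)) / (K : ℝ) ≤ ε := by
    refine le_trans ?_ hKε
    rw [div_eq_mul_inv]
    refine mul_le_of_le_one_left (by positivity) ?_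
    exact zpow_le_one_of_nonpos₀ (by norm_num) (by omega)
  -- If expansion failed for `Y`, the vertices without neighbours in `Y` would form with `Y` a
  -- divergent pair, as both thresholds in the hypothesis are at most those of `Sparse`.
  have hsparse : Sparse G (fun i : {i // i ∈ 𝓐.I} => 𝓐.block i) ε (n ^ c) := by
    refine ⟨fun i => 𝓐.nonempty i i.2, fun i j hij => 𝓐.disjoint i i.2 j j.2 fun h =>
      hij (Subtype.ext h), fun i j hij v hv => card_nbr_le_of_linkage hlink i.2 j.2
        (fun h => hij (Subtype.ext h)) hv, ?_⟩
    intro i j hij Y hY hYc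
    by_contra! hlt
    refine hdiv ⟨i, i.2, j, j.2, fun h => hij (Subtype.ext h), nonNbr G Y (𝓐.block i),
      nonNbr_subset _ _, Y, hY, ?_, ?_, anticomplete_symm (anticomplete_nonNbr _ _)⟩
    · exact le_trans (by gcongr) hlt.le
    · have hx0 : 0 < n ^ c := Real.rpow_pos_of_pos hn0 c
      rw [Real.rpow_neg hn0.le]
      have h1 : ((K : ℝ) ^ K)⁻¹ * (𝓐.block j).card ≤ n ^ c * Y.card :=
        le_trans (by gcongr; exact hKK.trans hKε) hYc
      rw [mul_comm, ← mul_assoc, ← div_eq_mul_inv, div_le_iff₀ hx0]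
      linarith
  obtain ⟨a, L, s, m, M, F, C, κ', e, B, hB, hBlen, hinj, hBe, hBlink, hfor, hback⟩ :=
    H V {i // i ∈ 𝓐.I} G (fun i => 𝓐.block i) ε (n ^ c) (n ^ d₀) n hsparse hε le_rfl
      (Real.one_le_rpow hn1 hd₀.le) (Real.rpow_le_rpow_of_exponent_le hn1 hd₀c) (by
        rw [← Real.rpow_natCast, ← Real.rpow_mul hn0.le]
        exact Real.self_le_rpow_of_one_le hn1 hct) (by
        rw [← Real.rpow_natCast, ← Real.rpow_mul hn0.le]
        exact Real.self_le_rpow_of_one_le hn1 hJ) (fun X => by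
        rw [hn]
        exact_mod_cast Finset.card_le_univ X) (by
        rw [Fintype.card_coe]
        have : 𝓐.I.card = K := hlen
        omega)
  have hy0 : 0 < n ^ d₀ := Real.rpow_pos_of_pos hn0 d₀
  have hBA : ∀ i, B i ⊆ 𝓐.block (e i) := fun i =>
    (hBe i).2.1.trans (hB.pool _ (hBe i).1).1
  have hBne : ∀ i, (B i).Nonempty := by
    intro i
    rw [← Finset.card_pos]
    have h1 := (hBe i).2.2
    have h2 := hsparse.card_pos (e i)
    have h3 : 0 < κ * ((𝓐.block (e i)).card : ℝ) := mul_pos hκ h2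
    have h4 : (0 : ℝ) < (B i).card := pos_of_mul_pos_right (h3.trans_le h1) hy0.le
    exact_mod_cast h4
  have hBd : ∀ i j, i ≠ j → Disjoint (B i) (B j) := fun i j hij =>
    Finset.disjoint_of_subset_left (hBA i) (Finset.disjoint_of_subset_right (hBA j)
      (hsparse.disjoint _ _ fun h => hij (hinj h)))
  have : Nonempty (Fin k) := ⟨⟨0, hk⟩⟩
  obtain ⟨𝓑, h𝓑⟩ : ∃ 𝓑, 𝓑 = blockadeOf B hBne hBd := ⟨_, rfl⟩
  have hverts : ∀ v, v ∈ 𝓑.verts ↔ ∃ i, v ∈ B i := fun v => by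
    rw [h𝓑]; exact mem_blockadeOf_verts
  have hnd := hB.nodup
  have hndL : ((a :: L ++ [s]).map Prod.fst).Nodup := by
    refine List.Nodup.sublist (List.Sublist.map _ ?_) hnd
    simp
  have hndM : ((m :: M ++ [s]).map Prod.fst).Nodup := by
    have h1 : ((s :: m :: M).map Prod.fst).Nodup :=
      List.Nodup.sublist (List.Sublist.map _ (List.sublist_append_right _ _)) hnd
    have h2 : (m :: M ++ [s]).Perm (s :: m :: M) := List.perm_append_singleton _ _
    exact (h2.map Prod.fst).nodup_iff.2 h1
  have hsubL : ∀ p ∈ a :: L ++ [s], p.2 ⊆ 𝓐.block p.1 := fun p hp => hB.sub p (by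
    simp only [List.mem_append, List.mem_cons, List.not_mem_nil, or_false] at hp ⊢
    tauto)
  have hsubM : ∀ p ∈ m :: M ++ [s], p.2 ⊆ 𝓐.block p.1 := fun p hp => hB.sub p (by
    simp only [List.mem_append, List.mem_cons, List.not_mem_nil, or_false] at hp ⊢
    tauto)
  have hlevL : ∀ i, Lev G ((e i, B i) :: a :: (L ++ [s])) := fun i =>
    (hB.left _ (hBe i).1).replace_head (hBe i).2.1
  have hlevM : ∀ i, Lev G ((e i, B i) :: m :: (M ++ [s])) := fun i =>
    (hB.right _ (hBe i).1).replace_head (hBe i).2.1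
  obtain ⟨i₀⟩ : Nonempty (Fin k) := inferInstance
  have hvd : ∀ p ∈ a :: L ++ s :: m :: M, Disjoint 𝓑.verts p.2 := by
    intro p hp
    rw [Finset.disjoint_left]
    intro v hv hvp
    obtain ⟨i, hi⟩ := (hverts v).1 hv
    have hne : e i ≠ p.1 := fun h =>
      hB.notMem _ (hBe i).1 (h ▸ List.mem_map_of_mem hp)
    exact Finset.disjoint_left.1 (hsparse.disjoint _ _ hne) (hBA i hi) (hB.sub p hp hvp)
  have hpL := pairwise_disjoint hndL hsubL hsparse.disjoint
  have hpM := pairwise_disjoint hndM hsubM hsparse.disjoint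
  have hisL : IsLevelling G (a :: L).length (levelOf (a :: L ++ [s])) :=
    (hlevL i₀).tail.isLevelling (l := a :: L) hB.apex rfl (by simp) hpL
  have hisM : IsLevelling G (m :: M).length (levelOf (m :: M ++ [s])) :=
    (hlevM i₀).tail.isLevelling (l := m :: M) hB.apex rfl (by simp) hpM
  have hreachL : (levellingOf G (a :: L) s hisL).Reaches 𝓑.verts :=
    levellingOf_reaches (c := (e i₀, 𝓑.verts)) hisL rfl
      (Lev.union hlevL fun v hv => (hverts v).1 hv) hB.apex
      (List.pairwise_cons.2 ⟨fun p hp => hvd p (by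
        simp only [List.mem_append, List.mem_cons, List.not_mem_nil, or_false] at hp ⊢
        tauto), hpL⟩)
  have hreachM : (levellingOf G (m :: M) s hisM).Reaches 𝓑.verts :=
    levellingOf_reaches (c := (e i₀, 𝓑.verts)) hisM rfl
      (Lev.union hlevM fun v hv => (hverts v).1 hv) hB.apex
      (List.pairwise_cons.2 ⟨fun p hp => hvd p (by
        simp only [List.mem_append, List.mem_cons, List.not_mem_nil, or_false] at hp ⊢
        tauto), hpM⟩)
  have hunion : ∀ (p : ℤ → Prop) (v : V), v ∈ 𝓑.unionOf p ↔ ∃ i : Fin k, p ((i : ℕ) : ℤ) ∧ v ∈ B i :=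
    fun p v => by rw [h𝓑]; exact mem_blockadeOf_unionOf
  have hcons : ∀ X ∈ constituents (levellingOf G (a :: L) s hisL) (levellingOf G (m :: M) s hisM) 𝓑,
      ∃ p ∈ (a :: L ++ s :: m :: M) ++ List.ofFn fun i => (e i, B i), X = p.2 := by
    rintro X (⟨j, hj, rfl⟩ | ⟨i, hi, rfl⟩ | ⟨i, hi1, hi, rfl⟩)
    · rw [h𝓑] at hj
      obtain ⟨j, rfl⟩ := mem_blockadeOf_I.1 hj
      refine ⟨(e j, B j), List.mem_append_right _ (List.mem_ofFn.2 ⟨j, rfl⟩), ?_⟩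
      rw [h𝓑, blockadeOf_block]
    · change i ≤ (a :: L).length at hi
      obtain ⟨p, hp, hpe⟩ := exists_levelOf_eq (l := a :: L ++ [s]) (i := i) (by simpa using hi)
      refine ⟨p, List.mem_append_left _ ?_, hpe⟩
      simp only [List.mem_append, List.mem_cons, List.not_mem_nil, or_false] at hp ⊢
      tauto
    · change i ≤ (m :: M).length at hi
      obtain ⟨p, hp, hpe⟩ := exists_levelOf_eq (l := m :: M ++ [s]) (i := i) (by simpa using hi)
      refine ⟨p, List.mem_append_left _ ?_, hpe⟩
      simp only [List.mem_append, List.mem_cons, List.not_mem_nil, or_false] at hp ⊢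
      tauto
  have hfullsub : ∀ p ∈ (a :: L ++ s :: m :: M) ++ List.ofFn fun i => (e i, B i),
      p.2 ⊆ 𝓐.block p.1 := by
    intro p hp
    rcases List.mem_append.1 hp with hp | hp
    · exact hB.sub p hp
    · obtain ⟨i, rfl⟩ := List.mem_ofFn.1 hp
      exact hBA i
  have hfullne : ∀ p ∈ (a :: L ++ s :: m :: M) ++ List.ofFn fun i => (e i, B i),
      p.2.Nonempty := by
    intro p hp
    rcases List.mem_append.1 hp with hp | hp
    · rcases List.mem_append.1 hp with hp | hp
      · exact (hlevL i₀).nonempty (hBne i₀) p (List.mem_append_left [s] hp)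
      · refine (hlevM i₀).nonempty (hBne i₀) p ?_
        simp only [List.mem_append, List.mem_cons, List.not_mem_nil, or_false] at hp ⊢
        tauto
    · obtain ⟨i, rfl⟩ := List.mem_ofFn.1 hp
      exact hBne i
  have hfullnd : (((a :: L ++ s :: m :: M) ++ List.ofFn fun i => (e i, B i)).map
      Prod.fst).Nodup := by
    rw [List.map_append, List.nodup_append']
    refine ⟨hnd, ?_, ?_⟩
    · rw [List.map_ofFn, List.nodup_ofFn]
      exact hinj
    · intro x hx hx'
      obtain ⟨q, hq, rfl⟩ := List.mem_map.1 hx'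
      obtain ⟨i, rfl⟩ := List.mem_ofFn.1 hq
      exact hB.notMem _ (hBe i).1 hx
  -- A nonempty set lies in only one block of `𝓐`, so its index is determined; with distinct indices
  -- this gives the rainbow condition.
  have hfst : ∀ p ∈ (a :: L ++ s :: m :: M) ++ List.ofFn fun i => (e i, B i),
      ∀ i : {i // i ∈ 𝓐.I}, p.2 ⊆ 𝓐.block i → p.1 = i := by
    intro p hp i hi
    by_contra hne
    obtain ⟨v, hv⟩ := hfullne p hp
    exact Finset.disjoint_left.1 (hsparse.disjoint _ _ hne) (hfullsub p hp hv) (hi hv)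
  refine ⟨levellingOf G (a :: L) s hisL, levellingOf G (m :: M) s hisM, 𝓑,
    ⟨⟨⟨?_, ?_⟩, hreachL, hreachM, hreachL, ?_⟩, hreachM, ?_⟩, ⟨?_, ?_⟩, ?_, ?_, ?_, ?_⟩
  · change levelOf (a :: L ++ [s]) 0 = levelOf (m :: M ++ [s]) 0
    rw [levelOf_append_singleton_zero, levelOf_append_singleton_zero]
  · intro i j hi hiM hj hjL
    change i ≤ (m :: M).length at hiM
    change j ≤ (a :: L).length at hjL
    change Disjoint (levelOf (m :: M ++ [s]) i) (levelOf (a :: L ++ [s]) j) ∧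
      Anticomplete G (levelOf (m :: M ++ [s]) i) (levelOf (a :: L ++ [s]) j)
    obtain ⟨i, rfl⟩ : ∃ i', i = i' + 1 := ⟨i - 1, by omega⟩
    obtain ⟨j, rfl⟩ : ∃ j', j = j' + 1 := ⟨j - 1, by omega⟩
    rw [levelOf_append_singleton_succ, levelOf_append_singleton_succ]
    obtain ⟨q, hq, hqe⟩ := exists_levelOf_eq (l := m :: M) (i := i) (by omega)
    obtain ⟨p, hp, hpe⟩ := exists_levelOf_eq (l := a :: L) (i := j) (by omega)
    rw [hqe, hpe]
    refine ⟨?_, anticomplete_symm (hB.anti p hp q hq)⟩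
    have h1 := pairwise_disjoint hnd hB.sub hsparse.disjoint
    exact ((List.pairwise_append.1 h1).2.2 p hp q (List.mem_cons_of_mem _ hq)).symm
  · intro j hj
    rw [h𝓑] at hj
    obtain ⟨j, rfl⟩ := mem_blockadeOf_I.1 hj
    obtain ⟨Y, hY, h1, h2⟩ := hfor j
    refine ⟨Y, by rw [levellingOf_base]; exact hY, ?_, ?_⟩
    · intro v hv
      obtain ⟨i, hi, hvi⟩ := (hunion _ v).1 hv
      exact h1 i (by exact_mod_cast hi) v hvi
    · intro y hy v hv
      obtain ⟨i, hi, hvi⟩ := (hunion _ v).1 hv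
      exact h2 i (by exact_mod_cast hi) y hy v hvi
  · intro j hj
    rw [h𝓑] at hj
    obtain ⟨j, rfl⟩ := mem_blockadeOf_I.1 hj
    obtain ⟨Y, hY, h1, h2⟩ := hback j
    refine ⟨Y, by rw [levellingOf_base]; exact hY, ?_, ?_⟩
    · intro v hv
      obtain ⟨i, hi, hvi⟩ := (hunion _ v).1 hv
      exact h1 i (by exact_mod_cast hi) v hvi
    · intro y hy v hv
      obtain ⟨i, hi, hvi⟩ := (hunion _ v).1 hv
      exact h2 i (by exact_mod_cast hi) y hy v hvi
  · intro X hX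
    obtain ⟨p, hp, rfl⟩ := hcons X hX
    exact ⟨p.1, p.1.2, hfullsub p hp⟩
  · intro i hi X hX Y hY hXi hYi
    obtain ⟨p, hp, rfl⟩ := hcons X hX
    obtain ⟨q, hq, rfl⟩ := hcons Y hY
    have h1 : p.1 = q.1 := (hfst p hp ⟨i, hi⟩ hXi).trans (hfst q hq ⟨i, hi⟩ hYi).symm
    rw [List.inj_on_of_nodup_map hfullnd hp hq h1]
  · rw [h𝓑]
    exact blockadeOf_length
  · change ((a :: L).length : ℤ) + ((m :: M).length : ℤ) = ℓ'
    exact_mod_cast hBlen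
  · have : Nonempty 𝓑.I := by
      rw [h𝓑]
      exact ⟨⟨_, mem_blockadeOf_I.2 ⟨i₀, rfl⟩⟩⟩
    refine le_ciInf ?_
    rintro ⟨j, hj⟩
    change _ ≤ 𝓐.sizeOfSet (𝓑.block j)
    rw [h𝓑] at hj ⊢
    obtain ⟨j, rfl⟩ := mem_blockadeOf_I.1 hj
    rw [blockadeOf_block]
    refine le_sizeOfSet (e j).2 (hBA j) ?_
    have h1 : (2 : ℝ) ^ (-(k : ℤ) - 2 * (ℓ' : ℤ)) ≤ 1 :=
      zpow_le_one_of_nonpos₀ (by norm_num) (by omega)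
    have h2 : n ^ (-d) ≤ (n ^ d₀)⁻¹ := by
      rw [← Real.rpow_neg hn0.le]
      exact Real.rpow_le_rpow_of_exponent_le hn1 (by linarith)
    have h3 : (2 : ℝ) ^ (-(k : ℤ) - 2 * (ℓ' : ℤ)) * ((K : ℝ) ^ K)⁻¹ ≤ κ :=
      (mul_le_of_le_one_left (by positivity) h1).trans (hKK.trans hKκ)
    have h4 := mul_le_mul h3 h2 (by positivity) hκ.le
    refine (mul_le_mul_of_nonneg_right h4 (Nat.cast_nonneg _)).trans ?_
    rw [mul_right_comm, ← div_eq_mul_inv, div_le_iff₀ hy0, mul_comm ((B j).card : ℝ)]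
    exact (hBe j).2.2
  · refine linkage_le hlam'.le ?_
    rw [h𝓑]
    intro i hi j hj hij v hv
    obtain ⟨i, rfl⟩ := mem_blockadeOf_I.1 hi
    obtain ⟨j, rfl⟩ := mem_blockadeOf_I.1 hj
    rw [blockadeOf_block] at hv ⊢
    exact hBlink i j (fun h => hij (by rw [h])) v hv
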